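/- Let $d\ge 1$, let $U\subset\mathbb{R}^d$ be a bounded open set with smooth boundary, let $m\in(0,\infty)$, $n\in\mathbb{N}$, $f_1,\dots,f_n\in C_b^2(U)$, and let $z=(z^1,\dots,z^n)\in C([0,\infty);\mathbb{R}^n)$. Write $u^{[m]}:=|u|^{m-1}u$ and $\overline{\chi}(s,\xi):=\mathbf 1_{\{0<\xi<s\}}-\mathbf 1_{\{s<\xi<0\}}$. For $\rho_0\in C_c^\infty(U\times\mathbb{R})$ and $0\le s\le t$ put $$v_{s,t}(x):=\exp\Big(-\sum_{k=1}^n f_k(x)(z^k_t-z^k_s)\Big),\qquad \rho_{s,t}(x,\xi):=\rho_0\big(x,\xi\,v_{s,t}(x)\big)\,v_{s,t}(x).$$ For $u_0\in L^2(U)$, a *pathwise kinetic solution* of $du=\Delta u^{[m]}\,dt+\sum_k f_k(x)\,u\circ dz^k_t$ in $U\times(0,\infty)$, $u=0$ on $\partial U\times(0,\infty)$, with initial data $u_0$, is a function $u\in L^\infty_{\mathrm{loc}}([0,\infty);L^2(U))$ such that: (i) for each $T>0$, $u^{[\frac{m+1}{2}]}\in L^2([0,T];H^1_0(U))$; the parabolic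 defect measure is $q:=\frac{4m}{(m+1)^2}\,\delta_0(\xi-u(x,t))\,|\nabla u^{[\frac{m+1}{2}]}|^2$ on $U\times\mathbb{R}\times(0,\infty)$; (ii) for $\chi(x,\xi,t):=\overline\chi(u(x,t),\xi)$ there exist a nonnegative measure $p$ on $U\times\mathbb{R}\times(0,\infty)$, finite on $U\times\mathbb{R}\times(0,T)$ for each $T>0$, and a Lebesgue-null set $\mathcal N\subset(0,\infty)$ such that, for all $s<t$ in $[0,\infty)\setminus\mathcal N$ and all $\rho_0\in C_c^\infty(U\times\mathbb{R})$, $$\int_{\mathbb R}\int_U\chi\,\rho_{s,r}\,dx\,d\xi\,\Big|_{r=s}^{t}=\int_s^t\int_{\mathbb R}\int_U m|\xi|^{m-1}\chi\,\Delta_x\rho_{s,r}\,dx\,d\xi\,dr-\int_{U\times\mathbb{R}\times(s,t]}\partial_\xi\rho_{s,r}(x,\xi)\,d(p+q)(x,\xi,r),$$ where for $s=0$ the initial value is $\int_{\mathbb R}\int_U\chi(x,\xi,0)\rho_{0}\,dx\,d\xi=\int_{\mathbb R}\int_U\overline\chi(u_0(x),\xi)\rho_0(x,\xi)\,dx\,d\xi$.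 **Lemma A.1.** Let $p_m:=\min\big(\tfrac{m+1}{m},2\big)$. For each $T>0$ there is a constant $C>0$, depending only on $m$, $U$, $T$, $f=(f_k)_k$ and $z$, such that for every $u_0\in L^2(U)$ and every pathwise kinetic solution $u$ with initial data $u_0$, $$u^{[m]}\in L^{p_m}\big([0,T];W^{1,p_m}_0(U)\big)\quad\text{with}\quad \nabla u^{[m]}=\frac{2m}{m+1}\,|u|^{\frac{m-1}{2}}\,\nabla u^{[\frac{m+1}{2}]}$$ (when $m<1$ the right-hand side is read as $0$ where $u=0$), and, if $m\in[1,\infty)$, $$\|u^{[m]}\|^{p_m}_{L^{p_m}([0,T];W^{1,p_m}_0(U))}\le C\,\|u_0\|^2_{L^2(U)},$$ while, if $m\in(0,1)$, $$\|u^{[m]}\|^{2}_{L^{2}([0,T];W^{1,2}_0(U))}\le C\Big(\|u_0\|^{1+m}_{L^{1+m}(U)}+\|u_0\|_{L^2(U)}^{\frac{4m}{m+1}}\Big).$$ In particular, $u^{[m]}$ has vanishing trace on $\partial U\times(0,\infty)$: for almost every $t\in(0,\infty)$ the trace of $u^{[m]}(\cdot,t)$ on $\partial U$ is zero. -/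

import Mathlib

open MeasureTheory Set Filter Topology
open scoped ENNReal ContDiff

namespace PathwiseKinetic

/-- The Euclidean space `ℝ^d`. -/
abbrev Space (d : ℕ) : Type := EuclideanSpace ℝ (Fin d)

/-- The signed power `s^{[m]} = |s|^{m-1} s`. -/
noncomputable def spow (m s : ℝ) : ℝ := |s| ^ (m - 1) * s

/-- A bounded open set with smooth boundary: near each boundary point the set is the sublevel
set `{g < 0}` of a smooth function whose differential does not vanish at that point.
Connectedness is not required. -/
structure IsSmoothBoundedDomain {d : ℕ} (U : Set (Space d)) : Prop where
  isOpen : IsOpen U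
  isBounded : Bornology.IsBounded U
  smooth_boundary : ∀ x ∈ frontier U, ∃ V : Set (Space d), ∃ g : Space d → ℝ,
    IsOpen V ∧ x ∈ V ∧ ContDiff ℝ ∞ g ∧ fderiv ℝ g x ≠ 0 ∧ U ∩ V = {y ∈ V | g y < 0}

/-- `f ∈ C_b^2(U)`: `f` is twice continuously differentiable on the open set `U`, and it is
bounded there together with its derivatives of order one and two. -/
def IsCb2 {d : ℕ} (U : Set (Space d)) (f : Space d → ℝ) : Prop :=
  ContDiffOn ℝ 2 f U ∧
    ∃ M : ℝ, ∀ i : ℕ, i ≤ 2 → ∀ x ∈ U, ‖iteratedFDerivWithin ℝ i f U x‖ ≤ M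

/-! ### Sobolev spaces -/

/-- `φ ∈ C_c^∞(U)` (extended by zero). -/
structure IsTestFunction {X : Type*} [NormedAddCommGroup X] [NormedSpace ℝ X]
    (U : Set X) (φ : X → ℝ) : Prop where
  smooth : ContDiff ℝ ∞ φ
  compact : HasCompactSupport φ
  support_subset : tsupport φ ⊆ U

/-- `g` is the weak gradient of `f` on `U`. -/
def HasWeakGradient {d : ℕ} (U : Set (Space d)) (f : Space d → ℝ) (g : Space d → Space d) :
    Prop :=
  ∀ φ : Space d → ℝ, IsTestFunction U φ →
    ∫ x in U, f x • gradient φ x = - ∫ x in U, φ x • g x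

/-- `f ∈ W^{1,p}(U)` with `∇f = g`. -/
def MemW1p {d : ℕ} (U : Set (Space d)) (p : ℝ) (f : Space d → ℝ) (g : Space d → Space d) :
    Prop :=
  MemLp f (ENNReal.ofReal p) (volume.restrict U) ∧
  MemLp g (ENNReal.ofReal p) (volume.restrict U) ∧
  HasWeakGradient U f g

/-- The smooth functions `φ j` converge in `W^{1,p}(U)` to `f`, where `∇f = g`. -/
def TendstoW1p {d : ℕ} (U : Set (Space d)) (p : ℝ) (φ : ℕ → Space d → ℝ)
    (f : Space d → ℝ) (g : Space d → Space d) : Prop :=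
  Tendsto (fun j => eLpNorm (fun x => φ j x - f x) (ENNReal.ofReal p) (volume.restrict U))
    atTop (𝓝 0) ∧
  Tendsto (fun j => eLpNorm (fun x => gradient (φ j) x - g x) (ENNReal.ofReal p)
    (volume.restrict U)) atTop (𝓝 0)

/-- `f ∈ W^{1,p}_0(U)` with `∇f = g`: the function lies in the closure of `C_c^∞(U)` in
`W^{1,p}(U)`. -/
def MemW1pZero {d : ℕ} (U : Set (Space d)) (p : ℝ) (f : Space d → ℝ)
    (g : Space d → Space d) : Prop :=
  MemW1p U p f g ∧
    ∃ φ : ℕ → Space d → ℝ, (∀ j, IsTestFunction U (φ j)) ∧ TendstoW1p U p φ f g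

/-- The `p`-th power of the norm of `L^p([0,T]; W^{1,p}(U))` of a function `w` with spatial
gradient `G`, that is `∫_0^T (‖w(t)‖_{L^p(U)}^p + ‖∇w(t)‖_{L^p(U)}^p) dt`. -/
noncomputable def normPowLpW1p {d : ℕ} (U : Set (Space d)) (T p : ℝ) (w : ℝ → Space d → ℝ)
    (G : ℝ → Space d → Space d) : ℝ≥0∞ :=
  ∫⁻ t in Icc 0 T, ∫⁻ x in U, (‖w t x‖ₑ ^ p + ‖G t x‖ₑ ^ p)

/-- `w ∈ L^p([0,T]; W^{1,p}_0(U))` with `∇w = G` (gradient in space). -/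
structure MemLpW1pZero {d : ℕ} (U : Set (Space d)) (T p : ℝ) (w : ℝ → Space d → ℝ)
    (G : ℝ → Space d → Space d) : Prop where
  aestronglyMeasurable : AEStronglyMeasurable (Function.uncurry w)
    ((volume.restrict (Icc 0 T)).prod (volume.restrict U))
  aestronglyMeasurable_grad : AEStronglyMeasurable (Function.uncurry G)
    ((volume.restrict (Icc 0 T)).prod (volume.restrict U))
  mem : ∀ᵐ t ∂(volume.restrict (Icc 0 T)), MemW1pZero U p (w t) (G t)
  norm_lt_top : normPowLpW1p U T p w G < ⊤

/-- `f ∈ W^{1,p}(U)` has trace `b` on `∂U`: `f` is the limit in `W^{1,p}(U)` of functions smooth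
up to the boundary whose boundary values converge to `b` in `L^p(∂U)`, with respect to the
`(d-1)`-dimensional Hausdorff measure. -/
def HasTrace {d : ℕ} (U : Set (Space d)) (p : ℝ) (f b : Space d → ℝ) : Prop :=
  ∃ g : Space d → Space d, MemW1p U p f g ∧
    ∃ φ : ℕ → Space d → ℝ, (∀ j, ContDiff ℝ ∞ (φ j)) ∧ TendstoW1p U p φ f g ∧
      Tendsto (fun j => eLpNorm (fun x => φ j x - b x) (ENNReal.ofReal p)
        ((Measure.hausdorffMeasure ((d : ℝ) - 1)).restrict (frontier U))) atTop (𝓝 0)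

/-! ### Pathwise kinetic solutions -/

/-- The kinetic function `χ̄(s,ξ) = 1_{0 < ξ < s} - 1_{s < ξ < 0}`. -/
noncomputable def kinetic (s ξ : ℝ) : ℝ :=
  (if 0 < ξ ∧ ξ < s then 1 else 0) - (if s < ξ ∧ ξ < 0 then 1 else 0)

/-- The change of variables factor `v_{s,t}(x) = exp(-∑_k f_k(x) (z^k_t - z^k_s))`. -/
noncomputable def weight {d n : ℕ} (f : Fin n → Space d → ℝ) (z : ℝ → Fin n → ℝ) (s t : ℝ)
    (x : Space d) : ℝ :=
  Real.exp (- ∑ k, f k x * (z t k - z s k))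

/-- The backward characteristic `Π^{x,ξ}_{t,t-s} = ξ exp(∑_k f_k(x) (z^k_s - z^k_t))`. -/
noncomputable def backChar {d n : ℕ} (f : Fin n → Space d → ℝ) (z : ℝ → Fin n → ℝ) (s t : ℝ)
    (x : Space d) (ξ : ℝ) : ℝ :=
  ξ * Real.exp (∑ k, f k x * (z s k - z t k))

/-- The transported test function `ρ_{s,t}(x,ξ) = ρ₀(x, Π^{x,ξ}_{t,t-s}) v_{s,t}(x)`. -/
noncomputable def transported {d n : ℕ} (f : Fin n → Space d → ℝ) (z : ℝ → Fin n → ℝ)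
    (ρ₀ : Space d × ℝ → ℝ) (s t : ℝ) (x : Space d) (ξ : ℝ) : ℝ :=
  ρ₀ (x, backChar f z s t x ξ) * weight f z s t x

/-- The parabolic defect measure `q = (4m/(m+1)²) δ₀(ξ - u(x,t)) |G(x,t)|²` on
`U × ℝ × (0,∞)`, with points written `(x, ξ, t)`; here `G` stands for `∇u^{[(m+1)/2]}`. -/
noncomputable def parabolicDefect {d : ℕ} (m : ℝ) (U : Set (Space d)) (u : ℝ → Space d → ℝ)
    (G : ℝ → Space d → Space d) : Measure (Space d × ℝ × ℝ) :=
  (((volume.restrict (Ioi (0 : ℝ))).prod (volume.restrict U)).withDensity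
    (fun y => ENNReal.ofReal (4 * m / (m + 1) ^ 2 * ‖G y.1 y.2‖ ^ 2))).map
    (fun y => (y.2, u y.1 y.2, y.1))

/-- `u` is a pathwise kinetic solution, with initial data `u₀`, of
`du = Δ u^{[m]} dt + ∑_k f_k(x) u ∘ dz^k` in `U × (0,∞)` with `u = 0` on `∂U`.
The field `G` is `∇u^{[(m+1)/2]}`, `p` is the entropy defect measure, and `N` is the
exceptional set of times. -/
def IsPathwiseKineticSolution {d n : ℕ} (m : ℝ) (U : Set (Space d)) (f : Fin n → Space d → ℝ)
    (z : ℝ → Fin n → ℝ) (u₀ : Space d → ℝ) (u : ℝ → Space d → ℝ) : Prop :=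
  -- `u ∈ L^∞_loc([0,∞); L²(U))`
  AEStronglyMeasurable (Function.uncurry u)
    ((volume.restrict (Ioi (0 : ℝ))).prod (volume.restrict U)) ∧
  (∀ T : ℝ, 0 < T → ∃ M : ℝ, ∀ᵐ t ∂(volume.restrict (Icc 0 T)),
    eLpNorm (u t) 2 (volume.restrict U) ≤ ENNReal.ofReal M) ∧
  ∃ G : ℝ → Space d → Space d,
    -- `u^{[(m+1)/2]} ∈ L²([0,T]; H¹₀(U))`
    (∀ T : ℝ, 0 < T → MemLpW1pZero U T 2 (fun t x => spow ((m + 1) / 2) (u t x)) G) ∧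
    ∃ (p : Measure (Space d × ℝ × ℝ)) (N : Set ℝ),
      (∀ T : ℝ, 0 < T → p (U ×ˢ univ ×ˢ Ioo 0 T) < ⊤) ∧
      N ⊆ Ioi 0 ∧ volume N = 0 ∧
      -- the transported kinetic equation
      (∀ s t : ℝ, 0 ≤ s → s < t → s ∉ N → t ∉ N →
        ∀ ρ₀ : Space d × ℝ → ℝ, IsTestFunction (U ×ˢ univ) ρ₀ →
          (∫ ξ : ℝ, ∫ x in U, kinetic (u t x) ξ * transported f z ρ₀ s t x ξ)
            - (∫ ξ : ℝ, ∫ x in U, kinetic (u s x) ξ * transported f z ρ₀ s s x ξ)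
          = (∫ r in Ioc s t, ∫ ξ : ℝ, ∫ x in U, m * |ξ| ^ (m - 1) * kinetic (u r x) ξ *
                Laplacian.laplacian (fun y => transported f z ρ₀ s r y ξ) x)
            - ∫ y in U ×ˢ univ ×ˢ Ioc s t,
                deriv (fun ξ => transported f z ρ₀ s y.2.2 y.1 ξ) y.2.1
                ∂(p + parabolicDefect m U u G)) ∧
      -- the initial condition
      (∀ ρ₀ : Space d × ℝ → ℝ, IsTestFunction (U ×ˢ univ) ρ₀ →
        (∫ ξ : ℝ, ∫ x in U, kinetic (u 0 x) ξ * transported f z ρ₀ 0 0 x ξ)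
          = ∫ ξ : ℝ, ∫ x in U, kinetic (u₀ x) ξ * ρ₀ (x, ξ))

/-- The exponent `p_m = min((m+1)/m, 2)`. -/
noncomputable def pExp (m : ℝ) : ℝ := min ((m + 1) / m) 2

end PathwiseKinetic

open PathwiseKinetic

/-!
The kinetic equation is tested with products `φ(x) ψ(ξ)`, whose transport along the characteristics
is `φ v ψ(ξ v)`, where `v` is the weight. Testing with a nondecreasing `ψ` bounds the dissipation
`∫∫ v² ψ'(u v) |∇u^{[(m+1)/2]}|²`, which is the contribution of the parabolic defect measure, by the
initial datum and by a flux term containing `Δ_x (φ v ψ(ξ v))`; the entropy defect measure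
contributes with a favourable sign.

The functions `φ` and `ψ` must have compact support, and the cutoffs have to be removed without
boundary terms. This is where `u^{[(m+1)/2]} ∈ H¹₀(U)` enters. The cutoffs of
`IsSmoothBoundedDomain.exists_cutoffs` have second derivatives of size `κ²`, where `κ` is comparable
to the inverse distance to the boundary, and the Hardy inequality bounds
`∫ κ² |u|^{m+1} = ∫ κ² |u^{[(m+1)/2]}|²` by the `H¹` norm. Hence the flux created by the cutoffs is
dominated by an integrable function and tends to zero. The result is
`KineticEquationOn.energy_le`.

Two choices of `ψ` are needed. The identity gives the `L²` energy estimate: the Laplacian of `v²` is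
small as long as the driving signal moves little, so that the flux term is absorbed by the
dissipation through the Poincaré inequality (`exists_short_time_bound`); uniform continuity of the
signal allows to iterate this over a finite partition of `[0,T]`, chosen outside the exceptional
null set of times (`exists_gradient_bound`). For `m < 1` the regularized powers
`ψ(a) = a (a² + ε²)^{(m-1)/2}` give, as `ε → 0`, a bound of `∫∫ |u|^{m-1} |∇u^{[(m+1)/2]}|²`, where
the flux term `∫∫ |u|^{2m}` is a sublinear power of the energy
(`exists_weighted_gradient_bound`, `exists_sublinear_bound`). For `m ≥ 1` the energy estimate and
Young's inequality suffice.

These bounds say that the formal gradient of `u^{[m]} = (u^{[(m+1)/2]})^{[θ]}`, `θ = 2m/(m+1)`, is in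
`L^{p_m}`. That it is the gradient of an element of `W^{1,p_m}_0` follows from the chain rule
`MemW1pZero.spow_comp`, proved with smooth approximations of the signed power whose derivatives
vanish at the origin. The approximating test functions vanish on the boundary, which gives the
zero trace.
-/

namespace PathwiseKinetic

/-! ### Hardy and Poincaré inequalities for test functions -/

section Sobolev

variable {d : ℕ}

lemma norm_gradient (f : Space d → ℝ) (x : Space d) : ‖gradient f x‖ = ‖fderiv ℝ f x‖ := by
  simp [gradient]

lemma continuous_gradient {f : Space d → ℝ} (hf : ContDiff ℝ 1 f) : Continuous (gradient f) := by
  unfold gradient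
  exact (LinearIsometryEquiv.continuous _).comp (hf.continuous_fderiv one_ne_zero)

lemma hasCompactSupport_gradient {f : Space d → ℝ} (hf : HasCompactSupport f) :
    HasCompactSupport (gradient f) :=
  (hf.fderiv (𝕜 := ℝ)).comp_left (g := (InnerProductSpace.toDual ℝ (Space d)).symm) (by simp)

lemma IsTestFunction.continuous_gradient {U : Set (Space d)} {φ : Space d → ℝ}
    (h : IsTestFunction U φ) : Continuous (gradient φ) :=
  PathwiseKinetic.continuous_gradient (h.smooth.of_le (by norm_cast))

/-- A continuous compactly supported factor makes a product integrable as soon as the other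
factor is continuous on the support of the first. -/
lemma integrable_mul_of_continuousAt {X : Type*} [TopologicalSpace X] [MeasurableSpace X]
    [OpensMeasurableSpace X] {μ : Measure X} [IsFiniteMeasureOnCompacts μ] {W h : X → ℝ}
    (hW : Continuous W) (hc : HasCompactSupport W) (hh : ∀ x ∈ tsupport W, ContinuousAt h x) :
    Integrable (fun x => W x * h x) μ := by
  refine Continuous.integrable_of_hasCompactSupport ?_ hc.mul_right
  refine continuous_of_tsupport fun x hx => ?_
  exact hW.continuousAt.mul (hh x (tsupport_mul_subset_left hx))

/-- A Hardy inequality in a single direction: the weight may blow up wherever `σ` vanishes, as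
long as `σ` grows at a definite rate in the direction `e` on the support of `W`. -/
lemma integral_sq_div_sq_le {O : Set (Space d)} {W σ : Space d → ℝ} {e : Space d} {c : ℝ}
    (hW : IsTestFunction O W) (hc : 0 < c) (hσ : ContDiff ℝ 1 σ)
    (hpos : ∀ x ∈ tsupport W, 0 < σ x) (hder : ∀ x ∈ tsupport W, c ≤ fderiv ℝ σ x e) :
    c ^ 2 * ∫ x, W x * (W x / σ x ^ 2) ≤ 4 * ∫ x, fderiv ℝ W x e * fderiv ℝ W x e := by
  have hWc := hW.smooth.continuous
  have hWd : Continuous fun x => fderiv ℝ W x e :=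
    (hW.smooth.continuous_fderiv (by simp)).clm_apply continuous_const
  have hWds : HasCompactSupport fun x => fderiv ℝ W x e := hW.compact.fderiv_apply ℝ e
  have hWdiff : Differentiable ℝ W := hW.smooth.differentiable (by simp)
  have hσd : Differentiable ℝ σ := hσ.differentiable (by simp)
  have hσdc : Continuous fun x => fderiv ℝ σ x e :=
    (hσ.continuous_fderiv (by simp)).clm_apply continuous_const
  have hsub : tsupport (fun x => fderiv ℝ W x e) ⊆ tsupport W := tsupport_fderiv_apply_subset ℝ e
  have hσx : ∀ x ∈ tsupport W, σ x ≠ 0 := fun x hx => (hpos x hx).ne'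
  have hsqd : ∀ x, fderiv ℝ (fun x => W x * W x) x e = 2 * W x * fderiv ℝ W x e := fun x => by
    rw [fderiv_fun_mul (hWdiff x) (hWdiff x)]; simp; ring
  have hid : ∀ x ∈ tsupport W, fderiv ℝ (fun x => (σ x)⁻¹) x e
      = - fderiv ℝ σ x e / σ x ^ 2 := fun x hx => by
    have := ((hasDerivAt_inv (hσx x hx)).comp_hasFDerivAt x (hσd x).hasFDerivAt).fderiv
    rw [show (fun x => (σ x)⁻¹) = Inv.inv ∘ σ from rfl, this]
    simp only [_root_.smul_apply, smul_eq_mul]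
    ring
  have hsqs : tsupport (fun x => W x * W x) ⊆ tsupport W := tsupport_mul_subset_left
  have hI1 : Integrable (fun x => W x * (2 * fderiv ℝ W x e * (σ x)⁻¹)) :=
    integrable_mul_of_continuousAt hWc hW.compact fun x hx =>
      (hWd.continuousAt.const_mul 2).mul (hσ.continuous.continuousAt.inv₀ (hσx x hx))
  have hI2 : Integrable (fun x => W x * (W x * (fderiv ℝ σ x e / σ x ^ 2))) :=
    integrable_mul_of_continuousAt hWc hW.compact fun x hx =>
      hWc.continuousAt.mul (hσdc.continuousAt.div (hσ.continuous.continuousAt.pow 2)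
        (pow_ne_zero 2 (hσx x hx)))
  have hI3 : Integrable (fun x => W x * (W x / σ x ^ 2)) :=
    integrable_mul_of_continuousAt hWc hW.compact fun x hx =>
      hWc.continuousAt.div (hσ.continuous.continuousAt.pow 2) (pow_ne_zero 2 (hσx x hx))
  have hI4 : Integrable (fun x => fderiv ℝ W x e * fderiv ℝ W x e) :=
    integrable_mul_of_continuousAt hWd hWds fun x _ => hWd.continuousAt
  have hI5 : Integrable (fun x => W x * (W x * (σ x)⁻¹)) :=
    integrable_mul_of_continuousAt hWc hW.compact fun x hx =>
      hWc.continuousAt.mul (hσ.continuous.continuousAt.inv₀ (hσx x hx))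
  have key := integral_mul_fderiv_eq_neg_fderiv_mul_of_integrable
    (f := fun x => W x * W x) (g := fun x => (σ x)⁻¹) (v := e) (μ := volume)
    (hI1.congr (.of_forall fun x => by simp only [hsqd]; ring))
    (hI2.neg.congr (.of_forall fun x => by
      by_cases hx : x ∈ tsupport W
      · simp only [hid x hx, Pi.neg_apply]; ring
      · simp [image_eq_zero_of_notMem_tsupport hx]))
    (hI5.congr (.of_forall fun x => by simp only; ring))
    (fun x _ => (hWdiff x).mul (hWdiff x))
    (fun x hx => (hσd x).inv (hσx x (hsqs hx)))
  have key2 : ∫ x, W x * (W x * (fderiv ℝ σ x e / σ x ^ 2))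
      = ∫ x, W x * (2 * fderiv ℝ W x e * (σ x)⁻¹) := by
    have h1 : ∫ x, W x * W x * fderiv ℝ (fun x => (σ x)⁻¹) x e
        = - ∫ x, W x * (W x * (fderiv ℝ σ x e / σ x ^ 2)) := by
      rw [← integral_neg]
      refine integral_congr_ae (.of_forall fun x => ?_)
      by_cases hx : x ∈ tsupport W
      · simp only [hid x hx]; ring
      · simp [image_eq_zero_of_notMem_tsupport hx]
    have h2 : ∫ x, fderiv ℝ (fun x => W x * W x) x e * (σ x)⁻¹
        = ∫ x, W x * (2 * fderiv ℝ W x e * (σ x)⁻¹) :=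
      integral_congr_ae (.of_forall fun x => by simp only [hsqd]; ring)
    linarith [key, h1, h2]
  have h3 : c * ∫ x, W x * (W x / σ x ^ 2) ≤ ∫ x, W x * (W x * (fderiv ℝ σ x e / σ x ^ 2)) := by
    rw [← integral_const_mul]
    refine integral_mono (hI3.const_mul c) hI2 fun x => ?_
    by_cases hx : x ∈ tsupport W
    · have h := hder x hx
      have : 0 ≤ W x * W x / σ x ^ 2 := by have := mul_self_nonneg (W x); positivity
      calc c * (W x * (W x / σ x ^ 2)) = c * (W x * W x / σ x ^ 2) := by ring
        _ ≤ fderiv ℝ σ x e * (W x * W x / σ x ^ 2) := by gcongr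
        _ = _ := by ring
    · simp [image_eq_zero_of_notMem_tsupport hx]
  -- Young's inequality, with the constant that leaves half of the left-hand side
  have h4 : ∫ x, W x * (2 * fderiv ℝ W x e * (σ x)⁻¹)
      ≤ ∫ x, (c / 2 * (W x * (W x / σ x ^ 2)) + 2 / c * (fderiv ℝ W x e * fderiv ℝ W x e)) := by
    refine integral_mono hI1 ((hI3.const_mul _).add (hI4.const_mul _)) fun x => ?_
    have : 0 ≤ c / 2 * (W x * (σ x)⁻¹ - 2 / c * fderiv ℝ W x e) ^ 2 := by positivity
    have h' : c / 2 * (W x * (σ x)⁻¹ - 2 / c * fderiv ℝ W x e) ^ 2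
        = c / 2 * (W x * (W x / σ x ^ 2)) + 2 / c * (fderiv ℝ W x e * fderiv ℝ W x e)
          - W x * (2 * fderiv ℝ W x e * (σ x)⁻¹) := by field_simp; ring
    simp only
    linarith
  rw [integral_add (hI3.const_mul _) (hI4.const_mul _), integral_const_mul,
    integral_const_mul] at h4
  have h5 : c / 2 * ∫ x, W x * (W x / σ x ^ 2)
      ≤ 2 / c * ∫ x, fderiv ℝ W x e * fderiv ℝ W x e := by linarith
  have h6 := mul_le_mul_of_nonneg_left h5 (by positivity : 0 ≤ 2 * c)
  have e1 : 2 * c * (c / 2 * ∫ x, W x * (W x / σ x ^ 2))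
      = c ^ 2 * ∫ x, W x * (W x / σ x ^ 2) := by ring
  have e2 : 2 * c * (2 / c * ∫ x, fderiv ℝ W x e * fderiv ℝ W x e)
      = 4 * ∫ x, fderiv ℝ W x e * fderiv ℝ W x e := by field_simp; ring
  linarith

lemma enorm_sq_eq_ofReal (a : ℝ) : ‖a‖ₑ ^ 2 = ENNReal.ofReal (a ^ 2) := by
  rw [← ofReal_norm, ← ENNReal.ofReal_pow (norm_nonneg _), Real.norm_eq_abs, sq_abs]

lemma lintegral_enorm_sq_of_integrable {X : Type*} [MeasurableSpace X] {μ : Measure X}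
    {f : X → ℝ} (hf : Integrable (fun x => f x * f x) μ) :
    ∫⁻ x, ‖f x‖ₑ ^ 2 ∂μ = ENNReal.ofReal (∫ x, f x * f x ∂μ) := by
  rw [ofReal_integral_eq_lintegral_ofReal hf (.of_forall fun x => mul_self_nonneg _)]
  refine lintegral_congr fun x => ?_
  rw [enorm_sq_eq_ofReal, sq]

/-- The directional Hardy inequality for a unit direction, with the full gradient on the
right-hand side. -/
lemma lintegral_div_sq_le {O : Set (Space d)} {W σ : Space d → ℝ} {e : Space d} {c : ℝ}
    (hW : IsTestFunction O W) (hc : 0 < c) (he : ‖e‖ ≤ 1) (hσ : ContDiff ℝ 1 σ)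
    (hpos : ∀ x ∈ tsupport W, 0 < σ x) (hder : ∀ x ∈ tsupport W, c ≤ fderiv ℝ σ x e) :
    ∫⁻ x, ‖W x / σ x‖ₑ ^ 2 ≤ ENNReal.ofReal (4 / c ^ 2) * ∫⁻ x, ‖gradient W x‖ₑ ^ 2 := by
  have h := integral_sq_div_sq_le hW hc hσ hpos hder
  have hWd : Continuous fun x => fderiv ℝ W x e :=
    (hW.smooth.continuous_fderiv (by simp)).clm_apply continuous_const
  have hWds : HasCompactSupport fun x => fderiv ℝ W x e := hW.compact.fderiv_apply ℝ e
  have hI3 : Integrable (fun x => W x * (W x / σ x ^ 2)) :=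
    integrable_mul_of_continuousAt hW.smooth.continuous hW.compact fun x hx =>
      hW.smooth.continuous.continuousAt.div (hσ.continuous.continuousAt.pow 2)
        (pow_ne_zero 2 (hpos x hx).ne')
  have hI4 : Integrable (fun x => fderiv ℝ W x e * fderiv ℝ W x e) :=
    integrable_mul_of_continuousAt hWd hWds fun x _ => hWd.continuousAt
  have hI3' : Integrable (fun x => W x / σ x * (W x / σ x)) :=
    hI3.congr (.of_forall fun x => by simp only; ring)
  rw [lintegral_enorm_sq_of_integrable hI3']
  calc ENNReal.ofReal (∫ x, W x / σ x * (W x / σ x))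
      ≤ ENNReal.ofReal (4 / c ^ 2 * ∫ x, fderiv ℝ W x e * fderiv ℝ W x e) := by
        refine ENNReal.ofReal_le_ofReal ?_
        have : ∫ x, W x / σ x * (W x / σ x) = ∫ x, W x * (W x / σ x ^ 2) :=
          integral_congr_ae (.of_forall fun x => by simp only; ring)
        rw [this, div_mul_eq_mul_div, le_div_iff₀ (by positivity)]
        linarith
    _ = ENNReal.ofReal (4 / c ^ 2) * ∫⁻ x, ‖fderiv ℝ W x e‖ₑ ^ 2 := by
        rw [ENNReal.ofReal_mul (by positivity), lintegral_enorm_sq_of_integrable hI4]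
    _ ≤ _ := by
        gcongr with x
        rw [enorm_le_iff_norm_le, norm_gradient]
        exact ((fderiv ℝ W x).le_opNorm e).trans (mul_le_of_le_one_right (norm_nonneg _) he)

lemma setLIntegral_enorm_eq {E : Type*} [NormedAddCommGroup E] {U : Set (Space d)}
    {g : Space d → E} (hg : tsupport g ⊆ U) :
    ∫⁻ x in U, ‖g x‖ₑ ^ 2 = ∫⁻ x, ‖g x‖ₑ ^ 2 := by
  refine setLIntegral_eq_of_support_subset fun x hx => hg (subset_tsupport g ?_)
  intro h0
  simp [h0] at hx

lemma tsupport_gradient_subset (f : Space d → ℝ) : tsupport (gradient f) ⊆ tsupport f := by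
  refine (closure_mono fun x hx => ?_).trans (tsupport_fderiv_subset ℝ (f := f))
  intro h0
  exact hx (by simp [gradient, h0])

/-- **Poincaré's inequality** for test functions on a bounded set. -/
lemma exists_poincare_test (hd : 1 ≤ d) {U : Set (Space d)} (hU : Bornology.IsBounded U) :
    ∃ C : ℝ, 0 < C ∧ ∀ φ : Space d → ℝ, IsTestFunction U φ →
      ∫⁻ x in U, ‖φ x‖ₑ ^ 2 ≤ ENNReal.ofReal C * ∫⁻ x in U, ‖gradient φ x‖ₑ ^ 2 := by
  obtain ⟨R, hR0, hR⟩ := hU.exists_pos_norm_le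
  let e : Space d := EuclideanSpace.single ⟨0, hd⟩ 1
  have he : ‖e‖ = 1 := by simp [e]
  let L : Space d →L[ℝ] ℝ := innerSL ℝ e
  have hL : ∀ x ∈ U, |L x| ≤ R := fun x hx => by
    have := abs_real_inner_le_norm e x
    rw [he, one_mul] at this
    exact this.trans (hR x hx)
  have hσ : ContDiff ℝ 1 fun x => L x + 2 * R := by fun_prop
  refine ⟨4 * (3 * R) ^ 2, by positivity, fun φ hφ => ?_⟩
  have h := lintegral_div_sq_le (σ := fun x => L x + 2 * R) (e := e) (c := 1) hφ one_pos he.le hσ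
    (fun x hx => by have := abs_le.1 (hL x (hφ.support_subset hx)); linarith)
    (fun x _ => by
      rw [fderiv_add_const, L.fderiv]
      simp [L, he])
  rw [setLIntegral_enorm_eq hφ.support_subset,
    setLIntegral_enorm_eq ((tsupport_gradient_subset φ).trans hφ.support_subset)]
  calc ∫⁻ x, ‖φ x‖ₑ ^ 2
      ≤ ∫⁻ x, ENNReal.ofReal ((3 * R) ^ 2) * ‖φ x / (L x + 2 * R)‖ₑ ^ 2 := by
        refine lintegral_mono fun x => ?_
        by_cases hx : x ∈ tsupport φ
        · have h1 := abs_le.1 (hL x (hφ.support_subset hx))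
          have h2 : 0 < L x + 2 * R := by linarith
          rw [enorm_sq_eq_ofReal, enorm_sq_eq_ofReal, ← ENNReal.ofReal_mul (by positivity)]
          refine ENNReal.ofReal_le_ofReal ?_
          rw [div_pow, mul_div_assoc', le_div_iff₀ (by positivity), mul_comm]
          gcongr
          linarith
        · simp [image_eq_zero_of_notMem_tsupport hx]
    _ = ENNReal.ofReal ((3 * R) ^ 2) * ∫⁻ x, ‖φ x / (L x + 2 * R)‖ₑ ^ 2 :=
        lintegral_const_mul' _ _ ENNReal.ofReal_ne_top
    _ ≤ ENNReal.ofReal ((3 * R) ^ 2) * (ENNReal.ofReal (4 / 1 ^ 2) *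
          ∫⁻ x, ‖gradient φ x‖ₑ ^ 2) := by
        gcongr
    _ = _ := by
        rw [← mul_assoc, ← ENNReal.ofReal_mul (by positivity)]
        congr 2; ring

end Sobolev

/-! ### The space `W^{1,p}_0` as a closure of test functions -/

section SobolevClosure

variable {d : ℕ} {U : Set (Space d)}

lemma IsTestFunction.memLp {φ : Space d → ℝ} (h : IsTestFunction U φ) (p : ℝ≥0∞) :
    MemLp φ p (volume.restrict U) :=
  (h.smooth.continuous.memLp_of_hasCompactSupport h.compact).restrict U

lemma IsTestFunction.memLp_gradient {φ : Space d → ℝ} (h : IsTestFunction U φ) (p : ℝ≥0∞) :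
    MemLp (gradient φ) p (volume.restrict U) :=
  (h.continuous_gradient.memLp_of_hasCompactSupport
    (hasCompactSupport_gradient h.compact)).restrict U

lemma one_le_ofReal {p : ℝ} (hp : 1 ≤ p) : 1 ≤ ENNReal.ofReal p := by
  simpa using ENNReal.ofReal_le_ofReal hp

lemma ofReal_ne_zero_of_one_le {p : ℝ} (hp : 1 ≤ p) : ENNReal.ofReal p ≠ 0 :=
  (lt_of_lt_of_le one_pos (one_le_ofReal hp)).ne'

lemma lintegral_enorm_sq_eq_eLpNorm_sq {X E : Type*} [MeasurableSpace X] {μ : Measure X}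
    [NormedAddCommGroup E] (f : X → E) : ∫⁻ x, ‖f x‖ₑ ^ 2 ∂μ = eLpNorm f 2 μ ^ 2 := by
  have := eLpNorm_nnreal_pow_eq_lintegral (f := f) (μ := μ) (p := 2) two_ne_zero
  simpa using this.symm

lemma lintegral_enorm_rpow_eq_eLpNorm_rpow {X E : Type*} [MeasurableSpace X] {μ : Measure X}
    [NormedAddCommGroup E] (f : X → E) {p : ℝ} (hp : 0 < p) :
    ∫⁻ x, ‖f x‖ₑ ^ p ∂μ = eLpNorm f (ENNReal.ofReal p) μ ^ p := by
  have := eLpNorm_nnreal_pow_eq_lintegral (f := f) (μ := μ) (p := p.toNNReal)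
    (by simpa using hp)
  simpa [Real.coe_toNNReal _ hp.le, ENNReal.ofReal] using this.symm

/-- Dominated convergence in `L^p`, with the domination imposed on the difference. -/
lemma tendsto_eLpNorm_sub_of_dominated {X E : Type*} [MeasurableSpace X] {μ : Measure X}
    [NormedAddCommGroup E] {p : ℝ} (hp : 0 < p) {F : ℕ → X → E} {f : X → E} {b : X → ℝ}
    (hb : MemLp b (ENNReal.ofReal p) μ) (hF : ∀ j, AEStronglyMeasurable (F j) μ)
    (hf : AEStronglyMeasurable f μ) (hbound : ∀ j, ∀ᵐ x ∂μ, ‖F j x - f x‖ ≤ b x)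
    (hlim : ∀ᵐ x ∂μ, Tendsto (fun j => F j x) atTop (𝓝 (f x))) :
    Tendsto (fun j => eLpNorm (fun x => F j x - f x) (ENNReal.ofReal p) μ) atTop (𝓝 0) := by
  have hp0 : ENNReal.ofReal p ≠ 0 := by simpa using hp
  have key : Tendsto (fun j => ∫⁻ x, ‖F j x - f x‖ₑ ^ p ∂μ) atTop (𝓝 (∫⁻ _, 0 ∂μ)) := by
    refine tendsto_lintegral_of_dominated_convergence' (fun x => ‖b x‖ₑ ^ p)
      (fun j => ((hF j).sub hf).enorm.pow_const p) (fun j => ?_) ?_ ?_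
    · filter_upwards [hbound j] with x hx
      gcongr
      rw [enorm_le_iff_norm_le]
      exact hx.trans (le_abs_self _)
    · have := lintegral_rpow_enorm_lt_top_of_eLpNorm_lt_top hp0 ENNReal.ofReal_ne_top hb.2
      rw [ENNReal.toReal_ofReal hp.le] at this
      exact this.ne
    · filter_upwards [hlim] with x hx
      have h1 : Tendsto (fun j => F j x - f x) atTop (𝓝 0) := by
        simpa using hx.sub_const (f x)
      have h2 := (h1.enorm).ennrpow_const p
      simpa [hp] using h2
  rw [lintegral_zero] at key
  simp only [eLpNorm_eq_lintegral_rpow_enorm_toReal hp0 ENNReal.ofReal_ne_top,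
    ENNReal.toReal_ofReal hp.le]
  have h3 := key.ennrpow_const (1 / p)
  simpa [hp] using h3

/-- Approximating test functions may be chosen to converge almost everywhere, together with
their gradients. -/
lemma MemW1pZero.exists_seq {p : ℝ} (hp : 1 ≤ p) {f : Space d → ℝ} {g : Space d → Space d}
    (h : MemW1pZero U p f g) : ∃ φ : ℕ → Space d → ℝ, (∀ j, IsTestFunction U (φ j)) ∧
      TendstoW1p U p φ f g ∧
      (∀ᵐ x ∂(volume.restrict U), Tendsto (fun j => φ j x) atTop (𝓝 (f x))) ∧
      (∀ᵐ x ∂(volume.restrict U), Tendsto (fun j => gradient (φ j) x) atTop (𝓝 (g x))) := by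
  obtain ⟨⟨hf, hg, -⟩, φ, hφ, h1, h2⟩ := h
  have hp0 := ofReal_ne_zero_of_one_le hp
  obtain ⟨n1, hn1, ha1⟩ := (tendstoInMeasure_of_tendsto_eLpNorm hp0
    (fun j => ((hφ j).memLp (ENNReal.ofReal p)).1) hf.1 h1).exists_seq_tendsto_ae
  have h2' := h2.comp hn1.tendsto_atTop
  obtain ⟨n2, hn2, ha2⟩ := (tendstoInMeasure_of_tendsto_eLpNorm hp0
    (fun j => ((hφ (n1 j)).memLp_gradient (ENNReal.ofReal p)).1) hg.1 h2').exists_seq_tendsto_ae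
  refine ⟨fun j => φ (n1 (n2 j)), fun j => hφ _,
    ⟨h1.comp (hn1.tendsto_atTop.comp hn2.tendsto_atTop), h2'.comp hn2.tendsto_atTop⟩, ?_, ha2⟩
  filter_upwards [ha1] with x hx
  exact hx.comp hn2.tendsto_atTop

lemma tendsto_eLpNorm_of_sub {X E : Type*} [MeasurableSpace X] {μ : Measure X}
    [NormedAddCommGroup E] {p : ℝ≥0∞} (hp : 1 ≤ p) {F : ℕ → X → E} {f : X → E}
    (hF : ∀ j, AEStronglyMeasurable (F j) μ) (hf : MemLp f p μ)
    (h : Tendsto (fun j => eLpNorm (fun x => F j x - f x) p μ) atTop (𝓝 0)) :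
    Tendsto (fun j => eLpNorm (F j) p μ) atTop (𝓝 (eLpNorm f p μ)) := by
  have hup : Tendsto (fun j => eLpNorm f p μ + eLpNorm (fun x => F j x - f x) p μ) atTop
      (𝓝 (eLpNorm f p μ)) := by simpa using h.const_add (eLpNorm f p μ)
  have hlo : Tendsto (fun j => eLpNorm f p μ - eLpNorm (fun x => F j x - f x) p μ) atTop
      (𝓝 (eLpNorm f p μ)) := by
    simpa using ENNReal.Tendsto.sub tendsto_const_nhds h (Or.inl hf.2.ne)
  refine tendsto_of_tendsto_of_tendsto_of_le_of_le hlo hup (fun j => ?_) (fun j => ?_)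
  · rw [tsub_le_iff_right]
    have := eLpNorm_sub_le (hF j) ((hF j).sub hf.1) hp
    rw [sub_sub_cancel] at this
    exact this
  · have := eLpNorm_add_le hf.1 ((hF j).sub hf.1) hp
    rw [add_sub_cancel] at this
    exact this

/-- A weighted inequality that holds for test functions extends to `H¹₀(U)`. -/
lemma MemW1pZero.lintegral_weight_le {κ : Space d → ℝ≥0∞} (hκ : Measurable κ) {A B : ℝ≥0∞}
    (hA : A ≠ ⊤) (hB : B ≠ ⊤)
    (hineq : ∀ φ, IsTestFunction U φ → ∫⁻ x in U, κ x * ‖φ x‖ₑ ^ 2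
      ≤ A * (∫⁻ x in U, ‖φ x‖ₑ ^ 2) + B * ∫⁻ x in U, ‖gradient φ x‖ₑ ^ 2)
    {w : Space d → ℝ} {G : Space d → Space d} (hw : MemW1pZero U 2 w G) :
    ∫⁻ x in U, κ x * ‖w x‖ₑ ^ 2 ≤ A * (∫⁻ x in U, ‖w x‖ₑ ^ 2) + B * ∫⁻ x in U, ‖G x‖ₑ ^ 2 := by
  obtain ⟨φ, hφ, ⟨h1, h2⟩, ha, -⟩ := hw.exists_seq one_le_two
  rw [lintegral_enorm_sq_eq_eLpNorm_sq w, lintegral_enorm_sq_eq_eLpNorm_sq G]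
  have e2 : ENNReal.ofReal 2 = 2 := by simp
  rw [e2] at h1 h2
  have hwm : MemLp w 2 (volume.restrict U) := by have := hw.1.1; rwa [e2] at this
  have hGm : MemLp G 2 (volume.restrict U) := by have := hw.1.2.1; rwa [e2] at this
  have l1 := tendsto_eLpNorm_of_sub one_le_two (fun j => ((hφ j).memLp 2).1) hwm h1
  have l2 := tendsto_eLpNorm_of_sub one_le_two (fun j => ((hφ j).memLp_gradient 2).1) hGm h2
  have l3 : Tendsto (fun j => A * eLpNorm (φ j) 2 (volume.restrict U) ^ 2
      + B * eLpNorm (gradient (φ j)) 2 (volume.restrict U) ^ 2) atTop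
      (𝓝 (A * eLpNorm w 2 (volume.restrict U) ^ 2 + B * eLpNorm G 2 (volume.restrict U) ^ 2)) :=
    (ENNReal.Tendsto.const_mul (ENNReal.Tendsto.pow l1) (Or.inr hA)).add
      (ENNReal.Tendsto.const_mul (ENNReal.Tendsto.pow l2) (Or.inr hB))
  calc ∫⁻ x in U, κ x * ‖w x‖ₑ ^ 2
      ≤ ∫⁻ x in U, liminf (fun j => κ x * ‖φ j x‖ₑ ^ 2) atTop := by
        refine lintegral_mono_ae ?_
        filter_upwards [ha] with x hx
        have hsq : Tendsto (fun j => ‖φ j x‖ₑ ^ 2) atTop (𝓝 (‖w x‖ₑ ^ 2)) :=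
          ENNReal.Tendsto.pow hx.enorm
        by_cases h0 : ‖w x‖ₑ ^ 2 = 0
        · rw [h0, mul_zero]; exact zero_le
        · exact (ENNReal.Tendsto.const_mul hsq (Or.inl h0)).liminf_eq.ge
    _ ≤ liminf (fun j => ∫⁻ x in U, κ x * ‖φ j x‖ₑ ^ 2) atTop :=
        lintegral_liminf_le' fun j => hκ.aemeasurable.mul (((hφ j).memLp 2).1.enorm.pow_const 2)
    _ ≤ liminf (fun j => A * eLpNorm (φ j) 2 (volume.restrict U) ^ 2
          + B * eLpNorm (gradient (φ j)) 2 (volume.restrict U) ^ 2) atTop :=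
        liminf_le_liminf (.of_forall fun j => by
          have := hineq _ (hφ j)
          rwa [lintegral_enorm_sq_eq_eLpNorm_sq (φ j),
            lintegral_enorm_sq_eq_eLpNorm_sq (gradient (φ j))] at this)
    _ = _ := l3.liminf_eq

/-- **Poincaré's inequality** in `H¹₀` of a bounded set. -/
lemma exists_poincare (hd : 1 ≤ d) (hU : Bornology.IsBounded U) :
    ∃ C : ℝ, 0 < C ∧ ∀ (w : Space d → ℝ) (G : Space d → Space d), MemW1pZero U 2 w G →
      ∫⁻ x in U, ‖w x‖ₑ ^ 2 ≤ ENNReal.ofReal C * ∫⁻ x in U, ‖G x‖ₑ ^ 2 := by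
  obtain ⟨C, hC, h⟩ := exists_poincare_test hd hU
  refine ⟨C, hC, fun w G hw => ?_⟩
  have := hw.lintegral_weight_le (κ := fun _ => 1) (A := 0) measurable_const (by simp)
    ENNReal.ofReal_ne_top (fun φ hφ => by simpa only [one_mul, zero_mul, zero_add] using h φ hφ)
  simpa only [one_mul, zero_mul, zero_add] using this

lemma IsTestFunction.integral_smul_gradient {φ ψ : Space d → ℝ} (hφ : IsTestFunction U φ)
    (hψ : IsTestFunction U ψ) :
    ∫ x in U, φ x • gradient ψ x = - ∫ x in U, ψ x • gradient φ x := by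
  have hs : ∀ {φ ψ : Space d → ℝ}, IsTestFunction U φ → IsTestFunction U ψ →
      ∫ x in U, φ x • gradient ψ x = ∫ x, φ x • gradient ψ x := fun h1 _ => by
    refine setIntegral_eq_integral_of_forall_compl_eq_zero fun x hx => ?_
    rw [image_eq_zero_of_notMem_tsupport fun h => hx (h1.support_subset h), zero_smul]
  have hint : ∀ {φ ψ : Space d → ℝ}, IsTestFunction U φ → IsTestFunction U ψ →
      Integrable fun x => φ x • gradient ψ x := fun h1 h2 =>
    (h1.smooth.continuous.smul h2.continuous_gradient).integrable_of_hasCompactSupport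
      h1.compact.smul_right
  rw [hs hφ hψ, hs hψ hφ]
  refine ext_inner_left ℝ fun e => ?_
  rw [inner_neg_right, ← integral_inner (hint hφ hψ), ← integral_inner (hint hψ hφ)]
  have hd : ∀ {φ ψ : Space d → ℝ}, IsTestFunction U φ → IsTestFunction U ψ →
      Integrable fun x => φ x * fderiv ℝ ψ x e := fun h1 h2 =>
    integrable_mul_of_continuousAt h1.smooth.continuous h1.compact fun x _ =>
      ((h2.smooth.continuous_fderiv (by simp)).clm_apply continuous_const).continuousAt
  have key := integral_mul_fderiv_eq_neg_fderiv_mul_of_integrable (f := φ) (g := ψ) (v := e)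
    (μ := volume) ((hd hψ hφ).congr (.of_forall fun x => mul_comm _ _)) (hd hφ hψ)
    (integrable_mul_of_continuousAt hφ.smooth.continuous hφ.compact fun x _ =>
      hψ.smooth.continuous.continuousAt)
    (fun x _ => hφ.smooth.differentiable (by simp) x)
    (fun x _ => hψ.smooth.differentiable (by simp) x)
  simp only [inner_smul_right, inner_gradient_right, conj_trivial]
  rw [key]
  congr 2 with x
  ring

/-- A limit of test functions in `W^{1,p}(U)` has the limit of the gradients as weak gradient. -/
lemma hasWeakGradient_of_tendsto (hU : Bornology.IsBounded U) {p : ℝ} (hp : 1 ≤ p)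
    {f : Space d → ℝ} {g : Space d → Space d} (hf : MemLp f (ENNReal.ofReal p) (volume.restrict U))
    (hg : MemLp g (ENNReal.ofReal p) (volume.restrict U)) {φ : ℕ → Space d → ℝ}
    (hφ : ∀ j, IsTestFunction U (φ j)) (hlim : TendstoW1p U p φ f g) : HasWeakGradient U f g := by
  have : IsFiniteMeasure (volume.restrict U) := ⟨by simpa using hU.measure_lt_top⟩
  intro ψ hψ
  obtain ⟨K1, hK1⟩ := hψ.continuous_gradient.bounded_above_of_compact_support
    (hasCompactSupport_gradient hψ.compact)
  obtain ⟨K2, hK2⟩ := hψ.smooth.continuous.bounded_above_of_compact_support hψ.compact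
  -- on a set of finite measure, convergence in `L^p` implies convergence in `L¹`
  have hL1 : ∀ {E : Type} [NormedAddCommGroup E] {F : ℕ → Space d → E} {f : Space d → E},
      (∀ j, AEStronglyMeasurable (F j) (volume.restrict U)) →
      AEStronglyMeasurable f (volume.restrict U) →
      Tendsto (fun j => eLpNorm (fun x => F j x - f x) (ENNReal.ofReal p) (volume.restrict U))
        atTop (𝓝 0) →
      Tendsto (fun j => eLpNorm (fun x => F j x - f x) 1 (volume.restrict U)) atTop (𝓝 0) := by
    intro E _ F f hF hf h
    have hc : ENNReal.ofReal p ≠ 0 := ofReal_ne_zero_of_one_le hp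
    have h' := ENNReal.Tendsto.mul_const (b := volume.restrict U univ ^
        (1 / (1 : ℝ≥0∞).toReal - 1 / (ENNReal.ofReal p).toReal)) h (Or.inr ?_)
    · rw [zero_mul] at h'
      exact tendsto_of_tendsto_of_tendsto_of_le_of_le tendsto_const_nhds h' (fun j => zero_le)
        fun j => eLpNorm_le_eLpNorm_mul_rpow_measure_univ (one_le_ofReal hp) ((hF j).sub hf)
    · refine ENNReal.rpow_ne_top_of_nonneg ?_ (measure_ne_top _ _)
      rw [ENNReal.toReal_ofReal (by linarith), sub_nonneg]
      simpa using inv_le_one_of_one_le₀ hp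
  have t1 : Tendsto (fun j => ∫ x in U, φ j x • gradient ψ x) atTop
      (𝓝 (∫ x in U, f x • gradient ψ x)) := by
    refine tendsto_integral_of_L1' _ (hf.1.smul hψ.continuous_gradient.aestronglyMeasurable)
      (.of_forall fun j => ?_) ?_
    · exact (((hφ j).smooth.continuous.smul hψ.continuous_gradient).integrable_of_hasCompactSupport
        (hφ j).compact.smul_right).restrict
    · have h0 := hL1 (fun j => ((hφ j).memLp 1).1) hf.1 hlim.1
      have h1 := ENNReal.Tendsto.const_mul (a := ENNReal.ofReal K1) h0
        (Or.inr ENNReal.ofReal_ne_top)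
      rw [mul_zero] at h1
      refine tendsto_of_tendsto_of_tendsto_of_le_of_le tendsto_const_nhds h1 (fun j => zero_le)
        fun j => eLpNorm_le_mul_eLpNorm_of_ae_le_mul (.of_forall fun x => ?_) 1
      change ‖φ j x • gradient ψ x - f x • gradient ψ x‖ ≤ K1 * ‖φ j x - f x‖
      rw [← sub_smul, norm_smul, mul_comm]
      gcongr
      exact hK1 x
  have t2 : Tendsto (fun j => ∫ x in U, ψ x • gradient (φ j) x) atTop
      (𝓝 (∫ x in U, ψ x • g x)) := by
    refine tendsto_integral_of_L1' _ (hψ.smooth.continuous.aestronglyMeasurable.smul hg.1)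
      (.of_forall fun j => ?_) ?_
    · exact ((hψ.smooth.continuous.smul (hφ j).continuous_gradient).integrable_of_hasCompactSupport
        hψ.compact.smul_right).restrict
    · have h0 := hL1 (fun j => ((hφ j).memLp_gradient 1).1) hg.1 hlim.2
      have h1 := ENNReal.Tendsto.const_mul (a := ENNReal.ofReal K2) h0
        (Or.inr ENNReal.ofReal_ne_top)
      rw [mul_zero] at h1
      refine tendsto_of_tendsto_of_tendsto_of_le_of_le tendsto_const_nhds h1 (fun j => zero_le)
        fun j => eLpNorm_le_mul_eLpNorm_of_ae_le_mul (.of_forall fun x => ?_) 1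
      change ‖ψ x • gradient (φ j) x - ψ x • g x‖ ≤ K2 * ‖gradient (φ j) x - g x‖
      rw [← smul_sub, norm_smul]
      gcongr
      exact hK2 x
  refine tendsto_nhds_unique t1 ?_
  have : (fun j => ∫ x in U, φ j x • gradient ψ x) = fun j => -∫ x in U, ψ x • gradient (φ j) x :=
    funext fun j => (hφ j).integral_smul_gradient hψ
  rw [this]
  exact t2.neg

lemma memW1pZero_of_tendsto_test (hU : Bornology.IsBounded U) {p : ℝ} (hp : 1 ≤ p)
    {f : Space d → ℝ} {g : Space d → Space d} (hf : MemLp f (ENNReal.ofReal p) (volume.restrict U))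
    (hg : MemLp g (ENNReal.ofReal p) (volume.restrict U)) {φ : ℕ → Space d → ℝ}
    (hφ : ∀ j, IsTestFunction U (φ j)) (hlim : TendstoW1p U p φ f g) : MemW1pZero U p f g :=
  ⟨⟨hf, hg, hasWeakGradient_of_tendsto hU hp hf hg hφ hlim⟩, φ, hφ, hlim⟩

/-- `W^{1,p}_0(U)` is closed in `W^{1,p}(U)`. -/
lemma memW1pZero_of_tendsto (hU : Bornology.IsBounded U) {p : ℝ} (hp : 1 ≤ p)
    {f : Space d → ℝ} {g : Space d → Space d} (hf : MemLp f (ENNReal.ofReal p) (volume.restrict U))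
    (hg : MemLp g (ENNReal.ofReal p) (volume.restrict U)) {F : ℕ → Space d → ℝ}
    {Γ : ℕ → Space d → Space d} (hF : ∀ k, MemW1pZero U p (F k) (Γ k))
    (h1 : Tendsto (fun k => eLpNorm (fun x => F k x - f x) (ENNReal.ofReal p)
      (volume.restrict U)) atTop (𝓝 0))
    (h2 : Tendsto (fun k => eLpNorm (fun x => Γ k x - g x) (ENNReal.ofReal p)
      (volume.restrict U)) atTop (𝓝 0)) : MemW1pZero U p f g := by
  have hex : ∀ k : ℕ, ∃ φ : Space d → ℝ, IsTestFunction U φ ∧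
      eLpNorm (fun x => φ x - F k x) (ENNReal.ofReal p) (volume.restrict U)
        ≤ ENNReal.ofReal (1 / (k + 1)) ∧
      eLpNorm (fun x => gradient φ x - Γ k x) (ENNReal.ofReal p) (volume.restrict U)
        ≤ ENNReal.ofReal (1 / (k + 1)) := by
    intro k
    obtain ⟨-, φ, hφ, l1, l2⟩ := hF k
    have hpos : 0 < ENNReal.ofReal (1 / ((k : ℝ) + 1)) := by
      rw [ENNReal.ofReal_pos]; positivity
    obtain ⟨j, hj1, hj2⟩ := ((l1.eventually (ge_mem_nhds hpos)).and
      (l2.eventually (ge_mem_nhds hpos))).exists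
    exact ⟨φ j, hφ j, hj1, hj2⟩
  choose φ hφ e1 e2 using hex
  have h0 : Tendsto (fun k : ℕ => ENNReal.ofReal (1 / ((k : ℝ) + 1))) atTop (𝓝 0) := by
    simpa using ENNReal.tendsto_ofReal (tendsto_one_div_add_atTop_nhds_zero_nat (𝕜 := ℝ))
  refine memW1pZero_of_tendsto_test hU hp hf hg hφ ⟨?_, ?_⟩
  · have hs := h0.add h1
    rw [add_zero] at hs
    refine tendsto_of_tendsto_of_tendsto_of_le_of_le tendsto_const_nhds hs (fun _ => zero_le)
      fun k => ?_
    have := eLpNorm_add_le (p := ENNReal.ofReal p) (((hφ k).memLp 1).1.sub (hF k).1.1.1)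
      ((hF k).1.1.1.sub hf.1) (one_le_ofReal hp)
    refine le_trans ?_ (this.trans (add_le_add_left (e1 k) _))
    exact le_of_eq (congrArg (eLpNorm · _ _) (by ext x; simp))
  · have hs := h0.add h2
    rw [add_zero] at hs
    refine tendsto_of_tendsto_of_tendsto_of_le_of_le tendsto_const_nhds hs (fun _ => zero_le)
      fun k => ?_
    have := eLpNorm_add_le (p := ENNReal.ofReal p) (((hφ k).memLp_gradient 1).1.sub (hF k).1.2.1.1)
      ((hF k).1.2.1.1.sub hg.1) (one_le_ofReal hp)
    refine le_trans ?_ (this.trans (add_le_add_left (e2 k) _))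
    exact le_of_eq (congrArg (eLpNorm · _ _) (by ext x; simp))

end SobolevClosure

/-! ### Uniqueness of weak gradients and the chain rule -/

section ChainRule

variable {d : ℕ} {U : Set (Space d)}

/-- Weak gradients of a function in `H¹₀` are unique. -/
lemma MemW1pZero.gradient_unique (hUo : IsOpen U) (hU : Bornology.IsBounded U) {w : Space d → ℝ}
    {G₁ G₂ : Space d → Space d} (h₁ : MemW1pZero U 2 w G₁) (h₂ : MemW1pZero U 2 w G₂) :
    G₁ =ᵐ[volume.restrict U] G₂ := by
  have : IsFiniteMeasure (volume.restrict U) := ⟨by simpa using hU.measure_lt_top⟩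
  have i₁ : Integrable G₁ (volume.restrict U) := h₁.1.2.1.integrable (one_le_ofReal one_le_two)
  have i₂ : Integrable G₂ (volume.restrict U) := h₂.1.2.1.integrable (one_le_ofReal one_le_two)
  have hae := hUo.ae_eq_zero_of_integral_contDiff_smul_eq_zero (μ := volume.restrict U)
    (f := fun x => G₁ x - G₂ x) ((i₁.sub i₂).locallyIntegrable.locallyIntegrableOn U)
    (fun φ h1 h2 h3 => by
      have hφ : IsTestFunction U φ := ⟨h1, h2, h3⟩
      obtain ⟨K, hK⟩ := h1.continuous.bounded_above_of_compact_support h2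
      have j₁ : Integrable (fun x => φ x • G₁ x) (volume.restrict U) :=
        i₁.bdd_smul K h1.continuous.aestronglyMeasurable (.of_forall hK)
      have j₂ : Integrable (fun x => φ x • G₂ x) (volume.restrict U) :=
        i₂.bdd_smul K h1.continuous.aestronglyMeasurable (.of_forall hK)
      simp only [smul_sub]
      rw [integral_sub j₁ j₂]
      have e₁ := h₁.1.2.2 φ hφ
      have e₂ := h₂.1.2.2 φ hφ
      rw [e₁] at e₂
      rw [neg_inj.1 e₂, sub_self])
  filter_upwards [hae, ae_restrict_mem hUo.measurableSet] with x hx hxU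
  exact sub_eq_zero.1 (hx hxU)

lemma IsTestFunction.comp_smooth {φ : Space d → ℝ} (h : IsTestFunction U φ) {β : ℝ → ℝ}
    (hβ : ContDiff ℝ ∞ β) (h0 : β 0 = 0) : IsTestFunction U (fun x => β (φ x)) :=
  ⟨hβ.comp h.smooth, h.compact.comp_left h0,
    (tsupport_comp_subset h0 φ).trans h.support_subset⟩

lemma gradient_comp {φ : Space d → ℝ} {β : ℝ → ℝ} {x : Space d} (hβ : DifferentiableAt ℝ β (φ x))
    (hφ : DifferentiableAt ℝ φ x) :
    gradient (fun x => β (φ x)) x = deriv β (φ x) • gradient φ x := by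
  unfold gradient
  have := (hβ.hasDerivAt.comp_hasFDerivAt x hφ.hasFDerivAt).fderiv
  rw [show (fun x => β (φ x)) = β ∘ φ from rfl, this]
  simp

/-- Chain rule in `H¹₀`: composition with a smooth function of bounded derivative. -/
lemma MemW1pZero.comp_smooth (hU : Bornology.IsBounded U) {p : ℝ} (hp : 1 ≤ p) (hp2 : p ≤ 2)
    {w : Space d → ℝ} {G : Space d → Space d} (hw : MemW1pZero U 2 w G) {β : ℝ → ℝ}
    (hβ : ContDiff ℝ ∞ β) (h0 : β 0 = 0) {K : ℝ} (hK : ∀ s, |deriv β s| ≤ K) :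
    MemW1pZero U p (fun x => β (w x)) (fun x => deriv β (w x) • G x) := by
  have : IsFiniteMeasure (volume.restrict U) := ⟨by simpa using hU.measure_lt_top⟩
  have hp' : 0 < p := by linarith
  have hK0 : 0 ≤ K := (abs_nonneg _).trans (hK 0)
  have hpq : ENNReal.ofReal p ≤ ENNReal.ofReal 2 := ENNReal.ofReal_le_ofReal hp2
  obtain ⟨φ, hφ, hlim, ha, -⟩ := hw.exists_seq one_le_two
  have hdiff : Differentiable ℝ β := hβ.differentiable (by simp)
  have hdc : Continuous (deriv β) := hβ.continuous_deriv (by simp)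
  have hlip : LipschitzWith K.toNNReal β := lipschitzWith_of_nnnorm_deriv_le hdiff fun s => by
    rw [← NNReal.coe_le_coe, coe_nnnorm, Real.coe_toNNReal _ hK0]; exact hK s
  have hwm := hw.1.1.mono_exponent hpq
  have hGm := hw.1.2.1.mono_exponent hpq
  -- convergence in `L²` implies convergence in `L^p`
  have hlow : ∀ {E : Type} [NormedAddCommGroup E] {F : ℕ → Space d → E} {f : Space d → E},
      (∀ j, AEStronglyMeasurable (F j) (volume.restrict U)) →
      AEStronglyMeasurable f (volume.restrict U) →
      Tendsto (fun j => eLpNorm (fun x => F j x - f x) (ENNReal.ofReal 2) (volume.restrict U))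
        atTop (𝓝 0) →
      Tendsto (fun j => eLpNorm (fun x => F j x - f x) (ENNReal.ofReal p) (volume.restrict U))
        atTop (𝓝 0) := by
    intro E _ F f hF hf h
    have h' := ENNReal.Tendsto.mul_const (b := volume.restrict U univ ^
        (1 / (ENNReal.ofReal p).toReal - 1 / (ENNReal.ofReal 2).toReal)) h (Or.inr ?_)
    · rw [zero_mul] at h'
      exact tendsto_of_tendsto_of_tendsto_of_le_of_le tendsto_const_nhds h' (fun j => zero_le)
        fun j => eLpNorm_le_eLpNorm_mul_rpow_measure_univ hpq ((hF j).sub hf)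
    · refine ENNReal.rpow_ne_top_of_nonneg ?_ (measure_ne_top _ _)
      rw [ENNReal.toReal_ofReal hp'.le, ENNReal.toReal_ofReal zero_le_two, sub_nonneg]
      exact one_div_le_one_div_of_le hp' hp2
  have l1 := hlow (fun j => ((hφ j).memLp 1).1) hw.1.1.1 hlim.1
  have l2 := hlow (fun j => ((hφ j).memLp_gradient 1).1) hw.1.2.1.1 hlim.2
  have hβw : MemLp (fun x => β (w x)) (ENNReal.ofReal p) (volume.restrict U) :=
    hlip.comp_memLp h0 hwm
  have hβG : MemLp (fun x => deriv β (w x) • G x) (ENNReal.ofReal p) (volume.restrict U) :=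
    hGm.of_le_mul (c := K) ((hdc.comp_aestronglyMeasurable hwm.1).smul hGm.1)
      (.of_forall fun x => by
        rw [norm_smul]; gcongr; exact hK _)
  refine memW1pZero_of_tendsto_test hU hp hβw hβG (fun j => (hφ j).comp_smooth hβ h0) ⟨?_, ?_⟩
  · have h1 := ENNReal.Tendsto.const_mul (a := ENNReal.ofReal K) l1 (Or.inr ENNReal.ofReal_ne_top)
    rw [mul_zero] at h1
    refine tendsto_of_tendsto_of_tendsto_of_le_of_le tendsto_const_nhds h1 (fun _ => zero_le)
      fun j => eLpNorm_le_mul_eLpNorm_of_ae_le_mul (.of_forall fun x => ?_) _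
    have := hlip.norm_sub_le (φ j x) (w x)
    rwa [Real.coe_toNNReal _ hK0] at this
  · have h1 := ENNReal.Tendsto.const_mul (a := ENNReal.ofReal K) l2 (Or.inr ENNReal.ofReal_ne_top)
    rw [mul_zero] at h1
    have h2 : Tendsto (fun j => eLpNorm (fun x => deriv β (φ j x) • G x - deriv β (w x) • G x)
        (ENNReal.ofReal p) (volume.restrict U)) atTop (𝓝 0) := by
      refine tendsto_eLpNorm_sub_of_dominated hp' (hGm.norm.const_mul (2 * K))
        (fun j => (hdc.comp_aestronglyMeasurable
          ((hφ j).memLp 1).1).smul hGm.1) hβG.1 (fun j => .of_forall fun x => ?_) ?_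
      · rw [← sub_smul, norm_smul]
        gcongr
        calc ‖deriv β (φ j x) - deriv β (w x)‖ ≤ ‖deriv β (φ j x)‖ + ‖deriv β (w x)‖ :=
              norm_sub_le _ _
          _ ≤ K + K := add_le_add (hK _) (hK _)
          _ = 2 * K := by ring
      · filter_upwards [ha] with x hx
        exact ((hdc.tendsto _).comp hx).smul_const _
    have h3 := h1.add h2
    rw [add_zero] at h3
    refine tendsto_of_tendsto_of_tendsto_of_le_of_le tendsto_const_nhds h3 (fun _ => zero_le)
      fun j => ?_
    have hA : AEStronglyMeasurable (fun x => deriv β (φ j x) • (gradient (φ j) x - G x))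
        (volume.restrict U) := (hdc.comp_aestronglyMeasurable ((hφ j).memLp 1).1).smul
          (((hφ j).memLp_gradient 1).1.sub hGm.1)
    have hB : AEStronglyMeasurable (fun x => deriv β (φ j x) • G x - deriv β (w x) • G x)
        (volume.restrict U) := ((hdc.comp_aestronglyMeasurable
          ((hφ j).memLp 1).1).smul hGm.1).sub hβG.1
    have hsum := eLpNorm_add_le (p := ENNReal.ofReal p) hA hB (one_le_ofReal hp)
    have heq : (fun x => gradient (fun x => β (φ j x)) x - deriv β (w x) • G x)
        = (fun x => deriv β (φ j x) • (gradient (φ j) x - G x))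
          + (fun x => deriv β (φ j x) • G x - deriv β (w x) • G x) := by
      ext1 x
      rw [gradient_comp (hdiff _) ((hφ j).smooth.differentiable (by simp) x)]
      simp [smul_sub]
    rw [heq]
    refine hsum.trans (add_le_add_left (eLpNorm_le_mul_eLpNorm_of_ae_le_mul
      (.of_forall fun x => ?_) _) _)
    rw [norm_smul]
    gcongr
    exact hK _

/-- The smooth functions `y³ (y² + ε²)^{(θ-3)/2} (1 + ε² y²)^{-1/2}`. They approximate the signed
power `y^{[θ]}` as `ε → 0`; their derivative vanishes at the origin, which keeps the chain rule
meaningful for `θ < 1`, and it is bounded thanks to the last factor. -/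
noncomputable def powApprox (θ ε y : ℝ) : ℝ :=
  y ^ 3 * (y ^ 2 + ε ^ 2) ^ ((θ - 3) / 2) * (1 + ε ^ 2 * y ^ 2) ^ (-(1 / 2) : ℝ)

/-- The derivative of `powApprox θ ε`. -/
noncomputable def powApproxDeriv (θ ε y : ℝ) : ℝ :=
  (3 * y ^ 2 * (y ^ 2 + ε ^ 2) ^ ((θ - 3) / 2)
      + y ^ 4 * ((θ - 3) * (y ^ 2 + ε ^ 2) ^ ((θ - 3) / 2 - 1)))
      * (1 + ε ^ 2 * y ^ 2) ^ (-(1 / 2) : ℝ)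
    - y ^ 4 * (y ^ 2 + ε ^ 2) ^ ((θ - 3) / 2) * ε ^ 2
      * (1 + ε ^ 2 * y ^ 2) ^ (-(1 / 2) - 1 : ℝ)

lemma hasDerivAt_powApprox {ε : ℝ} (hε : 0 < ε) (θ y : ℝ) :
    HasDerivAt (powApprox θ ε) (powApproxDeriv θ ε y) y := by
  have hA : 0 < y ^ 2 + ε ^ 2 := by positivity
  have hB : 0 < 1 + ε ^ 2 * y ^ 2 := by positivity
  have h1 : HasDerivAt (fun y : ℝ => y ^ 2 + ε ^ 2) (2 * y) y := by
    simpa using (hasDerivAt_pow 2 y).add_const (ε ^ 2)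
  have h2 : HasDerivAt (fun y : ℝ => 1 + ε ^ 2 * y ^ 2) (ε ^ 2 * (2 * y)) y := by
    simpa using ((hasDerivAt_pow 2 y).const_mul (ε ^ 2)).const_add 1
  have h := (((hasDerivAt_pow 3 y).fun_mul (h1.rpow_const (p := (θ - 3) / 2)
    (Or.inl hA.ne'))).fun_mul
    (h2.rpow_const (p := (-(1 / 2) : ℝ)) (Or.inl hB.ne')))
  refine h.congr_deriv ?_
  unfold powApproxDeriv
  push_cast
  ring

lemma contDiff_powApprox {ε : ℝ} (hε : 0 < ε) (θ : ℝ) : ContDiff ℝ ∞ (powApprox θ ε) := by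
  unfold powApprox
  refine ((contDiff_id.pow 3).mul (ContDiff.rpow_const_of_ne (by fun_prop) fun y => ?_)).mul
    (ContDiff.rpow_const_of_ne (by fun_prop) fun y => ?_) <;> positivity

lemma sq_rpow_half_sub {y : ℝ} (θ : ℝ) : (y ^ 2) ^ ((θ - 3) / 2) = |y| ^ (θ - 3) := by
  rw [← sq_abs, ← Real.rpow_natCast, ← Real.rpow_mul (abs_nonneg _)]
  congr 1
  push_cast; ring

lemma sq_mul_rpow_eq {y : ℝ} (hy : y ≠ 0) (θ : ℝ) : y ^ 2 * |y| ^ (θ - 3) = |y| ^ (θ - 1) := by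
  rw [← sq_abs, ← Real.rpow_natCast, ← Real.rpow_add (abs_pos.2 hy)]
  congr 1
  push_cast; ring

lemma abs_powApproxDeriv_le {ε : ℝ} (hε : 0 < ε) {θ : ℝ} (h0 : 0 < θ) (h2 : θ ≤ 2) (y : ℝ) :
    |powApproxDeriv θ ε y| ≤ 7 * (y ^ 2 * (y ^ 2 + ε ^ 2) ^ ((θ - 3) / 2)
      * (1 + ε ^ 2 * y ^ 2) ^ (-(1 / 2) : ℝ)) := by
  have hA : 0 < y ^ 2 + ε ^ 2 := by positivity
  have hB : 0 < 1 + ε ^ 2 * y ^ 2 := by positivity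
  unfold powApproxDeriv
  rw [Real.rpow_sub_one hA.ne', Real.rpow_sub_one hB.ne']
  set A := (y ^ 2 + ε ^ 2) ^ ((θ - 3) / 2)
  set B := (1 + ε ^ 2 * y ^ 2) ^ (-(1 / 2) : ℝ)
  have hA0 : 0 ≤ A := by positivity
  have hB0 : 0 ≤ B := by positivity
  set a := y ^ 2 / (y ^ 2 + ε ^ 2) with ha
  set b := ε ^ 2 * y ^ 2 / (1 + ε ^ 2 * y ^ 2) with hb
  have ha1 : a ≤ 1 := div_le_one_of_le₀ (by nlinarith [sq_nonneg ε]) hA.le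
  have hb1 : b ≤ 1 := div_le_one_of_le₀ (by linarith) hB.le
  have ha0 : 0 ≤ a := by positivity
  have hb0 : 0 ≤ b := by positivity
  have e : (3 * y ^ 2 * A + y ^ 4 * ((θ - 3) * (A / (y ^ 2 + ε ^ 2)))) * B
      - y ^ 4 * A * ε ^ 2 * (B / (1 + ε ^ 2 * y ^ 2))
      = (3 + (θ - 3) * a - b) * (y ^ 2 * A * B) := by
    rw [ha, hb]; field_simp
  rw [e, abs_mul, abs_of_nonneg (by positivity : 0 ≤ y ^ 2 * A * B)]
  gcongr
  rw [abs_le]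
  constructor <;> nlinarith

lemma abs_powApproxDeriv_le_rpow {ε : ℝ} (hε : 0 < ε) {θ : ℝ} (h0 : 0 < θ) (h2 : θ ≤ 2) (y : ℝ) :
    |powApproxDeriv θ ε y| ≤ 7 * |y| ^ (θ - 1) := by
  rcases eq_or_ne y 0 with rfl | hy
  · simp only [powApproxDeriv]
    norm_num
    positivity
  refine (abs_powApproxDeriv_le hε h0 h2 y).trans ?_
  have hA : (y ^ 2 + ε ^ 2) ^ ((θ - 3) / 2) ≤ |y| ^ (θ - 3) := by
    rw [← sq_rpow_half_sub]
    exact Real.rpow_le_rpow_of_nonpos (by positivity) (by nlinarith [sq_nonneg ε]) (by linarith)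
  have hB : (1 + ε ^ 2 * y ^ 2) ^ (-(1 / 2) : ℝ) ≤ 1 :=
    Real.rpow_le_one_of_one_le_of_nonpos (by nlinarith [mul_nonneg (sq_nonneg ε) (sq_nonneg y)])
      (by norm_num)
  rw [← sq_mul_rpow_eq hy]
  calc 7 * (y ^ 2 * (y ^ 2 + ε ^ 2) ^ ((θ - 3) / 2) * (1 + ε ^ 2 * y ^ 2) ^ (-(1 / 2) : ℝ))
      ≤ 7 * (y ^ 2 * |y| ^ (θ - 3) * 1) := by gcongr
    _ = _ := by ring

lemma abs_powApprox_le {ε : ℝ} (hε : 0 < ε) {θ : ℝ} (h2 : θ ≤ 2) (y : ℝ) :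
    |powApprox θ ε y| ≤ |spow θ y| := by
  rcases eq_or_ne y 0 with rfl | hy
  · simp [powApprox, spow]
  have hA : (y ^ 2 + ε ^ 2) ^ ((θ - 3) / 2) ≤ |y| ^ (θ - 3) := by
    rw [← sq_rpow_half_sub]
    exact Real.rpow_le_rpow_of_nonpos (by positivity) (by nlinarith [sq_nonneg ε]) (by linarith)
  have hB : (1 + ε ^ 2 * y ^ 2) ^ (-(1 / 2) : ℝ) ≤ 1 :=
    Real.rpow_le_one_of_one_le_of_nonpos (by nlinarith [mul_nonneg (sq_nonneg ε) (sq_nonneg y)])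
      (by norm_num)
  rw [powApprox, spow, abs_mul, abs_mul, abs_mul, ← sq_mul_rpow_eq hy,
    abs_of_nonneg (by positivity : 0 ≤ (y ^ 2 + ε ^ 2) ^ ((θ - 3) / 2)),
    abs_of_nonneg (by positivity : 0 ≤ (1 + ε ^ 2 * y ^ 2) ^ (-(1 / 2) : ℝ)),
    abs_of_nonneg (by positivity : 0 ≤ y ^ 2 * |y| ^ (θ - 3))]
  calc |y ^ 3| * (y ^ 2 + ε ^ 2) ^ ((θ - 3) / 2) * (1 + ε ^ 2 * y ^ 2) ^ (-(1 / 2) : ℝ)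
      ≤ |y ^ 3| * |y| ^ (θ - 3) * 1 := by gcongr
    _ = y ^ 2 * |y| ^ (θ - 3) * |y| := by rw [abs_pow, ← sq_abs y]; ring

lemma exists_bound_powApproxDeriv {ε : ℝ} (hε : 0 < ε) (hε1 : ε ≤ 1) {θ : ℝ} (h0 : 0 < θ)
    (h2 : θ ≤ 2) : ∃ K : ℝ, ∀ y, |powApproxDeriv θ ε y| ≤ K := by
  refine ⟨7 * ((ε ^ 2) ^ ((θ - 2) / 2) * (1 / ε ^ 2) ^ (1 / 2 : ℝ)), fun y => ?_⟩
  have hA : 0 < y ^ 2 + ε ^ 2 := by positivity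
  have hB : 0 < 1 + ε ^ 2 * y ^ 2 := by positivity
  refine (abs_powApproxDeriv_le hε h0 h2 y).trans ?_
  gcongr 7 * ?_
  have h1 : y ^ 2 * (y ^ 2 + ε ^ 2) ^ ((θ - 3) / 2)
      ≤ (y ^ 2 + ε ^ 2) ^ ((θ - 2) / 2) * (y ^ 2 + ε ^ 2) ^ (1 / 2 : ℝ) := by
    rw [← Real.rpow_add hA, show (θ - 2) / 2 + 1 / 2 = 1 + (θ - 3) / 2 by ring, Real.rpow_add hA,
      Real.rpow_one]
    gcongr
    nlinarith [sq_nonneg ε]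
  have h3 : (y ^ 2 + ε ^ 2) ^ ((θ - 2) / 2) ≤ (ε ^ 2) ^ ((θ - 2) / 2) :=
    Real.rpow_le_rpow_of_nonpos (by positivity) (by nlinarith [sq_nonneg y]) (by linarith)
  have h4 : (y ^ 2 + ε ^ 2) ^ (1 / 2 : ℝ) * (1 + ε ^ 2 * y ^ 2) ^ (-(1 / 2) : ℝ)
      ≤ (1 / ε ^ 2) ^ (1 / 2 : ℝ) := by
    rw [Real.rpow_neg hB.le, ← div_eq_mul_inv, ← Real.div_rpow hA.le hB.le]
    refine Real.rpow_le_rpow (by positivity) ?_ (by norm_num)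
    rw [div_le_div_iff₀ hB (by positivity)]
    have : ε ^ 2 * ε ^ 2 ≤ 1 := by
      have : ε ^ 2 ≤ 1 := pow_le_one₀ hε.le hε1
      nlinarith [sq_nonneg ε]
    nlinarith
  calc y ^ 2 * (y ^ 2 + ε ^ 2) ^ ((θ - 3) / 2) * (1 + ε ^ 2 * y ^ 2) ^ (-(1 / 2) : ℝ)
      ≤ ((ε ^ 2) ^ ((θ - 2) / 2) * (y ^ 2 + ε ^ 2) ^ (1 / 2 : ℝ))
        * (1 + ε ^ 2 * y ^ 2) ^ (-(1 / 2) : ℝ) := by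
          refine mul_le_mul_of_nonneg_right (h1.trans ?_) (by positivity)
          gcongr
    _ = (ε ^ 2) ^ ((θ - 2) / 2) * ((y ^ 2 + ε ^ 2) ^ (1 / 2 : ℝ)
        * (1 + ε ^ 2 * y ^ 2) ^ (-(1 / 2) : ℝ)) := by ring
    _ ≤ _ := by gcongr

lemma tendsto_powApprox (θ y : ℝ) : Tendsto (fun ε => powApprox θ ε y) (𝓝 0) (𝓝 (spow θ y)) := by
  rcases eq_or_ne y 0 with rfl | hy
  · simp [powApprox, spow]
  have hc : ContinuousAt (fun ε => powApprox θ ε y) 0 := by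
    unfold powApprox
    refine (continuousAt_const.mul (ContinuousAt.rpow_const (by fun_prop) (Or.inl ?_))).mul
      (ContinuousAt.rpow_const (by fun_prop) (Or.inl ?_)) <;> positivity
  have h := hc.tendsto
  have e : powApprox θ 0 y = spow θ y := by
    simp only [powApprox, spow]
    norm_num
    rw [sq_rpow_half_sub, ← sq_mul_rpow_eq hy]
    ring
  rwa [e] at h

lemma tendsto_powApproxDeriv {θ : ℝ} (hθ : θ ≠ 1) (y : ℝ) :
    Tendsto (fun ε => powApproxDeriv θ ε y) (𝓝 0) (𝓝 (θ * |y| ^ (θ - 1))) := by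
  rcases eq_or_ne y 0 with rfl | hy
  · simp [powApproxDeriv, Real.zero_rpow (sub_ne_zero.2 hθ)]
  have hc : ContinuousAt (fun ε => powApproxDeriv θ ε y) 0 := by
    unfold powApproxDeriv
    have h1 : ∀ p : ℝ, ContinuousAt (fun ε : ℝ => (y ^ 2 + ε ^ 2) ^ p) 0 := fun p =>
      ContinuousAt.rpow_const (by fun_prop) (Or.inl (by positivity))
    have h2 : ∀ p : ℝ, ContinuousAt (fun ε : ℝ => (1 + ε ^ 2 * y ^ 2) ^ p) 0 := fun p =>
      ContinuousAt.rpow_const (by fun_prop) (Or.inl (by positivity))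
    exact (((continuousAt_const.mul (h1 _)).add
      (continuousAt_const.mul (continuousAt_const.mul (h1 _)))).mul (h2 _)).sub
      (((continuousAt_const.mul (h1 _)).mul (by fun_prop)).mul (h2 _))
  have h := hc.tendsto
  have e : powApproxDeriv θ 0 y = θ * |y| ^ (θ - 1) := by
    simp only [powApproxDeriv]
    rw [← sq_mul_rpow_eq hy, ← sq_rpow_half_sub]
    norm_num
    rw [Real.rpow_sub_one (by positivity)]
    field_simp
    ring
  rwa [e] at h

/-- Chain rule for signed powers: `w ∈ H¹₀` implies `w^{[θ]} ∈ W^{1,p}_0` with the formal gradient,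
provided the function and this gradient belong to `L^p`. For `θ < 1` the junk value `0 ^ (θ-1) = 0`
says that the gradient is zero where `w = 0`. -/
lemma MemW1pZero.spow_comp (hU : Bornology.IsBounded U) {p : ℝ} (hp : 1 ≤ p) (hp2 : p ≤ 2)
    {w : Space d → ℝ} {G : Space d → Space d} (hw : MemW1pZero U 2 w G) {θ : ℝ} (h0 : 0 < θ)
    (h2 : θ ≤ 2) (h1 : θ ≠ 1)
    (hf : MemLp (fun x => spow θ (w x)) (ENNReal.ofReal p) (volume.restrict U))
    (hg : MemLp (fun x => (θ * |w x| ^ (θ - 1)) • G x) (ENNReal.ofReal p) (volume.restrict U)) :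
    MemW1pZero U p (fun x => spow θ (w x)) (fun x => (θ * |w x| ^ (θ - 1)) • G x) := by
  have hp' : 0 < p := by linarith
  have hε : ∀ k : ℕ, 0 < 1 / ((k : ℝ) + 1) := fun k => by positivity
  have hε1 : ∀ k : ℕ, 1 / ((k : ℝ) + 1) ≤ 1 := fun k => by
    rw [div_le_one (by positivity)]; linarith [(Nat.cast_nonneg k : (0 : ℝ) ≤ k)]
  have hε0 := tendsto_one_div_add_atTop_nhds_zero_nat (𝕜 := ℝ)
  have hderiv : ∀ k : ℕ, deriv (powApprox θ (1 / ((k : ℝ) + 1)))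
      = powApproxDeriv θ (1 / ((k : ℝ) + 1)) := fun k =>
    funext fun y => (hasDerivAt_powApprox (hε k) θ y).deriv
  have hmem : ∀ k : ℕ, MemW1pZero U p (fun x => powApprox θ (1 / ((k : ℝ) + 1)) (w x))
      (fun x => powApproxDeriv θ (1 / ((k : ℝ) + 1)) (w x) • G x) := fun k => by
    obtain ⟨K, hK⟩ := exists_bound_powApproxDeriv (hε k) (hε1 k) h0 h2
    have := hw.comp_smooth hU hp hp2 (contDiff_powApprox (hε k) θ) (by simp [powApprox])
      (K := K) (fun s => by rw [hderiv]; exact hK s)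
    rwa [hderiv] at this
  refine memW1pZero_of_tendsto hU hp hf hg hmem ?_ ?_
  · refine tendsto_eLpNorm_sub_of_dominated hp' (hf.norm.const_mul 2) (fun k => (hmem k).1.1.1)
      hf.1 (fun k => .of_forall fun x => ?_)
      (.of_forall fun x => (tendsto_powApprox θ (w x)).comp hε0)
    have := abs_powApprox_le (hε k) h2 (w x)
    refine (norm_sub_le _ _).trans ?_
    simp only [Real.norm_eq_abs]
    linarith
  · refine tendsto_eLpNorm_sub_of_dominated hp' (hg.norm.const_mul (7 / θ + 1))
      (fun k => (hmem k).1.2.1.1) hg.1 (fun k => .of_forall fun x => ?_)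
      (.of_forall fun x => ((tendsto_powApproxDeriv h1 (w x)).comp hε0).smul_const (G x))
    have := abs_powApproxDeriv_le_rpow (hε k) h0 h2 (w x)
    refine (norm_sub_le _ _).trans ?_
    rw [norm_smul, norm_smul, Real.norm_eq_abs, Real.norm_eq_abs, abs_mul, abs_of_pos h0,
      abs_of_nonneg (Real.rpow_nonneg (abs_nonneg (w x)) (θ - 1))]
    calc |powApproxDeriv θ (1 / ((k : ℝ) + 1)) (w x)| * ‖G x‖ + θ * |w x| ^ (θ - 1) * ‖G x‖
        ≤ 7 * |w x| ^ (θ - 1) * ‖G x‖ + θ * |w x| ^ (θ - 1) * ‖G x‖ := by gcongr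
      _ = _ := by field_simp

end ChainRule

/-! ### Cutoffs adapted to the boundary -/

section Cutoff

variable {d : ℕ} {U : Set (Space d)}

lemma exists_bound_iteratedFDeriv {E F : Type*} [NormedAddCommGroup E] [NormedSpace ℝ E]
    [NormedAddCommGroup F] [NormedSpace ℝ F] {f : E → F} (hf : ContDiff ℝ ∞ f)
    {K : Set E} (hK : IsCompact K) :
    ∃ C : ℝ, 1 ≤ C ∧ ∀ i ≤ 2, ∀ x ∈ K, ‖iteratedFDeriv ℝ i f x‖ ≤ C := by
  have h : ∀ i : ℕ, ∃ C : ℝ, ∀ x ∈ K, ‖iteratedFDeriv ℝ i f x‖ ≤ C := fun i =>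
    hK.exists_bound_of_continuousOn (hf.continuous_iteratedFDeriv
      (by exact_mod_cast le_top)).continuousOn
  choose C hC using h
  refine ⟨max 1 (max (C 0) (max (C 1) (C 2))), le_max_left _ _,
    fun i hi x hx => (hC i x hx).trans ?_⟩
  interval_cases i <;> simp

lemma iteratedFDeriv_eq_zero_of_eventually_const {E F : Type*} [NormedAddCommGroup E]
    [NormedSpace ℝ E] [NormedAddCommGroup F] [NormedSpace ℝ F] {f : E → F} {c : F} {x : E}
    (h : ∀ᶠ y in 𝓝 x, f y = c) {i : ℕ} (hi : i ≠ 0) : iteratedFDeriv ℝ i f x = 0 := by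
  have h' : f =ᶠ[𝓝 x] fun _ => c := h
  rw [(h'.iteratedFDeriv ℝ i).eq_of_nhds, iteratedFDeriv_const_of_ne hi, Pi.zero_apply]

/-- A smooth step, equal to `1` on `(-∞, 1]` and to `0` on `[2, ∞)`. -/
noncomputable def stepDown (y : ℝ) : ℝ := Real.smoothTransition (2 - y)

lemma contDiff_stepDown : ContDiff ℝ ∞ stepDown :=
  Real.smoothTransition.contDiff.comp (contDiff_const.sub contDiff_id)

lemma stepDown_nonneg (y : ℝ) : 0 ≤ stepDown y := Real.smoothTransition.nonneg _

lemma stepDown_le_one (y : ℝ) : stepDown y ≤ 1 := Real.smoothTransition.le_one _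

lemma stepDown_of_le_one {y : ℝ} (h : y ≤ 1) : stepDown y = 1 :=
  Real.smoothTransition.one_of_one_le (by linarith)

lemma stepDown_of_two_le {y : ℝ} (h : 2 ≤ y) : stepDown y = 0 :=
  Real.smoothTransition.zero_of_nonpos (by linarith)

/-- The derivatives of `stepDown (τ σ)` only live where `1 ≤ τ σ ≤ 2`, so they are controlled by
powers of `1 / σ`, uniformly in `τ`. -/
lemma exists_bound_iteratedFDeriv_stepDown {σ : Space d → ℝ} (hσ : ContDiff ℝ ∞ σ)
    {K : Set (Space d)} (hK : IsCompact K) :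
    ∃ C : ℝ, 1 ≤ C ∧ ∀ τ : ℝ, ∀ x ∈ K, 0 < σ x → ∀ M : ℝ, 1 ≤ M → (σ x)⁻¹ ≤ M →
      ∀ i ≤ 2, ‖iteratedFDeriv ℝ i (fun y => stepDown (τ * σ y)) x‖ ≤ C * M ^ i := by
  obtain ⟨L, hL1, hL⟩ := exists_bound_iteratedFDeriv hσ hK
  obtain ⟨B, hB1, hB⟩ := exists_bound_iteratedFDeriv contDiff_stepDown
    (isCompact_Icc (a := 1) (b := 2))
  refine ⟨2 * B * (1 + 2 * L) ^ 2, ?_, ?_⟩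
  · nlinarith [sq_nonneg L, mul_nonneg (by linarith : (0 : ℝ) ≤ B - 1) (sq_nonneg (1 + 2 * L))]
  intro τ x hx hpos M hM hσM i hi
  have hCM : 1 ≤ 2 * B * (1 + 2 * L) ^ 2 * M ^ i := by
    have h1 : 1 ≤ M ^ i := one_le_pow₀ hM
    have h2 : (1 : ℝ) ≤ (1 + 2 * L) ^ 2 := one_le_pow₀ (by linarith)
    have h3 : (1 : ℝ) ≤ 2 * B := by linarith
    have := one_le_mul_of_one_le_of_one_le (one_le_mul_of_one_le_of_one_le h3 h2) h1
    exact this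
  have hcont : Continuous fun y => τ * σ y := continuous_const.mul hσ.continuous
  rcases Nat.eq_zero_or_pos i with rfl | hi0
  · rw [norm_iteratedFDeriv_zero, Real.norm_eq_abs, abs_of_nonneg (stepDown_nonneg _)]
    exact (stepDown_le_one _).trans hCM
  by_cases h1 : τ * σ x < 1
  · rw [iteratedFDeriv_eq_zero_of_eventually_const (c := 1) _ hi0.ne', norm_zero]
    · linarith
    · filter_upwards [hcont.continuousAt.eventually_lt continuousAt_const h1] with y hy
      exact stepDown_of_le_one hy.le
  by_cases h2 : 2 < τ * σ x
  · rw [iteratedFDeriv_eq_zero_of_eventually_const (c := 0) _ hi0.ne', norm_zero]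
    · linarith
    · filter_upwards [continuousAt_const.eventually_lt hcont.continuousAt h2] with y hy
      exact stepDown_of_two_le hy.le
  push Not at h1 h2
  have hτ : τ ≤ 2 * M := by
    have : τ ≤ 2 * (σ x)⁻¹ := by rw [← div_eq_mul_inv, le_div_iff₀ hpos]; exact h2
    linarith
  have hτ0 : 0 < τ := by
    by_contra hneg
    push Not at hneg
    nlinarith
  have hb := norm_iteratedFDeriv_comp_le (g := stepDown) (f := fun y => τ * σ y) (n := i) (N := ∞)
    contDiff_stepDown (contDiff_const.mul hσ) (by exact_mod_cast le_top) x (C := B)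
    (D := (1 + 2 * L) * M)
    (fun k hk => hB k (hk.trans hi) _ ⟨h1, h2⟩) (fun k hk1 hk => by
      have : iteratedFDeriv ℝ k (fun y => τ * σ y) x = τ • iteratedFDeriv ℝ k σ x :=
        iteratedFDeriv_const_smul_apply (a := τ) (hσ.of_le (by exact_mod_cast le_top)).contDiffAt
      rw [this, norm_smul, Real.norm_eq_abs, abs_of_pos hτ0]
      calc τ * ‖iteratedFDeriv ℝ k σ x‖ ≤ 2 * M * L := by
            gcongr
            exact hL k (hk.trans hi) x hx
        _ ≤ (1 + 2 * L) * M := by nlinarith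
        _ ≤ ((1 + 2 * L) * M) ^ k := le_self_pow₀
            (one_le_mul_of_one_le_of_one_le (by linarith) hM) (by omega))
  refine hb.trans ?_
  rw [mul_pow, ← mul_assoc]
  have hf : (i.factorial : ℝ) ≤ 2 := by interval_cases i <;> norm_num [Nat.factorial]
  have hp : (1 + 2 * L) ^ i ≤ (1 + 2 * L) ^ 2 := pow_le_pow_right₀ (by linarith) hi
  gcongr

lemma iteratedFDeriv_mul_bound {E : Type*} [NormedAddCommGroup E] [NormedSpace ℝ E] {f g : E → ℝ}
    {s : Set E} (hs : IsOpen s) (hf : ContDiffOn ℝ 2 f s) (hg : ContDiffOn ℝ 2 g s) {x : E}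
    (hx : x ∈ s) {A B M : ℝ} (hM : 1 ≤ M) (hA : ∀ i ≤ 2, ‖iteratedFDeriv ℝ i f x‖ ≤ A)
    (hB : ∀ i ≤ 2, ‖iteratedFDeriv ℝ i g x‖ ≤ B * M ^ i) {i : ℕ} (hi : i ≤ 2) :
    ‖iteratedFDeriv ℝ i (fun y => f y * g y) x‖ ≤ 4 * A * B * M ^ i := by
  have hA0 : 0 ≤ A := (norm_nonneg _).trans (hA 0 (by norm_num))
  have hB0 : 0 ≤ B := by simpa using (norm_nonneg _).trans (hB 0 (by norm_num))
  have h := norm_iteratedFDerivWithin_mul_le (n := i) hf hg hs.uniqueDiffOn hx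
    (by exact_mod_cast hi)
  simp only [iteratedFDerivWithin_of_isOpen _ hs hx] at h
  refine h.trans ?_
  calc ∑ k ∈ Finset.range (i + 1), (i.choose k : ℝ) * ‖iteratedFDeriv ℝ k f x‖
        * ‖iteratedFDeriv ℝ (i - k) g x‖
      ≤ ∑ k ∈ Finset.range (i + 1), (i.choose k : ℝ) * (A * B * M ^ i) := by
        refine Finset.sum_le_sum fun k hk => ?_
        have hk' : k ≤ i := by simpa [Nat.lt_succ_iff] using hk
        rw [mul_assoc]
        refine mul_le_mul_of_nonneg_left ?_ (by positivity)
        calc ‖iteratedFDeriv ℝ k f x‖ * ‖iteratedFDeriv ℝ (i - k) g x‖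
            ≤ A * (B * M ^ (i - k)) := by
              gcongr
              · exact hA k (hk'.trans hi)
              · exact hB (i - k) (by omega)
          _ ≤ A * (B * M ^ i) := by gcongr; omega
          _ = _ := by ring
    _ = 2 ^ i * (A * B * M ^ i) := by
        rw [← Finset.sum_mul]
        congr 1
        exact_mod_cast Nat.sum_range_choose i
    _ ≤ 4 * (A * B * M ^ i) := by
        gcongr
        interval_cases i <;> norm_num
    _ = _ := by ring

/-- Near a boundary point a smooth domain is the positivity set of a smooth function which grows
at a definite rate in a fixed direction. -/
lemma IsSmoothBoundedDomain.exists_chart (hU : IsSmoothBoundedDomain U) {x₀ : Space d}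
    (hx₀ : x₀ ∈ frontier U) : ∃ (r : ℝ) (σ : Space d → ℝ) (e : Space d) (c : ℝ), 0 < r ∧
      ContDiff ℝ ∞ σ ∧ ‖e‖ ≤ 1 ∧ 0 < c ∧ (∀ x ∈ Metric.ball x₀ r, c ≤ fderiv ℝ σ x e) ∧
      ∀ x ∈ Metric.ball x₀ r, x ∈ U ↔ 0 < σ x := by
  obtain ⟨V, g, hVo, hxV, hg, hg0, hUV⟩ := hU.smooth_boundary x₀ hx₀
  obtain ⟨a, ha⟩ : ∃ a, fderiv ℝ g x₀ a ≠ 0 := by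
    by_contra h
    push Not at h
    exact hg0 (ContinuousLinearMap.ext h)
  have ha0 : a ≠ 0 := by rintro rfl; simp at ha
  have hσ : ContDiff ℝ ∞ fun y => -g y := hg.neg
  -- a unit vector along which `-g` increases at `x₀`
  obtain ⟨e, he, hpos⟩ : ∃ e : Space d, ‖e‖ ≤ 1 ∧ 0 < fderiv ℝ (fun y => -g y) x₀ e := by
    have hn : 0 < ‖a‖ := norm_pos_iff.2 ha0
    rcases lt_or_gt_of_ne ha with h | h
    · refine ⟨‖a‖⁻¹ • a, by rw [norm_smul, norm_inv, norm_norm, inv_mul_cancel₀ hn.ne'], ?_⟩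
      rw [fderiv_fun_neg]
      simp only [map_smul, smul_eq_mul, _root_.neg_apply]
      have := mul_neg_of_pos_of_neg (inv_pos.2 hn) h
      linarith
    · refine ⟨-(‖a‖⁻¹ • a), by rw [norm_neg, norm_smul, norm_inv, norm_norm,
        inv_mul_cancel₀ hn.ne'], ?_⟩
      rw [fderiv_fun_neg]
      simp only [map_smul, map_neg, smul_eq_mul, _root_.neg_apply]
      have := mul_pos (inv_pos.2 hn) h
      linarith
  have hcont : Continuous fun x => fderiv ℝ (fun y => -g y) x e :=
    (hσ.continuous_fderiv (by simp)).clm_apply continuous_const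
  have hev : ∀ᶠ x in 𝓝 x₀, fderiv ℝ (fun y => -g y) x₀ e / 2 < fderiv ℝ (fun y => -g y) x e :=
    hcont.continuousAt.eventually_const_lt (by simpa using half_lt_self hpos)
  obtain ⟨r, hr, hball⟩ := Metric.eventually_nhds_iff_ball.1 (hev.and (hVo.mem_nhds hxV))
  refine ⟨r, fun y => -g y, e, _, hr, hσ, he, half_pos hpos, fun x hx => (hball x hx).1.le,
    fun x hx => ?_⟩
  have hxV' := (hball x hx).2
  constructor
  · intro hxU
    have : x ∈ U ∩ V := ⟨hxU, hxV'⟩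
    rw [hUV] at this
    exact neg_pos.2 this.2
  · intro hs
    have : x ∈ {y ∈ V | g y < 0} := ⟨hxV', neg_pos.1 hs⟩
    rw [← hUV] at this
    exact this.1

/-- A localized Hardy inequality next to a boundary point. -/
lemma exists_local_hardy {x₀ : Space d} {r c : ℝ} {σ : Space d → ℝ} {e : Space d} (hr : 0 < r)
    (hσ : ContDiff ℝ ∞ σ) (he : ‖e‖ ≤ 1) (hc : 0 < c)
    (hder : ∀ x ∈ Metric.ball x₀ r, c ≤ fderiv ℝ σ x e)
    (hpos : ∀ x ∈ Metric.ball x₀ r, x ∈ U ↔ 0 < σ x) :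
    ∃ A : ℝ, 0 ≤ A ∧ ∀ ψ, IsTestFunction U ψ →
      ∫⁻ x in U, ‖(Metric.closedBall x₀ (r / 2)).indicator (fun x => |(σ x)⁻¹|) x‖ₑ ^ 2 *
          ‖ψ x‖ₑ ^ 2
        ≤ ENNReal.ofReal A * (∫⁻ x in U, ‖ψ x‖ₑ ^ 2)
          + ENNReal.ofReal A * ∫⁻ x in U, ‖gradient ψ x‖ₑ ^ 2 := by
  let ζ : ContDiffBump x₀ := ⟨r / 2, 3 * r / 4, by positivity, by linarith⟩
  have hζ : ContDiff ℝ ∞ ζ := ζ.contDiff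
  obtain ⟨K, hK1, hK⟩ := exists_bound_iteratedFDeriv hζ (isCompact_closedBall x₀ (3 * r / 4))
  have hζK : ∀ x, ‖gradient ζ x‖ ≤ K := fun x => by
    rw [norm_gradient, ← norm_iteratedFDeriv_one]
    by_cases hx : x ∈ Metric.closedBall x₀ (3 * r / 4)
    · exact hK 1 (by norm_num) x hx
    · have : x ∉ tsupport ζ := by rw [ζ.tsupport_eq]; exact hx
      rw [iteratedFDeriv_eq_zero_of_eventually_const (c := 0) _ one_ne_zero, norm_zero]
      · linarith
      · exact notMem_tsupport_iff_eventuallyEq.1 this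
  refine ⟨4 / c ^ 2 * (2 * K ^ 2), by positivity, fun ψ hψ => ?_⟩
  have hW : IsTestFunction U (fun x => ζ x * ψ x) :=
    ⟨hζ.mul hψ.smooth, hψ.compact.mul_left,
      tsupport_mul_subset_right.trans hψ.support_subset⟩
  have hWb : ∀ x ∈ tsupport (fun x => ζ x * ψ x), x ∈ Metric.ball x₀ r := fun x hx => by
    have h1 : x ∈ tsupport ζ := tsupport_mul_subset_left hx
    rw [ζ.tsupport_eq] at h1
    exact Metric.closedBall_subset_ball (by change 3 * r / 4 < r; linarith) h1
  have h := lintegral_div_sq_le hW hc he (hσ.of_le (by exact_mod_cast le_top))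
    (fun x hx => (hpos x (hWb x hx)).1 (hW.support_subset hx)) (fun x hx => hder x (hWb x hx))
  have hgrad : ∀ x, ‖gradient (fun x => ζ x * ψ x) x‖ₑ ^ 2
      ≤ ENNReal.ofReal (2 * K ^ 2) * (‖ψ x‖ₑ ^ 2 + ‖gradient ψ x‖ₑ ^ 2) := fun x => by
    have h1 : gradient (fun x => ζ x * ψ x) x = ζ x • gradient ψ x + ψ x • gradient ζ x := by
      unfold gradient
      rw [fderiv_fun_mul (hζ.differentiable (by simp) x) (hψ.smooth.differentiable (by simp) x)]
      simp
    have h2 : ‖gradient (fun x => ζ x * ψ x) x‖ ≤ ‖gradient ψ x‖ + K * ‖ψ x‖ := by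
      rw [h1]
      refine (norm_add_le _ _).trans (add_le_add ?_ ?_)
      · rw [norm_smul, Real.norm_eq_abs, abs_of_nonneg ζ.nonneg]
        exact mul_le_of_le_one_left (norm_nonneg _) ζ.le_one
      · rw [norm_smul, mul_comm]
        gcongr
        exact hζK x
    simp only [← ofReal_norm, ← ENNReal.ofReal_pow (norm_nonneg _)]
    rw [← ENNReal.ofReal_add (by positivity) (by positivity), ← ENNReal.ofReal_mul (by positivity)]
    refine ENNReal.ofReal_le_ofReal ?_
    have h3 : ‖gradient (fun x => ζ x * ψ x) x‖ ^ 2 ≤ (‖gradient ψ x‖ + K * ‖ψ x‖) ^ 2 := by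
      gcongr
    nlinarith [sq_nonneg (‖gradient ψ x‖ - K * ‖ψ x‖), sq_nonneg ‖gradient ψ x‖,
      mul_nonneg (by nlinarith : (0 : ℝ) ≤ K ^ 2 - 1) (sq_nonneg ‖gradient ψ x‖)]
  calc ∫⁻ x in U, ‖(Metric.closedBall x₀ (r / 2)).indicator (fun x => |(σ x)⁻¹|) x‖ₑ ^ 2 * ‖ψ x‖ₑ ^ 2
      ≤ ∫⁻ x in U, ‖ζ x * ψ x / σ x‖ₑ ^ 2 := by
        refine lintegral_mono fun x => ?_
        by_cases hx : x ∈ Metric.closedBall x₀ (r / 2)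
        · rw [indicator_of_mem hx, ζ.one_of_mem_closedBall hx, one_mul, div_eq_mul_inv, enorm_mul,
            mul_pow, mul_comm, Real.enorm_abs]
        · rw [indicator_of_notMem hx]; simp
    _ ≤ ∫⁻ x, ‖ζ x * ψ x / σ x‖ₑ ^ 2 := setLIntegral_le_lintegral _ _
    _ ≤ _ := h
    _ = ENNReal.ofReal (4 / c ^ 2) * ∫⁻ x in U, ‖gradient (fun x => ζ x * ψ x) x‖ₑ ^ 2 := by
        rw [setLIntegral_enorm_eq ((tsupport_gradient_subset _).trans hW.support_subset)]
    _ ≤ ENNReal.ofReal (4 / c ^ 2) * ∫⁻ x in U, ENNReal.ofReal (2 * K ^ 2)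
          * (‖ψ x‖ₑ ^ 2 + ‖gradient ψ x‖ₑ ^ 2) := by
        gcongr with x; exact hgrad x
    _ = _ := by
        rw [lintegral_const_mul' _ _ ENNReal.ofReal_ne_top,
          lintegral_add_left' ((hψ.memLp 1).1.enorm.pow_const 2), ← mul_assoc,
          ← ENNReal.ofReal_mul (by positivity), mul_add]

/-- The local building block of the cutoffs: `h τ` is a bump at a boundary point, switched off
where the defining function exceeds `2 / τ`. The weight `ℓ` (the inverse of the defining function)
controls its derivatives and obeys a Hardy inequality. -/
lemma IsSmoothBoundedDomain.exists_local_cutoff (hU : IsSmoothBoundedDomain U) {x₀ : Space d}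
    (hx₀ : x₀ ∈ frontier U) : ∃ (V : Set (Space d)) (l : Space d → ℝ) (h : ℝ → Space d → ℝ)
      (C A : ℝ), IsOpen V ∧ x₀ ∈ V ∧ Measurable l ∧ (∀ x, 0 ≤ l x) ∧ 1 ≤ C ∧ 0 ≤ A ∧
      (∀ τ, ContDiff ℝ ∞ (h τ)) ∧ (∀ τ x, 0 ≤ h τ x) ∧ (∀ τ x, h τ x ≤ 1) ∧
      (∀ τ, 0 ≤ τ → ∀ x ∈ V, x ∉ U → ∀ᶠ y in 𝓝 x, h τ y = 1) ∧
      (∀ τ, ∀ x ∈ U, 2 * l x < τ → ∀ᶠ y in 𝓝 x, h τ y = 0) ∧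
      (∀ τ, ∀ x ∈ U, ∀ M, 1 ≤ M → l x ≤ M → ∀ i ≤ 2, ‖iteratedFDeriv ℝ i (h τ) x‖ ≤ C * M ^ i) ∧
      ∀ ψ, IsTestFunction U ψ → ∫⁻ x in U, ‖l x‖ₑ ^ 2 * ‖ψ x‖ₑ ^ 2
        ≤ ENNReal.ofReal A * (∫⁻ x in U, ‖ψ x‖ₑ ^ 2)
          + ENNReal.ofReal A * ∫⁻ x in U, ‖gradient ψ x‖ₑ ^ 2 := by
  obtain ⟨r, σ, e, c, hr, hσ, he, hc, hder, hpos⟩ := hU.exists_chart hx₀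
  obtain ⟨A, hA, hardy⟩ := exists_local_hardy hr hσ he hc hder hpos
  let ζ : ContDiffBump x₀ := ⟨r / 4, r / 2, by positivity, by linarith⟩
  have hζ : ContDiff ℝ ∞ ζ := ζ.contDiff
  obtain ⟨Z, hZ1, hZ⟩ := exists_bound_iteratedFDeriv hζ (isCompact_closedBall x₀ (r / 2))
  obtain ⟨B, hB1, hB⟩ := exists_bound_iteratedFDeriv_stepDown hσ (isCompact_closedBall x₀ (r / 2))
  have hsub : Metric.closedBall x₀ (r / 2) ⊆ Metric.ball x₀ r :=
    Metric.closedBall_subset_ball (by linarith)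
  have hs : ∀ τ, ContDiff ℝ ∞ fun x => stepDown (τ * σ x) := fun τ =>
    contDiff_stepDown.comp (contDiff_const.mul hσ)
  have hout : ∀ τ x, x ∉ Metric.closedBall x₀ (r / 2) →
      ∀ᶠ y in 𝓝 x, ζ y * stepDown (τ * σ y) = 0 := fun τ x hx => by
    have : x ∉ tsupport ζ := by rw [ζ.tsupport_eq]; exact hx
    filter_upwards [notMem_tsupport_iff_eventuallyEq.1 this] with y hy
    rw [hy]; simp
  refine ⟨Metric.ball x₀ (r / 4), (Metric.closedBall x₀ (r / 2)).indicator (fun x => |(σ x)⁻¹|),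
    fun τ x => ζ x * stepDown (τ * σ x), 4 * Z * B, A, Metric.isOpen_ball,
    Metric.mem_ball_self (by positivity),
    (hσ.continuous.measurable.inv.norm).indicator measurableSet_closedBall, fun x =>
      indicator_nonneg (fun x _ => abs_nonneg _) x, ?_, hA, fun τ => hζ.mul (hs τ),
    fun τ x => mul_nonneg ζ.nonneg (stepDown_nonneg _),
    fun τ x => mul_le_one₀ ζ.le_one (stepDown_nonneg _) (stepDown_le_one _), ?_, ?_, ?_, hardy⟩
  · nlinarith
  · intro τ hτ x hx hxU
    have hxr : x ∈ Metric.ball x₀ r := Metric.ball_subset_ball (by linarith) hx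
    have hσx : σ x ≤ 0 := by
      have := mt (hpos x hxr).2 hxU
      linarith
    have hlt : τ * σ x < 1 := by nlinarith
    have hcont : Continuous fun y => τ * σ y := continuous_const.mul hσ.continuous
    filter_upwards [hcont.continuousAt.eventually_lt continuousAt_const hlt,
      Metric.isOpen_ball.mem_nhds hx] with y hy hyb
    rw [stepDown_of_le_one hy.le, ζ.one_of_mem_closedBall (Metric.ball_subset_closedBall hyb),
      one_mul]
  · intro τ x hxU hl
    by_cases hx : x ∈ Metric.closedBall x₀ (r / 2)
    · rw [indicator_of_mem hx] at hl
      have hp := (hpos x (hsub hx)).1 hxU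
      rw [abs_of_pos (inv_pos.2 hp), ← div_eq_mul_inv, div_lt_iff₀ hp] at hl
      have hcont : Continuous fun y => τ * σ y := continuous_const.mul hσ.continuous
      filter_upwards [continuousAt_const.eventually_lt hcont.continuousAt hl] with y hy
      rw [stepDown_of_two_le hy.le, mul_zero]
    · exact hout τ x hx
  · intro τ x hxU M hM hl i hi
    by_cases hx : x ∈ Metric.closedBall x₀ (r / 2)
    · rw [indicator_of_mem hx] at hl
      have hp := (hpos x (hsub hx)).1 hxU
      rw [abs_of_pos (inv_pos.2 hp)] at hl
      exact iteratedFDeriv_mul_bound isOpen_univ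
        (hζ.of_le (by norm_cast)).contDiffOn
        ((hs τ).of_le (by norm_cast)).contDiffOn (mem_univ x) hM
        (fun k hk => hZ k hk x hx) (fun k hk => hB τ x hx hp M hM hl k hk) hi
    · have h0 : iteratedFDeriv ℝ i (fun x => ζ x * stepDown (τ * σ x)) x = 0 := by
        have h' : (fun x => ζ x * stepDown (τ * σ x)) =ᶠ[𝓝 x] fun _ => 0 := hout τ x hx
        rw [(h'.iteratedFDeriv ℝ i).eq_of_nhds]
        simp
      rw [h0, norm_zero]
      positivity

/-- Cutoffs adapted to the Hardy inequality: test functions `φ j`, equal to `1` where the weight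
`κ` is less than `j`, whose derivatives up to order two are bounded by `κ ^ 2`, uniformly in `j`;
the weighted norm `∫ κ² ψ²` is controlled by the `H¹` norm of `ψ`. -/
lemma IsSmoothBoundedDomain.exists_cutoffs (hU : IsSmoothBoundedDomain U) :
    ∃ (κ : Space d → ℝ) (φ : ℕ → Space d → ℝ) (C A : ℝ), Measurable κ ∧ (∀ x, 1 ≤ κ x) ∧ 0 < C ∧
      0 < A ∧ (∀ j, IsTestFunction U (φ j)) ∧ (∀ j x, 0 ≤ φ j x) ∧ (∀ j x, φ j x ≤ 1) ∧
      (∀ j, ∀ x ∈ U, ∀ i ≤ 2, ‖iteratedFDeriv ℝ i (φ j) x‖ ≤ C * κ x ^ 2) ∧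
      (∀ j : ℕ, ∀ x ∈ U, κ x < j → ∀ᶠ y in 𝓝 x, φ j y = 1) ∧
      ∀ ψ, IsTestFunction U ψ → ∫⁻ x in U, ‖κ x‖ₑ ^ 2 * ‖ψ x‖ₑ ^ 2
        ≤ ENNReal.ofReal A * (∫⁻ x in U, ‖ψ x‖ₑ ^ 2)
          + ENNReal.ofReal A * ∫⁻ x in U, ‖gradient ψ x‖ₑ ^ 2 := by
  choose! V l h C A hVo hxV hlm hl0 hC hA hsm hh0 hh1 hone hzero hbd hardy using
    fun x₀ (hx₀ : x₀ ∈ frontier U) => hU.exists_local_cutoff hx₀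
  have hcpt : IsCompact (frontier U) :=
    Metric.isCompact_of_isClosed_isBounded isClosed_frontier
      (hU.isBounded.closure.subset frontier_subset_closure)
  obtain ⟨t, htU, hcov⟩ := hcpt.elim_nhds_subcover V fun x hx => (hVo x hx).mem_nhds (hxV x hx)
  set κ : Space d → ℝ := fun x => 1 + ∑ i ∈ t, l i x with hκ
  have hκ1 : ∀ x, 1 ≤ κ x := fun x => by
    simp only [hκ, le_add_iff_nonneg_right]
    exact Finset.sum_nonneg fun i hi => hl0 i (htU i hi) x
  have hlκ : ∀ i ∈ t, ∀ x, l i x ≤ κ x := fun i hi x => by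
    have := Finset.single_le_sum (f := fun i => l i x) (fun i hi => hl0 i (htU i hi) x) hi
    simp only [hκ]; linarith
  let S : ℕ → Space d → ℝ := fun j x => ∑ i ∈ t, h i (2 * j) x
  have hS : ∀ j, ContDiff ℝ ∞ (S j) := fun j => ContDiff.sum fun i hi => hsm i (htU i hi) _
  have hS0 : ∀ j x, 0 ≤ S j x := fun j x => Finset.sum_nonneg fun i hi => hh0 i (htU i hi) _ x
  have hSN : ∀ j x, S j x ≤ t.card := fun j x => by
    have := Finset.sum_le_sum (s := t) (f := fun i => h i (2 * j) x) (g := fun _ => (1 : ℝ))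
      fun i hi => hh1 i (htU i hi) _ x
    simpa [S] using this
  -- next to the boundary some piece equals `1`, so that `S j ≥ 1` and `Φ j = 0`; the factor `2` in
  -- `h i (2 * j)` matches the region `2 * l i x < 2 * j` where the pieces vanish
  let Φ : ℕ → Space d → ℝ := fun j x => stepDown (1 + S j x)
  have hΦ : ∀ j, ContDiff ℝ ∞ (Φ j) := fun j => contDiff_stepDown.comp (contDiff_const.add (hS j))
  have hfr : ∀ j, ∀ x ∈ frontier U, ∀ᶠ y in 𝓝 x, Φ j y = 0 := fun j x hx => by
    obtain ⟨i, hi, hxi⟩ := mem_iUnion₂.1 (hcov hx)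
    have hxU : x ∉ U := by
      rw [hU.isOpen.frontier_eq] at hx; exact hx.2
    filter_upwards [hone i (htU i hi) (2 * j) (by positivity) x hxi hxU] with y hy
    have := Finset.single_le_sum (f := fun i => h i (2 * j) y)
      (fun i hi => hh0 i (htU i hi) _ y) hi
    refine stepDown_of_two_le ?_
    simp only [hy] at this
    simp only [S]
    linarith
  have hev0 : ∀ j x, x ∉ U → ∀ᶠ y in 𝓝 x, U.indicator (Φ j) y = 0 := fun j x hxU => by
    by_cases hx : x ∈ frontier U
    · filter_upwards [hfr j x hx] with y hy
      by_cases hyU : y ∈ U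
      · rw [indicator_of_mem hyU, hy]
      · exact indicator_of_notMem hyU _
    · have hxc : x ∉ closure U := fun hxc => hx (by rw [hU.isOpen.frontier_eq]; exact ⟨hxc, hxU⟩)
      filter_upwards [isClosed_closure.isOpen_compl.mem_nhds hxc] with y hy
      exact indicator_of_notMem (fun hyU => hy (subset_closure hyU)) _
  have hevU : ∀ j x, x ∈ U → U.indicator (Φ j) =ᶠ[𝓝 x] Φ j := fun j x hxU => by
    filter_upwards [hU.isOpen.mem_nhds hxU] with y hy
    exact indicator_of_mem hy _
  have htsup : ∀ j, tsupport (U.indicator (Φ j)) ⊆ U := fun j x hx => by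
    by_contra hxU
    exact notMem_tsupport_iff_eventuallyEq.2 (hev0 j x hxU) hx
  have htest : ∀ j, IsTestFunction U (U.indicator (Φ j)) := fun j => by
    refine ⟨contDiff_iff_contDiffAt.2 fun x => ?_, ?_, htsup j⟩
    · by_cases hxU : x ∈ U
      · exact (hΦ j).contDiffAt.congr_of_eventuallyEq (hevU j x hxU)
      · exact (contDiffAt_const (c := (0 : ℝ))).congr_of_eventuallyEq (hev0 j x hxU)
    · exact Metric.isCompact_of_isClosed_isBounded (isClosed_tsupport _)
        (hU.isBounded.subset (htsup j))
  -- finitely many local pieces: the bound `C_i κ^k` of each piece is summed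
  set CS : ℝ := 1 + ∑ i ∈ t, C i with hCS
  have hCS1 : 1 ≤ CS := by
    have := Finset.sum_nonneg fun i hi => (zero_le_one.trans (hC i (htU i hi)))
    linarith
  have hSbd : ∀ j, ∀ x ∈ U, ∀ k ≤ 2, ‖iteratedFDeriv ℝ k (S j) x‖ ≤ CS * κ x ^ k := by
    intro j x hxU k hk
    have e1 : iteratedFDeriv ℝ k (S j) x = ∑ i ∈ t, iteratedFDeriv ℝ k (h i (2 * j)) x := by
      rw [show S j = ∑ i ∈ t, h i (2 * j) by ext x; simp [S]]
      exact iteratedFDeriv_sum_apply fun i hi =>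
        ((hsm i (htU i hi) (2 * j)).of_le (by exact_mod_cast le_top)).contDiffAt
    rw [e1]
    refine (norm_sum_le _ _).trans ?_
    calc ∑ i ∈ t, ‖iteratedFDeriv ℝ k (h i (2 * j)) x‖ ≤ ∑ i ∈ t, C i * κ x ^ k :=
          Finset.sum_le_sum fun i hi =>
            hbd i (htU i hi) _ x hxU _ (hκ1 x) (hlκ i hi x) k hk
      _ = (∑ i ∈ t, C i) * κ x ^ k := by rw [Finset.sum_mul]
      _ ≤ CS * κ x ^ k := by
          have := hκ1 x
          gcongr
          linarith
  obtain ⟨B, hB1, hB⟩ := exists_bound_iteratedFDeriv contDiff_stepDown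
    (isCompact_Icc (a := (0 : ℝ)) (b := 1 + t.card))
  have hΦbd : ∀ j, ∀ x ∈ U, ∀ k ≤ 2, ‖iteratedFDeriv ℝ k (U.indicator (Φ j)) x‖
      ≤ 2 * B * CS ^ 2 * κ x ^ 2 := by
    intro j x hxU k hk
    rw [((hevU j x hxU).iteratedFDeriv ℝ k).eq_of_nhds]
    have hCSκ : 1 ≤ CS * κ x := one_le_mul_of_one_le_of_one_le hCS1 (hκ1 x)
    have hb := norm_iteratedFDeriv_comp_le (g := stepDown) (f := fun y => 1 + S j y) (n := k)
      (N := ∞) contDiff_stepDown (contDiff_const.add (hS j)) (by exact_mod_cast le_top) x (C := B)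
      (D := CS * κ x)
      (fun i hi => hB i (hi.trans hk) _ ⟨by linarith [hS0 j x], by linarith [hSN j x]⟩)
      (fun i hi1 hi => by
        have e2 : iteratedFDeriv ℝ i (fun y => 1 + S j y) x = iteratedFDeriv ℝ i (S j) x := by
          have h1 : ContDiffAt ℝ i (fun _ : Space d => (1 : ℝ)) x := contDiffAt_const
          have := iteratedFDeriv_add_apply h1
            ((hS j).of_le (by exact_mod_cast le_top)).contDiffAt
          rw [show (fun y => 1 + S j y) = (fun _ : Space d => (1 : ℝ)) + S j from rfl, this,
            iteratedFDeriv_const_of_ne (by omega)]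
          simp
        rw [e2]
        refine (hSbd j x hxU i (hi.trans hk)).trans ?_
        rw [mul_pow]
        have := hκ1 x
        gcongr
        exact le_self_pow₀ hCS1 (by omega))
    refine hb.trans ?_
    have hf : (k.factorial : ℝ) ≤ 2 := by interval_cases k <;> norm_num [Nat.factorial]
    have hp : (CS * κ x) ^ k ≤ (CS * κ x) ^ 2 := pow_le_pow_right₀ hCSκ hk
    calc (k.factorial : ℝ) * B * (CS * κ x) ^ k ≤ 2 * B * (CS * κ x) ^ 2 := by gcongr
      _ = _ := by ring
  -- `κ² ≤ 2 + 2 N ∑ l_i²` reduces the weighted inequality to the local ones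
  set N : ℝ := (t.card : ℝ) with hN
  set AS : ℝ := 2 + 2 * N * ∑ i ∈ t, A i with hAS
  have hAsum : 0 ≤ ∑ i ∈ t, A i := Finset.sum_nonneg fun i hi => hA i (htU i hi)
  have hN0 : 0 ≤ N := by positivity
  refine ⟨κ, fun j => U.indicator (Φ j), 2 * B * CS ^ 2, AS,
    measurable_const.add (Finset.measurable_fun_sum t fun i hi => hlm i (htU i hi)), hκ1,
    by positivity, by positivity, htest,
    fun j x => indicator_nonneg (fun x _ => stepDown_nonneg _) x,
    fun j x => indicator_le' (fun x _ => stepDown_le_one _) (fun x _ => zero_le_one) x, hΦbd,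
    ?_, ?_⟩
  · intro j x hxU hx
    have hall : ∀ i ∈ t, ∀ᶠ y in 𝓝 x, h i (2 * j) y = 0 := fun i hi =>
      hzero i (htU i hi) _ x hxU (by linarith [hlκ i hi x])
    filter_upwards [(Finset.eventually_all t).2 hall, hevU j x hxU] with y hy1 hy2
    rw [hy2]
    refine stepDown_of_le_one ?_
    simp only [S]
    rw [Finset.sum_eq_zero hy1, add_zero]
  · intro ψ hψ
    have hptw : ∀ x, ‖κ x‖ₑ ^ 2 ≤ 2 + ENNReal.ofReal (2 * N) * ∑ i ∈ t, ‖l i x‖ₑ ^ 2 := fun x => by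
      simp only [enorm_sq_eq_ofReal]
      rw [← ENNReal.ofReal_sum_of_nonneg (fun i _ => sq_nonneg _),
        ← ENNReal.ofReal_mul (by positivity), show (2 : ℝ≥0∞) = ENNReal.ofReal 2 by simp,
        ← ENNReal.ofReal_add (by norm_num) (mul_nonneg (by positivity)
          (Finset.sum_nonneg fun i _ => sq_nonneg _))]
      refine ENNReal.ofReal_le_ofReal ?_
      have h1 := sq_sum_le_card_mul_sum_sq (s := t) (f := fun i => l i x)
      simp only [hκ]
      nlinarith [sq_nonneg (1 - ∑ i ∈ t, l i x)]
    have hψm : AEMeasurable (fun x => ‖ψ x‖ₑ ^ 2) (volume.restrict U) :=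
      (hψ.memLp 1).1.enorm.pow_const 2
    set I0 := ∫⁻ x in U, ‖ψ x‖ₑ ^ 2
    set I1 := ∫⁻ x in U, ‖gradient ψ x‖ₑ ^ 2
    calc ∫⁻ x in U, ‖κ x‖ₑ ^ 2 * ‖ψ x‖ₑ ^ 2
        ≤ ∫⁻ x in U, (2 * ‖ψ x‖ₑ ^ 2
            + ENNReal.ofReal (2 * N) * ∑ i ∈ t, ‖l i x‖ₑ ^ 2 * ‖ψ x‖ₑ ^ 2) := by
          refine lintegral_mono fun x => ?_
          rw [← Finset.sum_mul, ← mul_assoc, ← add_mul]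
          gcongr
          exact hptw x
      _ = 2 * I0 + ENNReal.ofReal (2 * N) * ∑ i ∈ t, ∫⁻ x in U, ‖l i x‖ₑ ^ 2 * ‖ψ x‖ₑ ^ 2 := by
          rw [lintegral_add_left' (hψm.const_mul 2), lintegral_const_mul'' _ hψm,
            lintegral_const_mul' _ _ ENNReal.ofReal_ne_top, lintegral_finsetSum' t]
          intro i hi
          exact ((hlm i (htU i hi)).enorm.pow_const 2).aemeasurable.mul hψm
      _ ≤ 2 * I0 + ENNReal.ofReal (2 * N) * ∑ i ∈ t, ENNReal.ofReal (A i) * (I0 + I1) := by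
          gcongr with i hi
          rw [mul_add]
          exact hardy i (htU i hi) ψ hψ
      _ = 2 * I0 + ENNReal.ofReal (2 * N * ∑ i ∈ t, A i) * (I0 + I1) := by
          rw [← Finset.sum_mul, ← ENNReal.ofReal_sum_of_nonneg (fun i hi => hA i (htU i hi)),
            ← mul_assoc, ← ENNReal.ofReal_mul (by positivity)]
      _ ≤ 2 * (I0 + I1) + ENNReal.ofReal (2 * N * ∑ i ∈ t, A i) * (I0 + I1) := by
          gcongr
          exact le_self_add
      _ = _ := by
          rw [← add_mul, show (2 : ℝ≥0∞) = ENNReal.ofReal 2 by simp,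
            ← ENNReal.ofReal_add (by norm_num) (by positivity), mul_add]

end Cutoff

/-! ### The kinetic function -/

section Kinetic

lemma measurable_kinetic : Measurable (Function.uncurry kinetic) := by
  unfold kinetic Function.uncurry
  refine Measurable.sub (Measurable.ite ?_ measurable_const measurable_const)
    (Measurable.ite ?_ measurable_const measurable_const)
  · exact (measurableSet_lt measurable_const measurable_snd).inter
      (measurableSet_lt measurable_snd measurable_fst)
  · exact (measurableSet_lt measurable_fst measurable_snd).inter
      (measurableSet_lt measurable_snd measurable_const)

lemma kinetic_of_pos {w ξ : ℝ} (hξ : 0 < ξ) : kinetic w ξ = if ξ < w then 1 else 0 := by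
  simp [kinetic, hξ, hξ.not_gt]

lemma kinetic_of_neg {w ξ : ℝ} (hξ : ξ < 0) : kinetic w ξ = if w < ξ then -1 else 0 := by
  unfold kinetic
  split_ifs with h1 h2 h2 <;> first | (exfalso; linarith [h1.1]) | simp_all

@[simp] lemma kinetic_zero (w : ℝ) : kinetic w 0 = 0 := by simp [kinetic]

/-- The kinetic function lives on levels between `0` and `w`. -/
lemma abs_le_of_kinetic_ne_zero {w ξ : ℝ} (h : kinetic w ξ ≠ 0) : |ξ| ≤ |w| := by
  rcases lt_trichotomy ξ 0 with hξ | rfl | hξ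
  · rw [kinetic_of_neg hξ] at h
    have : w < ξ := by by_contra hc; simp [hc] at h
    rw [abs_of_neg hξ, abs_of_neg (this.trans hξ)]; linarith
  · simp at h
  · rw [kinetic_of_pos hξ] at h
    have : ξ < w := by by_contra hc; simp [hc] at h
    rw [abs_of_pos hξ, abs_of_pos (hξ.trans this)]; linarith

lemma kinetic_mul_nonneg {w ξ b : ℝ} (h : 0 ≤ ξ * b) : 0 ≤ kinetic w ξ * b := by
  rcases lt_trichotomy ξ 0 with hξ | rfl | hξ
  · rw [kinetic_of_neg hξ]
    have : b ≤ 0 := by by_contra hb; push Not at hb; nlinarith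
    split_ifs <;> simp [this]
  · simp
  · rw [kinetic_of_pos hξ]
    have : 0 ≤ b := by by_contra hb; push Not at hb; nlinarith
    split_ifs <;> simp [this]

lemma kinetic_neg_neg (w ξ : ℝ) : kinetic (-w) (-ξ) = -kinetic w ξ := by
  rcases lt_trichotomy ξ 0 with h | rfl | h
  · rw [kinetic_of_neg h, kinetic_of_pos (by linarith)]; simp only [neg_lt_neg_iff]
    split_ifs <;> simp
  · simp
  · rw [kinetic_of_pos h, kinetic_of_neg (by linarith)]; simp only [neg_lt_neg_iff]
    split_ifs <;> simp

/-- The layer-cake formula `∫ |χ̄(w, ξ)| |ξ|^a dξ = |w|^{a+1} / (a+1)`. -/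
lemma lintegral_kinetic_rpow {a : ℝ} (ha : -1 < a) (w : ℝ) :
    ∫⁻ ξ, ‖kinetic w ξ‖ₑ * ENNReal.ofReal (|ξ| ^ a)
      = ENNReal.ofReal (|w| ^ (a + 1) / (a + 1)) := by
  have main : ∀ w : ℝ, 0 ≤ w → ∫⁻ ξ, ‖kinetic w ξ‖ₑ * ENNReal.ofReal (|ξ| ^ a)
      = ENNReal.ofReal (|w| ^ (a + 1) / (a + 1)) := fun w hw => by
    have h1 : ∀ ξ, ‖kinetic w ξ‖ₑ * ENNReal.ofReal (|ξ| ^ a)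
        = (Ioo 0 w).indicator (fun ξ => ENNReal.ofReal (ξ ^ a)) ξ := fun ξ => by
      rcases lt_trichotomy ξ 0 with h | rfl | h
      · rw [kinetic_of_neg h, if_neg (by linarith), indicator_of_notMem (by simp [h.not_gt])]
        simp
      · simp
      · rw [kinetic_of_pos h]
        by_cases hw : ξ < w
        · rw [indicator_of_mem (show ξ ∈ Ioo 0 w from ⟨h, hw⟩), if_pos hw, abs_of_pos h]; simp
        · rw [indicator_of_notMem (fun hm => hw hm.2), if_neg hw]; simp
    have hint := (intervalIntegral.intervalIntegrable_rpow' (a := 0) (b := w) ha)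
    have hint' : IntegrableOn (fun ξ : ℝ => ξ ^ a) (Ioo 0 w) :=
      ((intervalIntegrable_iff_integrableOn_Ioo_of_le hw).1 hint)
    simp_rw [h1]
    rw [lintegral_indicator measurableSet_Ioo, ← ofReal_integral_eq_lintegral_ofReal hint'
      ((ae_restrict_iff' measurableSet_Ioo).2 (.of_forall fun ξ hξ =>
        Real.rpow_nonneg hξ.1.le _)), ← integral_Ioc_eq_integral_Ioo,
      ← intervalIntegral.integral_of_le hw, integral_rpow (Or.inl ha),
      Real.zero_rpow (by linarith), abs_of_nonneg hw, sub_zero]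
  rcases le_total 0 w with hw | hw
  · exact main w hw
  · rw [← abs_neg w, ← main (-w) (by linarith), ← lintegral_neg_eq_self]
    refine lintegral_congr fun ξ => ?_
    have := kinetic_neg_neg (-w) ξ
    rw [neg_neg] at this
    rw [this, enorm_neg, abs_neg]

end Kinetic

/-! ### Test functions in the level variable -/

section Profile

/-- Smooth profiles `ψ` of growth `|a|^e`, with the matching bounds on the derivatives that come
from scaling. -/
structure IsProfile (ψ : ℝ → ℝ) (K e : ℝ) : Prop where
  smooth : ContDiff ℝ ∞ ψ
  bound_zero : ∀ a, |ψ a| ≤ K * |a| ^ e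
  bound_one : ∀ a, |a * deriv ψ a| ≤ K * |a| ^ e
  bound_two : ∀ a, |a ^ 2 * deriv (deriv ψ) a| ≤ K * |a| ^ e

lemma IsProfile.hasDerivAt {ψ : ℝ → ℝ} {K e : ℝ} (h : IsProfile ψ K e) (a : ℝ) :
    HasDerivAt ψ (deriv ψ a) a := (h.smooth.differentiable (by simp) a).hasDerivAt

lemma IsProfile.hasDerivAt_deriv {ψ : ℝ → ℝ} {K e : ℝ} (h : IsProfile ψ K e) (a : ℝ) :
    HasDerivAt (deriv ψ) (deriv (deriv ψ) a) a :=
  ((contDiff_infty_iff_deriv.1 h.smooth).2.differentiable (by simp) a).hasDerivAt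

/-- The function `y ↦ e^{-y} ψ(ξ e^{-y})`: the transported profile in terms of the logarithm of
the weight. -/
noncomputable def expProfile (ψ : ℝ → ℝ) (ξ y : ℝ) : ℝ := Real.exp (-y) * ψ (ξ * Real.exp (-y))

lemma contDiff_expProfile {ψ : ℝ → ℝ} (hψ : ContDiff ℝ ∞ ψ) (ξ : ℝ) :
    ContDiff ℝ ∞ (expProfile ψ ξ) := by
  unfold expProfile
  have h : ContDiff ℝ ∞ fun y : ℝ => Real.exp (-y) := Real.contDiff_exp.comp contDiff_neg
  exact h.mul (hψ.comp (contDiff_const.mul h))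

lemma norm_iteratedFDeriv_expProfile_le {ψ : ℝ → ℝ} {K e : ℝ} (h : IsProfile ψ K e) (he : 0 ≤ e)
    {Y y : ℝ} (hy : |y| ≤ Y) (ξ : ℝ) {i : ℕ} (hi : i ≤ 2) :
    ‖iteratedFDeriv ℝ i (expProfile ψ ξ) y‖ ≤ 5 * K * Real.exp (Y * (1 + e)) * |ξ| ^ e := by
  set E := Real.exp (-y) with hE
  set a := ξ * E with ha
  have hd0 : ∀ y : ℝ, HasDerivAt (fun y : ℝ => Real.exp (-y)) (-Real.exp (-y)) y := fun y => by
    exact ((Real.hasDerivAt_exp (-y)).comp y (hasDerivAt_neg y)).congr_deriv (by simp)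
  have hd1 : ∀ y, HasDerivAt (expProfile ψ ξ)
      (-(Real.exp (-y) * (ψ (ξ * Real.exp (-y))
        + (ξ * Real.exp (-y)) * deriv ψ (ξ * Real.exp (-y))))) y := fun y => by
    have h1 := (h.hasDerivAt (ξ * Real.exp (-y))).comp y ((hd0 y).const_mul ξ)
    refine ((hd0 y).mul h1).congr_deriv ?_
    simp only [Function.comp_apply]
    ring
  have hd2 : HasDerivAt (fun y => -(Real.exp (-y) * (ψ (ξ * Real.exp (-y))
        + (ξ * Real.exp (-y)) * deriv ψ (ξ * Real.exp (-y)))))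
      (E * (ψ a + 3 * (a * deriv ψ a) + a ^ 2 * deriv (deriv ψ) a)) y := by
    have h1 := (h.hasDerivAt (ξ * Real.exp (-y))).comp y ((hd0 y).const_mul ξ)
    have h2 := (h.hasDerivAt_deriv (ξ * Real.exp (-y))).comp y ((hd0 y).const_mul ξ)
    refine ((hd0 y).mul (h1.add (((hd0 y).const_mul ξ).mul h2))).neg.congr_deriv ?_
    simp only [Function.comp_apply, Pi.add_apply, Pi.mul_apply, ha, hE]
    ring
  have hderiv : deriv (expProfile ψ ξ) = fun y => -(Real.exp (-y) * (ψ (ξ * Real.exp (-y))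
        + (ξ * Real.exp (-y)) * deriv ψ (ξ * Real.exp (-y)))) := funext fun y => (hd1 y).deriv
  have b0 := h.bound_zero a
  have b1 := h.bound_one a
  have b2 := h.bound_two a
  have hE0 : 0 < E := Real.exp_pos _
  have hEY : E ≤ Real.exp Y := Real.exp_le_exp.2 (by linarith [neg_le_of_abs_le hy])
  have hK : 0 ≤ K * |a| ^ e := (abs_nonneg _).trans b0
  have hfin : E * (5 * (K * |a| ^ e)) ≤ 5 * K * Real.exp (Y * (1 + e)) * |ξ| ^ e := by
    rcases eq_or_ne ξ 0 with hξ | hξ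
    · rw [hξ] at ha
      rcases eq_or_lt_of_le he with he0 | he0
      · rw [← he0] at hK ⊢
        simp only [Real.rpow_zero, mul_one, add_zero] at hK ⊢
        nlinarith
      · rw [ha, hξ]; simp [Real.zero_rpow he0.ne']
    have hKpos : 0 ≤ K := by
      have : 0 < |a| ^ e := Real.rpow_pos_of_pos (abs_pos.2 (mul_ne_zero hξ hE0.ne')) _
      by_contra hneg
      push Not at hneg
      nlinarith
    have h1 : |a| ^ e = |ξ| ^ e * E ^ e := by
      rw [ha, abs_mul, abs_of_pos hE0, Real.mul_rpow (abs_nonneg _) hE0.le]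
    have h2 : E * E ^ e ≤ Real.exp (Y * (1 + e)) := by
      have : E ^ (1 + e) ≤ Real.exp Y ^ (1 + e) := Real.rpow_le_rpow hE0.le hEY (by linarith)
      rw [Real.rpow_add hE0, Real.rpow_one, ← Real.exp_mul Y] at this
      exact this
    calc E * (5 * (K * |a| ^ e)) = 5 * K * (E * E ^ e) * |ξ| ^ e := by rw [h1]; ring
      _ ≤ _ := by gcongr
  rw [norm_iteratedFDeriv_eq_norm_iteratedDeriv]
  refine le_trans ?_ hfin
  interval_cases i
  · rw [iteratedDeriv_zero, Real.norm_eq_abs, expProfile, abs_mul, abs_of_pos (Real.exp_pos _)]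
    gcongr
    linarith
  · rw [iteratedDeriv_one, hderiv, Real.norm_eq_abs, abs_neg, abs_mul, abs_of_pos (Real.exp_pos _)]
    gcongr
    refine (abs_add_le _ _).trans ?_
    change |ψ a| + |a * deriv ψ a| ≤ _
    linarith
  · rw [iteratedDeriv_succ, iteratedDeriv_one, hderiv, hd2.deriv, Real.norm_eq_abs, abs_mul,
      abs_of_pos hE0]
    gcongr
    refine (abs_add_le _ _).trans ?_
    have := abs_add_le (ψ a) (3 * (a * deriv ψ a))
    rw [abs_mul 3, abs_of_pos (by norm_num : (0 : ℝ) < 3)] at this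
    linarith

/-- An even smooth cutoff, equal to `1` on `[-1, 1]`. -/
noncomputable def evenCut (b : ℝ) : ℝ := stepDown (b ^ 2)

lemma contDiff_evenCut : ContDiff ℝ ∞ evenCut := contDiff_stepDown.comp (contDiff_id.pow 2)

lemma evenCut_eq_zero {b : ℝ} (hb : 2 < |b|) : evenCut b = 0 :=
  stepDown_of_two_le (by rw [← sq_abs]; nlinarith)

lemma evenCut_eq_one {b : ℝ} (hb : |b| ≤ 1) : evenCut b = 1 :=
  stepDown_of_le_one (by rwa [sq_le_one_iff_abs_le_one])

lemma abs_evenCut_le_one (b : ℝ) : |evenCut b| ≤ 1 := by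
  unfold evenCut
  rw [abs_of_nonneg (stepDown_nonneg _)]
  exact stepDown_le_one _

lemma exists_bound_evenCut : ∃ C₁ C₂ : ℝ, (∀ b, |b * deriv evenCut b| ≤ C₁) ∧
    ∀ b, |b ^ 2 * deriv (deriv evenCut) b| ≤ C₂ := by
  have hsupp : HasCompactSupport evenCut := by
    refine HasCompactSupport.intro (isCompact_Icc (a := (-2 : ℝ)) (b := 2))
      fun b hb => evenCut_eq_zero ?_
    by_contra hc
    push Not at hc
    exact hb (abs_le.1 hc)
  have h1 : ContDiff ℝ ∞ (deriv evenCut) := (contDiff_infty_iff_deriv.1 contDiff_evenCut).2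
  have h2 : ContDiff ℝ ∞ (deriv (deriv evenCut)) := (contDiff_infty_iff_deriv.1 h1).2
  have c1 : Continuous fun b : ℝ => b * deriv evenCut b := continuous_id.mul h1.continuous
  have c2 : Continuous fun b : ℝ => b ^ 2 * deriv (deriv evenCut) b :=
    (continuous_id.pow 2).mul h2.continuous
  have s1 : HasCompactSupport fun b : ℝ => b * deriv evenCut b := hsupp.deriv.mul_left
  have s2 : HasCompactSupport fun b : ℝ => b ^ 2 * deriv (deriv evenCut) b :=
    hsupp.deriv.deriv.mul_left
  obtain ⟨C₁, hC₁⟩ := c1.bounded_above_of_compact_support s1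
  obtain ⟨C₂, hC₂⟩ := c2.bounded_above_of_compact_support s2
  exact ⟨C₁, C₂, hC₁, hC₂⟩

/-- Truncation of a profile at the level `1 / ε`. -/
noncomputable def truncProfile (ψ : ℝ → ℝ) (ε a : ℝ) : ℝ := ψ a * evenCut (ε * a)

lemma truncProfile_of_abs_le {ψ : ℝ → ℝ} {ε a : ℝ} (h : |ε * a| ≤ 1) :
    truncProfile ψ ε a = ψ a := by
  rw [truncProfile, evenCut_eq_one h, mul_one]

/-- Truncating a profile of linear growth preserves the bounds, uniformly in the truncation
level. -/
lemma IsProfile.exists_trunc_bound : ∃ B : ℝ, 1 ≤ B ∧ ∀ (ψ : ℝ → ℝ) (K : ℝ), IsProfile ψ K 1 →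
    (∀ a, |deriv ψ a| ≤ K) → ∀ ε : ℝ, 0 < ε → IsProfile (truncProfile ψ ε) (B * K) 1 ∧
      (∀ a, |deriv (truncProfile ψ ε) a| ≤ B * K) ∧ HasCompactSupport (truncProfile ψ ε) := by
  obtain ⟨C1, C2, hC1, hC2⟩ := exists_bound_evenCut
  have hC10 : 0 ≤ C1 := (abs_nonneg _).trans (hC1 0)
  have hC20 : 0 ≤ C2 := (abs_nonneg _).trans (hC2 0)
  have hk1 : ContDiff ℝ ∞ (deriv evenCut) := (contDiff_infty_iff_deriv.1 contDiff_evenCut).2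
  refine ⟨1 + 2 * C1 + C2, by linarith, fun ψ K hψ hK ε hε => ?_⟩
  have hK0 : 0 ≤ K := (abs_nonneg _).trans (hK 0)
  have hψd : Differentiable ℝ ψ := hψ.smooth.differentiable (by simp)
  have hkd : Differentiable ℝ evenCut := contDiff_evenCut.differentiable (by simp)
  have hk1d : Differentiable ℝ (deriv evenCut) := hk1.differentiable (by simp)
  have hc1 : ∀ a, HasDerivAt (fun a => evenCut (ε * a)) (ε * deriv evenCut (ε * a)) a := fun a => by
    have := (hkd (ε * a)).hasDerivAt.comp a ((hasDerivAt_id a).const_mul ε)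
    exact this.congr_deriv (by simp; ring)
  have hc2 : ∀ a, HasDerivAt (fun a => ε * deriv evenCut (ε * a))
      (ε ^ 2 * deriv (deriv evenCut) (ε * a)) a := fun a => by
      have := ((hk1d (ε * a)).hasDerivAt.comp a ((hasDerivAt_id a).const_mul ε)).const_mul ε
      exact this.congr_deriv (by simp; ring)
  have hd1 : ∀ a, HasDerivAt (truncProfile ψ ε)
      (deriv ψ a * evenCut (ε * a) + ψ a * (ε * deriv evenCut (ε * a))) a := fun a =>
    (hψ.hasDerivAt a).mul (hc1 a)
  have hderiv : deriv (truncProfile ψ ε)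
      = fun a => deriv ψ a * evenCut (ε * a) + ψ a * (ε * deriv evenCut (ε * a)) :=
    funext fun a => (hd1 a).deriv
  have hd2 : ∀ a, HasDerivAt
      (fun a => deriv ψ a * evenCut (ε * a) + ψ a * (ε * deriv evenCut (ε * a)))
      ((deriv (deriv ψ) a * evenCut (ε * a) + deriv ψ a * (ε * deriv evenCut (ε * a)))
        + (deriv ψ a * (ε * deriv evenCut (ε * a))
          + ψ a * (ε ^ 2 * deriv (deriv evenCut) (ε * a)))) a :=
    fun a => ((hψ.hasDerivAt_deriv a).mul (hc1 a)).add ((hψ.hasDerivAt a).mul (hc2 a))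
  have b0 : ∀ a, |ψ a| ≤ K * |a| := fun a => by simpa using hψ.bound_zero a
  have b1 : ∀ a, |a * deriv ψ a| ≤ K * |a| := fun a => by simpa using hψ.bound_one a
  have b2 : ∀ a, |a ^ 2 * deriv (deriv ψ) a| ≤ K * |a| := fun a => by simpa using hψ.bound_two a
  have hkabs : ∀ a, |evenCut (ε * a)| ≤ 1 := fun a => abs_evenCut_le_one _
  have m1 : ∀ a, |ε * a * deriv evenCut (ε * a)| ≤ C1 := fun a => hC1 (ε * a)
  have m2 : ∀ a, |(ε * a) ^ 2 * deriv (deriv evenCut) (ε * a)| ≤ C2 := fun a => hC2 (ε * a)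
  have hmul : ∀ {x y X Z : ℝ}, |x| ≤ X → |y| ≤ Z → |x * y| ≤ X * Z := fun {x y X Z} hx hy => by
    rw [abs_mul]; exact mul_le_mul hx hy (abs_nonneg _) ((abs_nonneg _).trans hx)
  have hsmooth : ContDiff ℝ ∞ (truncProfile ψ ε) :=
    hψ.smooth.mul (contDiff_evenCut.comp (contDiff_const.mul contDiff_id))
  have hexp : ∀ a, (1 + 2 * C1 + C2) * K * |a| = K * |a| + 2 * (K * |a| * C1) + K * |a| * C2 :=
    fun a => by ring
  have p0 : ∀ a, 0 ≤ K * |a| := fun a => by positivity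
  have p1 : ∀ a, 0 ≤ K * |a| * C1 := fun a => by positivity
  have p2 : ∀ a, 0 ≤ K * |a| * C2 := fun a => by positivity
  refine ⟨⟨hsmooth, fun a => ?_, fun a => ?_, fun a => ?_⟩, fun a => ?_, ?_⟩
  · rw [Real.rpow_one]
    have := hmul (b0 a) (hkabs a)
    rw [hexp]
    calc |truncProfile ψ ε a| ≤ K * |a| * 1 := this
      _ ≤ _ := by linarith [p1 a, p2 a]
  · rw [Real.rpow_one, hderiv]
    have e : a * (deriv ψ a * evenCut (ε * a) + ψ a * (ε * deriv evenCut (ε * a)))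
        = a * deriv ψ a * evenCut (ε * a) + ψ a * (ε * a * deriv evenCut (ε * a)) := by ring
    simp only [e]
    have h1 := hmul (b1 a) (hkabs a)
    have h2 := hmul (b0 a) (m1 a)
    rw [hexp]
    refine (abs_add_le _ _).trans ?_
    linarith [p1 a, p2 a]
  · rw [Real.rpow_one, hderiv, (hd2 a).deriv]
    have e : a ^ 2 * ((deriv (deriv ψ) a * evenCut (ε * a)
          + deriv ψ a * (ε * deriv evenCut (ε * a)))
        + (deriv ψ a * (ε * deriv evenCut (ε * a)) + ψ a * (ε ^ 2 * deriv (deriv evenCut) (ε * a))))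
        = a ^ 2 * deriv (deriv ψ) a * evenCut (ε * a)
          + 2 * (a * deriv ψ a * (ε * a * deriv evenCut (ε * a)))
          + ψ a * ((ε * a) ^ 2 * deriv (deriv evenCut) (ε * a)) := by ring
    rw [e]
    have h1 := hmul (b2 a) (hkabs a)
    have h2 := hmul (b1 a) (m1 a)
    have h3 := hmul (b0 a) (m2 a)
    have t1 := abs_add_le (a ^ 2 * deriv (deriv ψ) a * evenCut (ε * a)
      + 2 * (a * deriv ψ a * (ε * a * deriv evenCut (ε * a))))
      (ψ a * ((ε * a) ^ 2 * deriv (deriv evenCut) (ε * a)))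
    have t2 := abs_add_le (a ^ 2 * deriv (deriv ψ) a * evenCut (ε * a))
      (2 * (a * deriv ψ a * (ε * a * deriv evenCut (ε * a))))
    rw [abs_mul 2, abs_of_pos (two_pos : (0 : ℝ) < 2)] at t2
    rw [hexp]
    linarith
  · rw [hderiv]
    have h1 := hmul (hK a) (hkabs a)
    have h2 : |ψ a * (ε * deriv evenCut (ε * a))| ≤ K * C1 := by
      calc |ψ a * (ε * deriv evenCut (ε * a))| = |ψ a| * |ε * deriv evenCut (ε * a)| := abs_mul _ _
        _ ≤ K * |a| * |ε * deriv evenCut (ε * a)| := by gcongr; exact b0 a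
        _ = K * |ε * a * deriv evenCut (ε * a)| := by
            rw [mul_assoc, ← abs_mul]; congr 2; ring
        _ ≤ _ := by gcongr; exact m1 a
    refine (abs_add_le _ _).trans ?_
    have q1 : 0 ≤ K * C1 := by positivity
    have q2 : 0 ≤ K * C2 := by positivity
    linarith
  · refine HasCompactSupport.intro (isCompact_Icc (a := -(2 / ε)) (b := 2 / ε)) fun a ha => ?_
    have : 2 < |ε * a| := by
      by_contra hc
      push Not at hc
      rw [abs_mul, abs_of_pos hε] at hc
      exact ha (abs_le.1 (by rw [le_div_iff₀ hε]; linarith))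
    rw [truncProfile, evenCut_eq_zero this, mul_zero]

end Profile

/-! ### Transported test functions and their Laplacians -/

section Weight

variable {d n : ℕ} {U : Set (Space d)} {f : Fin n → Space d → ℝ} {z : ℝ → Fin n → ℝ}

/-- The exponent `∑ a_k f_k` of the weight, for a fixed increment `a` of the driving signal. -/
def logWeight (f : Fin n → Space d → ℝ) (a : Fin n → ℝ) (x : Space d) : ℝ := ∑ k, f k x * a k

lemma weight_eq_exp (s t : ℝ) (x : Space d) :
    weight f z s t x = Real.exp (-logWeight f (z t - z s) x) := rfl

lemma backChar_eq (s t : ℝ) (x : Space d) (ξ : ℝ) :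
    backChar f z s t x ξ = ξ * weight f z s t x := by
  unfold backChar weight
  congr 2
  rw [← Finset.sum_neg_distrib]
  exact Finset.sum_congr rfl fun k _ => by ring

lemma weight_self (s : ℝ) (x : Space d) : weight f z s s x = 1 := by simp [weight]

lemma transported_prod (φ : Space d → ℝ) (ψ : ℝ → ℝ) (s t : ℝ) (x : Space d) (ξ : ℝ) :
    transported f z (fun y => φ y.1 * ψ y.2) s t x ξ
      = φ x * expProfile ψ ξ (logWeight f (z t - z s) x) := by
  unfold transported
  rw [backChar_eq, weight_eq_exp]
  simp only [expProfile]
  ring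

lemma expProfile_logWeight (ψ : ℝ → ℝ) (s t : ℝ) (x : Space d) (ξ : ℝ) :
    expProfile ψ ξ (logWeight f (z t - z s) x) = weight f z s t x * ψ (ξ * weight f z s t x) := by
  rw [weight_eq_exp, expProfile]

lemma contDiffOn_logWeight (hf : ∀ k, IsCb2 U (f k)) (a : Fin n → ℝ) :
    ContDiffOn ℝ 2 (logWeight f a) U :=
  ContDiffOn.sum fun k _ => (hf k).1.mul contDiffOn_const

lemma exists_bound_logWeight (hUo : IsOpen U) (hf : ∀ k, IsCb2 U (f k)) :
    ∃ M : ℝ, 0 < M ∧ ∀ a : Fin n → ℝ, ∀ i ≤ 2, ∀ x ∈ U,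
      ‖iteratedFDeriv ℝ i (logWeight f a) x‖ ≤ M * ‖a‖ := by
  choose M hM using fun k => (hf k).2
  refine ⟨1 + ∑ k, |M k|, by positivity, fun a i hi x hx => ?_⟩
  have hc : ∀ k, ContDiffAt ℝ i (f k) x := fun k =>
    ((hf k).1.contDiffAt (hUo.mem_nhds hx)).of_le (by exact_mod_cast hi)
  have e : iteratedFDeriv ℝ i (logWeight f a) x = ∑ k, a k • iteratedFDeriv ℝ i (f k) x := by
    rw [show logWeight f a = ∑ k, a k • f k by ext y; simp [logWeight, mul_comm],
      iteratedFDeriv_sum_apply (f := fun k => a k • f k)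
        fun k _ => contDiffAt_const.smul (hc k)]
    exact Finset.sum_congr rfl fun k _ => iteratedFDeriv_const_smul_apply (hc k)
  rw [e]
  calc ‖∑ k, a k • iteratedFDeriv ℝ i (f k) x‖ ≤ ∑ k, |M k| * ‖a‖ := by
        refine norm_sum_le_of_le _ fun k _ => ?_
        rw [norm_smul, mul_comm]
        have := hM k i hi x hx
        rw [iteratedFDerivWithin_of_isOpen i hUo hx] at this
        gcongr
        · exact this.trans (le_abs_self _)
        · exact norm_le_pi_norm a k
    _ = (∑ k, |M k|) * ‖a‖ := by rw [Finset.sum_mul]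
    _ ≤ _ := by gcongr; linarith

lemma abs_laplacian_le (g : Space d → ℝ) (x : Space d) :
    |Laplacian.laplacian g x| ≤ d * ‖iteratedFDeriv ℝ 2 g x‖ := by
  rw [InnerProductSpace.laplacian_eq_iteratedFDeriv_orthonormalBasis g
    (EuclideanSpace.basisFun (Fin d) ℝ)]
  refine (Finset.abs_sum_le_sum_abs _ _).trans ?_
  calc ∑ i, |iteratedFDeriv ℝ 2 g x ![EuclideanSpace.basisFun (Fin d) ℝ i,
        EuclideanSpace.basisFun (Fin d) ℝ i]|
      ≤ ∑ _i : Fin d, ‖iteratedFDeriv ℝ 2 g x‖ := by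
        refine Finset.sum_le_sum fun i _ => ?_
        refine ((iteratedFDeriv ℝ 2 g x).le_opNorm _).trans ?_
        simp [Fin.prod_univ_two]
    _ = _ := by simp

lemma norm_iteratedFDeriv_comp_logWeight_le (hUo : IsOpen U) (hf : ∀ k, IsCb2 U (f k))
    {Θ : ℝ → ℝ} (hΘ : ContDiff ℝ ∞ Θ) {a : Fin n → ℝ} {x : Space d} (hx : x ∈ U) {B D : ℝ}
    (hB : ∀ i ≤ 2, ‖iteratedFDeriv ℝ i Θ (logWeight f a x)‖ ≤ B)
    (hD : ∀ i, 1 ≤ i → i ≤ 2 → ‖iteratedFDeriv ℝ i (logWeight f a) x‖ ≤ D ^ i) {i : ℕ}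
    (hi : i ≤ 2) (hD0 : 0 ≤ D) :
    ‖iteratedFDeriv ℝ i (fun y => Θ (logWeight f a y)) x‖ ≤ 2 * B * D ^ i := by
  have h := norm_iteratedFDerivWithin_comp_le (g := Θ) (f := logWeight f a) (n := i) (s := U)
    (t := univ) (x := x) (N := 2) (hΘ.of_le (by norm_cast)).contDiffOn
    (contDiffOn_logWeight hf a) (by exact_mod_cast hi) uniqueDiffOn_univ hUo.uniqueDiffOn
    (mapsTo_univ _ _) hx (C := B) (D := D)
    (fun k hk => by rw [iteratedFDerivWithin_univ]; exact hB k (hk.trans hi))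
    (fun k hk1 hk => by
      rw [iteratedFDerivWithin_of_isOpen k hUo hx]; exact hD k hk1 (hk.trans hi))
  rw [iteratedFDerivWithin_of_isOpen i hUo hx] at h
  refine h.trans ?_
  have hB0 : 0 ≤ B := (norm_nonneg _).trans (hB 0 (by norm_num))
  have hf : (i.factorial : ℝ) ≤ 2 := by interval_cases i <;> norm_num [Nat.factorial]
  gcongr

/-- Derivatives up to order two of a transported profile are bounded by its growth function: each
`x`-derivative produces powers of `a d/da`, under which the profile bounds are stable. -/
lemma norm_iteratedFDeriv_transported_le (hUo : IsOpen U) (hf : ∀ k, IsCb2 U (f k))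
    {ψ : ℝ → ℝ} {K e Y : ℝ} (hψ : IsProfile ψ K e) (he : 0 ≤ e) {a : Fin n → ℝ}
    (hY : ∀ i ≤ 2, ∀ x ∈ U, ‖iteratedFDeriv ℝ i (logWeight f a) x‖ ≤ Y) {x : Space d}
    (hx : x ∈ U) (ξ : ℝ) {i : ℕ} (hi : i ≤ 2) :
    ‖iteratedFDeriv ℝ i (fun y => expProfile ψ ξ (logWeight f a y)) x‖
      ≤ 2 * (5 * K * Real.exp (Y * (1 + e)) * |ξ| ^ e) * (1 + Y) ^ i := by
  have hY0 : 0 ≤ Y := (norm_nonneg _).trans (hY 0 (by norm_num) x hx)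
  refine norm_iteratedFDeriv_comp_logWeight_le hUo hf (contDiff_expProfile hψ.smooth ξ) hx
    (fun k hk => norm_iteratedFDeriv_expProfile_le hψ he ?_ ξ hk) (fun k hk1 hk => ?_) hi
    (by linarith)
  · simpa using hY 0 (by norm_num) x hx
  · calc ‖iteratedFDeriv ℝ k (logWeight f a) x‖ ≤ 1 + Y := (hY k hk x hx).trans (by linarith)
      _ ≤ (1 + Y) ^ k := le_self_pow₀ (by linarith) (by omega)

lemma abs_laplacian_transported_le (hUo : IsOpen U) (hf : ∀ k, IsCb2 U (f k))
    {ψ : ℝ → ℝ} {K e Y : ℝ} (hψ : IsProfile ψ K e) (he : 0 ≤ e) {a : Fin n → ℝ}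
    (hY : ∀ i ≤ 2, ∀ x ∈ U, ‖iteratedFDeriv ℝ i (logWeight f a) x‖ ≤ Y) {x : Space d}
    (hx : x ∈ U) (ξ : ℝ) :
    |Laplacian.laplacian (fun y => expProfile ψ ξ (logWeight f a y)) x|
      ≤ d * (10 * K * Real.exp (Y * (1 + e)) * (1 + Y) ^ 2) * |ξ| ^ e := by
  refine (abs_laplacian_le _ x).trans ?_
  have := norm_iteratedFDeriv_transported_le hUo hf hψ he hY hx ξ le_rfl
  calc (d : ℝ) * ‖iteratedFDeriv ℝ 2 (fun y => expProfile ψ ξ (logWeight f a y)) x‖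
      ≤ d * (2 * (5 * K * Real.exp (Y * (1 + e)) * |ξ| ^ e) * (1 + Y) ^ 2) := by gcongr
    _ = _ := by ring

/-- With a cutoff whose derivatives are bounded by `C κ²`, the bound picks up the factor `κ²`. -/
lemma abs_laplacian_cutoff_transported_le (hUo : IsOpen U) (hf : ∀ k, IsCb2 U (f k))
    {ψ : ℝ → ℝ} {K e Y : ℝ} (hψ : IsProfile ψ K e) (he : 0 ≤ e) {a : Fin n → ℝ}
    (hY : ∀ i ≤ 2, ∀ x ∈ U, ‖iteratedFDeriv ℝ i (logWeight f a) x‖ ≤ Y) {x : Space d}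
    (hx : x ∈ U) {φ : Space d → ℝ} (hφ : ContDiff ℝ ∞ φ) {A : ℝ}
    (hA : ∀ i ≤ 2, ‖iteratedFDeriv ℝ i φ x‖ ≤ A) (ξ : ℝ) :
    |Laplacian.laplacian (fun y => φ y * expProfile ψ ξ (logWeight f a y)) x|
      ≤ d * (40 * K * Real.exp (Y * (1 + e)) * (1 + Y) ^ 2) * A * |ξ| ^ e := by
  have hY0 : 0 ≤ Y := (norm_nonneg _).trans (hY 0 (by norm_num) x hx)
  refine (abs_laplacian_le _ x).trans ?_
  have := iteratedFDeriv_mul_bound hUo (hφ.of_le (by norm_cast)).contDiffOn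
    (((contDiff_expProfile hψ.smooth ξ).of_le (by norm_cast)).comp_contDiffOn
      (contDiffOn_logWeight hf a)) hx (by linarith : 1 ≤ 1 + Y) hA
    (fun i hi => norm_iteratedFDeriv_transported_le hUo hf hψ he hY hx ξ hi) le_rfl
  calc (d : ℝ) * ‖iteratedFDeriv ℝ 2 (fun y => φ y * expProfile ψ ξ (logWeight f a y)) x‖
      ≤ d * (4 * A * (2 * (5 * K * Real.exp (Y * (1 + e)) * |ξ| ^ e)) * (1 + Y) ^ 2) :=
        mul_le_mul_of_nonneg_left this (Nat.cast_nonneg d)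
    _ = _ := by ring

/-- For the linear profile and a small increment of the driving signal, the Laplacian of the
transported test function is small. The first derivatives, of size `Y`, enter squared; they are
bounded by `√Y` so that both orders fit a single bound `D ^ i` with `D = √Y`. -/
lemma abs_laplacian_linear_le (hUo : IsOpen U) (hf : ∀ k, IsCb2 U (f k)) {Y : ℝ} (hY1 : Y ≤ 1)
    {a : Fin n → ℝ} (hY : ∀ i ≤ 2, ∀ x ∈ U, ‖iteratedFDeriv ℝ i (logWeight f a) x‖ ≤ Y)
    {x : Space d} (hx : x ∈ U) (ξ : ℝ) :
    |Laplacian.laplacian (fun y => expProfile id ξ (logWeight f a y)) x|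
      ≤ d * (10 * Real.exp 2 * Y) * |ξ| ^ (1 : ℝ) := by
  have hY0 : 0 ≤ Y := (norm_nonneg _).trans (hY 0 (by norm_num) x hx)
  have hid : IsProfile id 1 1 := by
    have hd : deriv (id : ℝ → ℝ) = fun _ => 1 := funext fun a => deriv_id a
    refine ⟨contDiff_id, fun a => by simp, fun a => by simp [hd], fun a => ?_⟩
    simp [hd]
  refine (abs_laplacian_le _ x).trans ?_
  have hs : Real.sqrt Y ^ 2 = Y := Real.sq_sqrt hY0
  have hYs : Y ≤ Real.sqrt Y := by
    have h1 : Real.sqrt Y ≤ 1 := by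
      simpa using Real.sqrt_le_sqrt hY1
    nlinarith [Real.sqrt_nonneg Y]
  have := norm_iteratedFDeriv_comp_logWeight_le hUo hf (contDiff_expProfile hid.smooth ξ) hx
    (a := a) (B := 5 * 1 * Real.exp (1 * (1 + 1)) * |ξ| ^ (1 : ℝ)) (D := Real.sqrt Y)
    (fun k hk => norm_iteratedFDeriv_expProfile_le hid zero_le_one
      ((by simpa using hY 0 (by norm_num) x hx : |logWeight f a x| ≤ Y).trans hY1) ξ hk)
    (fun k hk1 hk => by
      refine (hY k hk x hx).trans ?_
      interval_cases k
      · simpa using hYs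
      · exact hs.ge) le_rfl (Real.sqrt_nonneg _)
  rw [hs] at this
  calc (d : ℝ) * ‖iteratedFDeriv ℝ 2 (fun y => expProfile id ξ (logWeight f a y)) x‖
      ≤ d * (2 * (5 * 1 * Real.exp (1 * (1 + 1)) * |ξ| ^ (1 : ℝ)) * Y) := by gcongr
    _ = _ := by norm_num; ring

end Weight

/-! ### Moments of the kinetic function -/

section KineticIntegrals

variable {X : Type*} [MeasurableSpace X] {μ : Measure X} {w : X → ℝ}

lemma aemeasurable_kinetic_comp (hw : AEMeasurable w μ) :
    AEMeasurable (fun y : ℝ × X => kinetic (w y.2) y.1) (volume.prod μ) :=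
  measurable_kinetic.comp_aemeasurable (hw.comp_snd.prodMk measurable_fst.aemeasurable)

variable [SFinite μ]

/-- Moments of the kinetic function over levels and space are powers of `w`. -/
lemma lintegral_prod_kinetic_rpow {a : ℝ} (ha : -1 < a) (hw : AEMeasurable w μ) {g : X → ℝ≥0∞}
    (hg : AEMeasurable g μ) :
    ∫⁻ y, g y.2 * (‖kinetic (w y.2) y.1‖ₑ * ENNReal.ofReal (|y.1| ^ a)) ∂(volume.prod μ)
      = ∫⁻ x, g x * ENNReal.ofReal (|w x| ^ (a + 1) / (a + 1)) ∂μ := by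
  rw [lintegral_prod_symm _ (by
    refine hg.comp_snd.mul ((aemeasurable_kinetic_comp hw).enorm.mul ?_)
    exact Measurable.aemeasurable (by fun_prop))]
  refine lintegral_congr fun x => ?_
  dsimp only
  have h1 : Measurable fun ξ : ℝ => ‖kinetic (w x) ξ‖ₑ * ENNReal.ofReal (|ξ| ^ a) :=
    (measurable_kinetic.comp (measurable_const.prodMk measurable_id)).enorm.mul (by fun_prop)
  rw [lintegral_const_mul _ h1, lintegral_kinetic_rpow ha]

lemma lintegral_lintegral_kinetic_rpow {a : ℝ} (ha : -1 < a) (hw : AEMeasurable w μ)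
    {g : X → ℝ≥0∞} (hg : AEMeasurable g μ) :
    ∫⁻ ξ, ∫⁻ x, g x * (‖kinetic (w x) ξ‖ₑ * ENNReal.ofReal (|ξ| ^ a)) ∂μ
      = ∫⁻ x, g x * ENNReal.ofReal (|w x| ^ (a + 1) / (a + 1)) ∂μ := by
  rw [← lintegral_prod_kinetic_rpow ha hw hg, lintegral_prod]
  refine hg.comp_snd.mul ((aemeasurable_kinetic_comp hw).enorm.mul ?_)
  exact Measurable.aemeasurable (by fun_prop)

lemma integrable_kinetic_mul_bound (hw : MemLp w 2 μ) (C : ℝ) :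
    Integrable (fun y : ℝ × X => |kinetic (w y.2) y.1| * (C * |y.1|)) (volume.prod μ) := by
  have hm := aemeasurable_kinetic_comp hw.1.aemeasurable
  have h1 : Integrable (fun y : ℝ × X => |kinetic (w y.2) y.1| * |y.1|) (volume.prod μ) := by
    refine ⟨((hm.norm).mul (by fun_prop)).aestronglyMeasurable, ?_⟩
    have := lintegral_prod_kinetic_rpow (a := 1) (by norm_num) hw.1.aemeasurable
      (g := fun _ => 1) aemeasurable_const
    simp only [one_mul, Real.rpow_one] at this
    rw [hasFiniteIntegral_iff_enorm]
    calc ∫⁻ y, ‖|kinetic (w y.2) y.1| * |y.1|‖ₑ ∂(volume.prod μ)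
        = ∫⁻ x, ENNReal.ofReal (|w x| ^ ((1 : ℝ) + 1) / (1 + 1)) ∂μ := by
          rw [← this]
          refine lintegral_congr fun y => ?_
          rw [enorm_mul, ← Real.enorm_of_nonneg (abs_nonneg y.1)]
          simp [Real.enorm_eq_ofReal_abs]
      _ ≤ ∫⁻ x, ‖w x‖ₑ ^ 2 ∂μ := by
          refine lintegral_mono fun x => ?_
          rw [enorm_sq_eq_ofReal]
          refine ENNReal.ofReal_le_ofReal ?_
          norm_num
          nlinarith [sq_nonneg (w x)]
      _ < ⊤ := by
          rw [lintegral_enorm_sq_eq_eLpNorm_sq]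
          exact ENNReal.pow_lt_top hw.2
  exact (h1.const_mul C).congr (Eventually.of_forall fun y => by ring)

lemma integrable_kinetic_mul (hw : MemLp w 2 μ) {F : ℝ × X → ℝ} {C : ℝ}
    (hF : AEStronglyMeasurable F (volume.prod μ)) (hC : ∀ᵐ y ∂(volume.prod μ), |F y| ≤ C * |y.1|) :
    Integrable (fun y : ℝ × X => kinetic (w y.2) y.1 * F y) (volume.prod μ) := by
  refine (integrable_kinetic_mul_bound hw C).mono'
    ((aemeasurable_kinetic_comp hw.1.aemeasurable).aestronglyMeasurable.mul hF) ?_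
  filter_upwards [hC] with y hy
  rw [norm_mul, Real.norm_eq_abs, Real.norm_eq_abs]
  gcongr

end KineticIntegrals

/-! ### The parabolic defect measure -/

section Defect

variable {d : ℕ} {U : Set (Space d)}

/-- Measurability in space-time on all bounded time intervals gives measurability on the half
line. -/
lemma aestronglyMeasurable_Ioi {E : Type*} [NormedAddCommGroup E] {G : ℝ → Space d → E}
    (h : ∀ T : ℝ, 0 < T → AEStronglyMeasurable (Function.uncurry G)
      ((volume.restrict (Icc 0 T)).prod (volume.restrict U))) :
    AEStronglyMeasurable (Function.uncurry G)
      ((volume.restrict (Ioi (0 : ℝ))).prod (volume.restrict U)) := by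
  rw [Measure.prod_restrict]
  have h1 : ∀ n : ℕ, AEStronglyMeasurable (Function.uncurry G)
      ((volume.prod volume).restrict (Icc (0 : ℝ) (n + 1) ×ˢ U)) := fun n => by
    rw [← Measure.prod_restrict]
    exact h _ (by positivity)
  refine (aestronglyMeasurable_iUnion_iff.2 h1).mono_set fun y hy => ?_
  obtain ⟨k, hk⟩ := exists_nat_ge y.1
  exact mem_iUnion.2 ⟨k, ⟨⟨le_of_lt hy.1, by linarith⟩, hy.2⟩⟩

/-- Integration against the parabolic defect measure. -/
lemma setLIntegral_parabolicDefect (hUo : IsOpen U) {m s t : ℝ} (hs : 0 ≤ s)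
    {u : ℝ → Space d → ℝ} {G : ℝ → Space d → Space d}
    (hu : AEStronglyMeasurable (Function.uncurry u)
      ((volume.restrict (Ioi (0 : ℝ))).prod (volume.restrict U)))
    (hG : AEStronglyMeasurable (Function.uncurry G)
      ((volume.restrict (Ioi (0 : ℝ))).prod (volume.restrict U)))
    {F : Space d × ℝ × ℝ → ℝ≥0∞}
    (hF : AEMeasurable F ((parabolicDefect m U u G).restrict (U ×ˢ univ ×ˢ Ioc s t))) :
    ∫⁻ y in U ×ˢ univ ×ˢ Ioc s t, F y ∂(parabolicDefect m U u G)
      = ∫⁻ r in Ioc s t, ∫⁻ x in U,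
        ENNReal.ofReal (4 * m / (m + 1) ^ 2 * ‖G r x‖ ^ 2) * F (x, u r x, r) := by
  set D : ℝ × Space d → ℝ≥0∞ := fun y => ENNReal.ofReal (4 * m / (m + 1) ^ 2 * ‖G y.1 y.2‖ ^ 2)
  set ν := (volume.restrict (Ioi (0 : ℝ))).prod (volume.restrict U)
  set Φ : ℝ × Space d → Space d × ℝ × ℝ := fun y => (y.2, u y.1 y.2, y.1)
  have hS : MeasurableSet (U ×ˢ (univ : Set ℝ) ×ˢ Ioc s t) :=
    hUo.measurableSet.prod (MeasurableSet.univ.prod measurableSet_Ioc)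
  have hR : MeasurableSet (Ioc s t ×ˢ U) := measurableSet_Ioc.prod hUo.measurableSet
  have hpre : Φ ⁻¹' (U ×ˢ univ ×ˢ Ioc s t) = Ioc s t ×ˢ U := by
    ext y; simp [Φ, and_comm]
  have hD : AEMeasurable D ν := by
    have : AEMeasurable (fun y : ℝ × Space d => ‖G y.1 y.2‖) ν := hG.norm.aemeasurable
    exact ((this.pow_const 2).const_mul _).ennreal_ofReal
  have hΦ : AEMeasurable Φ (ν.withDensity D) := by
    refine AEMeasurable.mono_ac ?_ (withDensity_absolutelyContinuous ν D)
    exact measurable_snd.aemeasurable.prodMk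
      (hu.aemeasurable.prodMk measurable_fst.aemeasurable)
  have hq : (parabolicDefect m U u G).restrict (U ×ˢ univ ×ˢ Ioc s t)
      = ((ν.restrict (Ioc s t ×ˢ U)).withDensity D).map Φ := by
    rw [← restrict_withDensity hR, ← hpre, ← Measure.restrict_map_of_aemeasurable hΦ hS]
    rfl
  have hsub : Ioc s t ⊆ Ioi (0 : ℝ) := fun r hr => lt_of_le_of_lt hs hr.1
  have hν : ν.restrict (Ioc s t ×ˢ U)
      = (volume.restrict (Ioc s t)).prod (volume.restrict U) := by
    simp only [ν]
    rw [Measure.prod_restrict, Measure.restrict_restrict hR, prod_inter_prod, inter_self,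
      inter_eq_self_of_subset_left hsub,
      Measure.prod_restrict]
  have hac : (ν.restrict (Ioc s t ×ˢ U)).withDensity D ≪ ν.withDensity D := by
    rw [← restrict_withDensity hR]
    exact Measure.restrict_le_self.absolutelyContinuous
  rw [hq] at hF ⊢
  have hΦ' := hΦ.mono_ac hac
  have hFΦ := hF.comp_aemeasurable hΦ'
  have hD' : AEMeasurable D (ν.restrict (Ioc s t ×ˢ U)) := hD.mono_measure Measure.restrict_le_self
  rw [lintegral_map' hF hΦ',
    show (fun a => F (Φ a)) = F ∘ Φ from rfl, lintegral_withDensity_eq_lintegral_mul₀' hD' hFΦ]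
  have hfin : AEMeasurable (D * F ∘ Φ) (ν.restrict (Ioc s t ×ˢ U)) := by
    have hDn : AEMeasurable
        (fun y : ℝ × Space d => (4 * m / (m + 1) ^ 2 * ‖G y.1 y.2‖ ^ 2).toNNReal)
        (ν.restrict (Ioc s t ×ˢ U)) := by
      have : AEMeasurable (fun y : ℝ × Space d => ‖G y.1 y.2‖) ν := hG.norm.aemeasurable
      exact (((this.pow_const 2).const_mul _).real_toNNReal).mono_measure Measure.restrict_le_self
    have h1 := (aemeasurable_withDensity_ennreal_iff' hDn (g := F ∘ Φ)).1 hFΦ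
    exact h1
  rw [hν] at hfin ⊢
  rw [lintegral_prod _ hfin]
  rfl

end Defect

lemma IsTestFunction.prod_mul {d : ℕ} {U : Set (Space d)} {φ : Space d → ℝ}
    (hφ : IsTestFunction U φ) {ψ : ℝ → ℝ} (hψ : ContDiff ℝ ∞ ψ) (hc : HasCompactSupport ψ) :
    IsTestFunction (U ×ˢ (univ : Set ℝ)) fun y : Space d × ℝ => φ y.1 * ψ y.2 := by
  have hK : IsCompact (tsupport φ ×ˢ tsupport ψ) := hφ.compact.prod hc
  have hsub : Function.support (fun y : Space d × ℝ => φ y.1 * ψ y.2)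
      ⊆ tsupport φ ×ˢ tsupport ψ := fun y hy => by
    have := mul_ne_zero_iff.1 hy
    exact ⟨subset_tsupport _ this.1, subset_tsupport _ this.2⟩
  have hts : tsupport (fun y : Space d × ℝ => φ y.1 * ψ y.2) ⊆ tsupport φ ×ˢ tsupport ψ :=
    closure_minimal hsub hK.isClosed
  exact ⟨(hφ.smooth.comp contDiff_fst).mul (hψ.comp contDiff_snd),
    hK.of_isClosed_subset (isClosed_tsupport _) hts,
    fun y hy => ⟨hφ.support_subset (hts hy).1, mem_univ _⟩⟩

/-! ### Signed powers -/

section Spow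

lemma abs_spow {p : ℝ} (hp : 0 < p) (a : ℝ) : |spow p a| = |a| ^ p := by
  unfold spow
  rcases eq_or_ne a 0 with rfl | ha
  · simp [Real.zero_rpow hp.ne']
  · rw [abs_mul, abs_of_nonneg (Real.rpow_nonneg (abs_nonneg a) _),
      ← Real.rpow_add_one (abs_ne_zero.2 ha)]
    congr 1; ring

lemma enorm_spow_sq {m : ℝ} (hm : 0 < m) (a : ℝ) :
    ‖spow ((m + 1) / 2) a‖ₑ ^ 2 = ENNReal.ofReal (|a| ^ (m + 1)) := by
  rw [enorm_sq_eq_ofReal, ← sq_abs, abs_spow (by linarith), ← Real.rpow_natCast,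
    ← Real.rpow_mul (abs_nonneg a)]
  congr 2; push_cast; ring

lemma measurable_spow (p : ℝ) : Measurable (spow p) := by
  unfold spow
  fun_prop

end Spow

/-! ### The flux term -/

section Flux

variable {d n : ℕ} {U : Set (Space d)} {f : Fin n → Space d → ℝ} {z : ℝ → Fin n → ℝ}

/-- Away from the region where one of the two cutoffs acts, the Laplacian of the truncated
transported test function is that of the transported profile; elsewhere it is at most of the
order of `κ ^ 2 * |ξ|`. -/
lemma abs_laplacian_cutoff_trunc_le (hUo : IsOpen U) (hf : ∀ k, IsCb2 U (f k))
    {ψ : ℝ → ℝ} {K ε Y : ℝ} (hε : 0 < ε) (hψ : IsProfile (truncProfile ψ ε) K 1) {a : Fin n → ℝ}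
    (hY : ∀ i ≤ 2, ∀ x ∈ U, ‖iteratedFDeriv ℝ i (logWeight f a) x‖ ≤ Y) {x : Space d}
    (hx : x ∈ U) {ξ L : ℝ} (hL0 : 0 ≤ L)
    (hL : |Laplacian.laplacian (fun y => expProfile ψ ξ (logWeight f a y)) x| ≤ L)
    {φ : Space d → ℝ} (hφ : ContDiff ℝ ∞ φ) {C k : ℝ}
    (hb : ∀ i ≤ 2, ‖iteratedFDeriv ℝ i φ x‖ ≤ C * k ^ 2) {R : ℝ}
    (hone : k < R → ∀ᶠ y in 𝓝 x, φ y = 1) {w : ℝ} (hw : kinetic w ξ ≠ 0) :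
    |Laplacian.laplacian (fun y => φ y * expProfile (truncProfile ψ ε) ξ (logWeight f a y)) x|
      ≤ L + (if R ≤ k ∨ 1 ≤ ε * (|w| * Real.exp Y) then
          d * (40 * K * Real.exp (Y * 2) * (1 + Y) ^ 2) * C * k ^ 2 else 0) * |ξ| := by
  split_ifs with h
  · refine (abs_laplacian_cutoff_transported_le hUo hf hψ zero_le_one hY hx hφ hb ξ).trans ?_
    rw [Real.rpow_one, show (1 : ℝ) + 1 = 2 by norm_num]
    linarith
  · push Not at h
    have heq : (fun y => φ y * expProfile (truncProfile ψ ε) ξ (logWeight f a y))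
        =ᶠ[𝓝 x] fun y => expProfile ψ ξ (logWeight f a y) := by
      filter_upwards [hone h.1, hUo.mem_nhds hx] with y hy hyU
      rw [hy, one_mul, expProfile, expProfile, truncProfile_of_abs_le]
      have h1 : |logWeight f a y| ≤ Y := by simpa using hY 0 (by norm_num) y hyU
      rw [abs_mul, abs_of_pos hε, abs_mul, abs_of_pos (Real.exp_pos _)]
      refine le_trans ?_ h.2.le
      have := abs_le_of_kinetic_ne_zero hw
      gcongr
      linarith [neg_abs_le (logWeight f a y)]
    rw [(InnerProductSpace.laplacian_congr_nhds heq).eq_of_nhds]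
    simpa using hL

/-- The flux term of the kinetic equation at a fixed time, after integration over the levels. -/
lemma lintegral_flux_le {X : Type*} [MeasurableSpace X] {μ : Measure X} [SFinite μ] {m : ℝ}
    (hm : 0 < m) {w : X → ℝ} (hw : AEMeasurable w μ) {L : X → ℝ → ℝ} {Λ e : ℝ} (hΛ : 0 ≤ Λ)
    (he : 0 < m + e) {c : X → ℝ} (hc : AEMeasurable c μ) (hc0 : ∀ x, 0 ≤ c x)
    (hL : ∀ᵐ x ∂μ, ∀ ξ, kinetic (w x) ξ ≠ 0 → |L x ξ| ≤ Λ * |ξ| ^ e + c x * |ξ|) :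
    ∫⁻ ξ, ∫⁻ x, ‖m * |ξ| ^ (m - 1) * kinetic (w x) ξ * L x ξ‖ₑ ∂μ
      ≤ (∫⁻ x, ENNReal.ofReal (Λ * m / (m + e) * |w x| ^ (m + e)) ∂μ)
        + ∫⁻ x, ENNReal.ofReal (c x) * ENNReal.ofReal (m / (m + 1) * |w x| ^ (m + 1)) ∂μ := by
  set A : ℝ × X → ℝ≥0∞ := fun y => ENNReal.ofReal (Λ * m) *
    (‖kinetic (w y.2) y.1‖ₑ * ENNReal.ofReal (|y.1| ^ (m + e - 1)))
  set B : ℝ × X → ℝ≥0∞ := fun y => (ENNReal.ofReal (c y.2) * ENNReal.ofReal m) *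
    (‖kinetic (w y.2) y.1‖ₑ * ENNReal.ofReal (|y.1| ^ m))
  have hk := (aemeasurable_kinetic_comp hw).enorm
  have hmA : AEMeasurable A (volume.prod μ) :=
    (hk.mul (Measurable.aemeasurable (by fun_prop))).const_mul _
  have hmB : AEMeasurable B (volume.prod μ) := by
    refine AEMeasurable.mul ?_ (hk.mul (Measurable.aemeasurable (by fun_prop)))
    exact hc.ennreal_ofReal.comp_snd.mul_const _
  calc ∫⁻ ξ, ∫⁻ x, ‖m * |ξ| ^ (m - 1) * kinetic (w x) ξ * L x ξ‖ₑ ∂μ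
      ≤ ∫⁻ ξ, ∫⁻ x, (A + B) (ξ, x) ∂μ := by
        refine lintegral_mono fun ξ => lintegral_mono_ae ?_
        filter_upwards [hL] with x hx
        rcases eq_or_ne (kinetic (w x) ξ) 0 with h0 | h0
        · simp [h0]
        have hξ : 0 < |ξ| := abs_pos.2 fun h => h0 (by rw [h, kinetic_zero])
        have e1 : |ξ| ^ (m + e - 1) = |ξ| ^ (m - 1) * |ξ| ^ e := by
          rw [← Real.rpow_add hξ]; congr 1; ring
        have e2 : |ξ| ^ m = |ξ| ^ (m - 1) * |ξ| := by
          rw [← Real.rpow_add_one hξ.ne']; congr 1; ring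
        simp only [A, B, Pi.add_apply]
        rw [Real.enorm_eq_ofReal_abs, Real.enorm_eq_ofReal_abs,
          ← ENNReal.ofReal_mul (hc0 x), ← ENNReal.ofReal_mul (abs_nonneg _),
          ← ENNReal.ofReal_mul (abs_nonneg _), ← ENNReal.ofReal_mul (by positivity),
          ← ENNReal.ofReal_mul (mul_nonneg (hc0 x) hm.le), ← ENNReal.ofReal_add (by positivity)
            (mul_nonneg (mul_nonneg (hc0 x) hm.le) (by positivity))]
        refine ENNReal.ofReal_le_ofReal ?_
        rw [abs_mul, abs_mul, abs_mul, abs_of_pos hm,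
          abs_of_nonneg (Real.rpow_nonneg (abs_nonneg ξ) _), e1, e2]
        calc m * |ξ| ^ (m - 1) * |kinetic (w x) ξ| * |L x ξ|
            ≤ m * |ξ| ^ (m - 1) * |kinetic (w x) ξ| * (Λ * |ξ| ^ e + c x * |ξ|) := by
              gcongr
              exact hx ξ h0
          _ = _ := by ring
    _ = ∫⁻ y, (A + B) y ∂(volume.prod μ) := (lintegral_prod _ (hmA.add hmB)).symm
    _ = (∫⁻ y, A y ∂(volume.prod μ)) + ∫⁻ y, B y ∂(volume.prod μ) := lintegral_add_left' hmA _
    _ = _ := by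
      congr 1
      · simp only [A]
        rw [lintegral_prod_kinetic_rpow (g := fun _ => ENNReal.ofReal (Λ * m)) (by linarith) hw
          aemeasurable_const]
        refine lintegral_congr fun x => ?_
        rw [← ENNReal.ofReal_mul (by positivity), show m + e - 1 + 1 = m + e by ring]
        congr 1; ring
      · simp only [B]
        rw [lintegral_prod_kinetic_rpow (g := fun x => ENNReal.ofReal (c x) * ENNReal.ofReal m)
          (by linarith) hw (hc.ennreal_ofReal.mul_const _)]
        refine lintegral_congr fun x => ?_
        rw [mul_assoc, ← ENNReal.ofReal_mul hm.le]
        congr 2; ring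

/-- The Hardy weight is integrable against the square of a function of `L²([0,T]; H¹₀)`. -/
lemma MemLpW1pZero.lintegral_weight_lt_top {κ : Space d → ℝ} (hκ : Measurable κ) {A : ℝ}
    (hardy : ∀ ψ, IsTestFunction U ψ → ∫⁻ x in U, ‖κ x‖ₑ ^ 2 * ‖ψ x‖ₑ ^ 2
        ≤ ENNReal.ofReal A * (∫⁻ x in U, ‖ψ x‖ₑ ^ 2)
          + ENNReal.ofReal A * ∫⁻ x in U, ‖gradient ψ x‖ₑ ^ 2)
    {T : ℝ} {w : ℝ → Space d → ℝ} {G : ℝ → Space d → Space d} (h : MemLpW1pZero U T 2 w G) :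
    ∫⁻ r in Icc 0 T, ∫⁻ x in U, ‖κ x‖ₑ ^ 2 * ‖w r x‖ₑ ^ 2 < ⊤ := by
  calc ∫⁻ r in Icc 0 T, ∫⁻ x in U, ‖κ x‖ₑ ^ 2 * ‖w r x‖ₑ ^ 2
      ≤ ∫⁻ r in Icc 0 T, ENNReal.ofReal A *
          ∫⁻ x in U, (‖w r x‖ₑ ^ (2 : ℝ) + ‖G r x‖ₑ ^ (2 : ℝ)) := by
        refine lintegral_mono_ae ?_
        filter_upwards [h.mem, h.aestronglyMeasurable.prodMk_left] with r hr hwr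
        refine (hr.lintegral_weight_le (hκ.enorm.pow_const 2) ENNReal.ofReal_ne_top
          ENNReal.ofReal_ne_top hardy).trans ?_
        simp only [ENNReal.rpow_two]
        have hwr' : AEMeasurable (fun x => ‖w r x‖ₑ ^ 2) (volume.restrict U) :=
          hwr.enorm.pow_const 2
        rw [← mul_add, lintegral_add_left' hwr']
    _ = ENNReal.ofReal A * normPowLpW1p U T 2 w G := by
        rw [lintegral_const_mul' _ _ ENNReal.ofReal_ne_top]; rfl
    _ < ⊤ := ENNReal.mul_lt_top ENNReal.ofReal_lt_top h.norm_lt_top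

/-- The flux term of the kinetic equation: the contribution of the region where the cutoffs act
is dominated by the Hardy weight, hence tends to zero. -/
lemma exists_flux_remainder {m : ℝ} (hm : 0 < m) {s t : ℝ}
    {u : ℝ → Space d → ℝ} (hu : AEStronglyMeasurable (Function.uncurry u)
      ((volume.restrict (Ioc s t)).prod (volume.restrict U)))
    {κ : Space d → ℝ} (hκ : Measurable κ)
    (hfin : ∫⁻ r in Ioc s t, ∫⁻ x in U, ‖κ x‖ₑ ^ 2 * ENNReal.ofReal (|u r x| ^ (m + 1)) < ⊤)
    {Λ e : ℝ} (hΛ : 0 ≤ Λ) (he : 0 < m + e) {C : ℝ} (hC : 0 ≤ C) (Y : ℝ) (hUo : IsOpen U) :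
    ∃ R : ℕ → ℝ≥0∞, Tendsto R atTop (𝓝 0) ∧ ∀ (j : ℕ) (L : ℝ → Space d → ℝ → ℝ),
      (∀ r ∈ Ioc s t, ∀ x ∈ U, ∀ ξ, kinetic (u r x) ξ ≠ 0 → |L r x ξ| ≤ Λ * |ξ| ^ e +
        (if (j : ℝ) ≤ κ x ∨ 1 ≤ 1 / ((j : ℝ) + 1) * (|u r x| * Real.exp Y) then C * κ x ^ 2
          else 0) * |ξ|) →
      ‖∫ r in Ioc s t, ∫ ξ : ℝ, ∫ x in U, m * |ξ| ^ (m - 1) * kinetic (u r x) ξ * L r x ξ‖ₑ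
        ≤ (∫⁻ r in Ioc s t, ∫⁻ x in U, ENNReal.ofReal (Λ * m / (m + e) * |u r x| ^ (m + e)))
          + R j := by
  set ν := (volume.restrict (Ioc s t)).prod (volume.restrict U)
  set c : ℕ → ℝ × Space d → ℝ := fun j y =>
    if (j : ℝ) ≤ κ y.2 ∨ 1 ≤ 1 / ((j : ℝ) + 1) * (|u y.1 y.2| * Real.exp Y) then C * κ y.2 ^ 2
      else 0
  have hum : AEMeasurable (fun y : ℝ × Space d => u y.1 y.2) ν := hu.aemeasurable
  have hc : ∀ j, AEMeasurable (c j) ν := fun j => by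
    have hH : Measurable fun q : ℝ × ℝ => if (j : ℝ) ≤ q.1 ∨
        1 ≤ 1 / ((j : ℝ) + 1) * (|q.2| * Real.exp Y) then C * q.1 ^ 2 else 0 := by
      have h1 : Measurable fun q : ℝ × ℝ => 1 / ((j : ℝ) + 1) * (|q.2| * Real.exp Y) := by
        fun_prop
      exact Measurable.ite ((measurableSet_le measurable_const measurable_fst).union
        (measurableSet_le measurable_const h1)) (by fun_prop) measurable_const
    exact hH.comp_aemeasurable ((hκ.comp measurable_snd).aemeasurable.prodMk hum)
  have hc0 : ∀ j y, 0 ≤ c j y := fun j y => by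
    simp only [c]; split_ifs <;> positivity
  have hcC : ∀ j y, c j y ≤ C * κ y.2 ^ 2 := fun j y => by
    simp only [c]; split_ifs
    · exact le_rfl
    · positivity
  set F : ℕ → ℝ × Space d → ℝ≥0∞ := fun j y =>
    ENNReal.ofReal (c j y) * ENNReal.ofReal (m / (m + 1) * |u y.1 y.2| ^ (m + 1))
  have hF : ∀ j, AEMeasurable (F j) ν := fun j =>
    (hc j).ennreal_ofReal.mul ((((hum.abs).pow_const _).const_mul _).ennreal_ofReal)
  have hA : AEMeasurable (fun y : ℝ × Space d =>
      ENNReal.ofReal (Λ * m / (m + e) * |u y.1 y.2| ^ (m + e))) ν :=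
    (((hum.abs).pow_const _).const_mul _).ennreal_ofReal
  refine ⟨fun j => ∫⁻ y, F j y ∂ν, ?_, fun j L hL => ?_⟩
  · have := tendsto_lintegral_of_dominated_convergence' (μ := ν) (F := F) (f := fun _ => 0)
      (fun y => ENNReal.ofReal (C * (m / (m + 1))) *
        (‖κ y.2‖ₑ ^ 2 * ENNReal.ofReal (|u y.1 y.2| ^ (m + 1)))) hF
      (fun j => Eventually.of_forall fun y => ?_) ?_ (Eventually.of_forall fun y => ?_)
    · simpa using this
    · simp only [F]
      rw [enorm_sq_eq_ofReal, ← ENNReal.ofReal_mul (hc0 j y), ← ENNReal.ofReal_mul (by positivity),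
        ← ENNReal.ofReal_mul (by positivity)]
      refine ENNReal.ofReal_le_ofReal ?_
      calc c j y * (m / (m + 1) * |u y.1 y.2| ^ (m + 1))
          ≤ C * κ y.2 ^ 2 * (m / (m + 1) * |u y.1 y.2| ^ (m + 1)) := by
            gcongr
            exact hcC j y
        _ = _ := by ring
    · have hb : AEMeasurable (fun y : ℝ × Space d =>
          ‖κ y.2‖ₑ ^ 2 * ENNReal.ofReal (|u y.1 y.2| ^ (m + 1))) ν :=
        ((hκ.comp measurable_snd).enorm.pow_const 2).aemeasurable.mul
          ((hum.abs).pow_const _).ennreal_ofReal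
      rw [lintegral_const_mul' _ _ ENNReal.ofReal_ne_top, lintegral_prod _ hb]
      exact (ENNReal.mul_lt_top ENNReal.ofReal_lt_top hfin).ne
    · refine tendsto_const_nhds.congr' ?_
      have h1 : Tendsto (fun j : ℕ => 1 / ((j : ℝ) + 1) * (|u y.1 y.2| * Real.exp Y)) atTop
          (𝓝 0) := by
        simpa using tendsto_one_div_add_atTop_nhds_zero_nat.mul_const (|u y.1 y.2| * Real.exp Y)
      filter_upwards [h1.eventually (gt_mem_nhds zero_lt_one),
        tendsto_natCast_atTop_atTop.eventually (eventually_gt_atTop (κ y.2))] with j h2 h3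
      simp only [F, c]
      rw [if_neg (by push Not; exact ⟨h3, h2⟩)]
      simp
  · calc _ ≤ ∫⁻ r in Ioc s t, ∫⁻ ξ : ℝ, ∫⁻ x in U,
          ‖m * |ξ| ^ (m - 1) * kinetic (u r x) ξ * L r x ξ‖ₑ := by
          refine (enorm_integral_le_lintegral_enorm _).trans (lintegral_mono fun r => ?_)
          refine (enorm_integral_le_lintegral_enorm _).trans (lintegral_mono fun ξ => ?_)
          exact enorm_integral_le_lintegral_enorm _
      _ ≤ ∫⁻ r in Ioc s t, ((∫⁻ x in U, ENNReal.ofReal (Λ * m / (m + e) * |u r x| ^ (m + e)))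
            + ∫⁻ x in U, F j (r, x)) := by
          refine lintegral_mono_ae ?_
          filter_upwards [hu.prodMk_left, (hc j).aestronglyMeasurable.prodMk_left,
            ae_restrict_mem measurableSet_Ioc] with r hur hcr hr
          exact lintegral_flux_le hm hur.aemeasurable hΛ he hcr.aemeasurable (fun x => hc0 j _)
            ((ae_restrict_iff' hUo.measurableSet).2
              (Eventually.of_forall fun x hx ξ => hL r hr x hx ξ))
      _ = _ := by
          rw [lintegral_add_left' hA.lintegral_prod_right', ← lintegral_prod _ (hF j)]

end Flux

/-- The functions `ψ` used as test functions in the level variable: nondecreasing, of linear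
growth, with the sign of the identity. -/
structure IsEnergyProfile (ψ : ℝ → ℝ) (K : ℝ) : Prop extends IsProfile ψ K 1 where
  deriv_nonneg : ∀ a, 0 ≤ deriv ψ a
  deriv_le : ∀ a, |deriv ψ a| ≤ K
  sign : ∀ a, 0 ≤ a * ψ a

/-! ### Removing the cutoffs in the tested equation -/

section Limits

variable {d n : ℕ} {U : Set (Space d)} {f : Fin n → Space d → ℝ} {z : ℝ → Fin n → ℝ}

lemma continuous_expProfile {ψ : ℝ → ℝ} (hψ : Continuous ψ) :
    Continuous fun y : ℝ × ℝ => expProfile ψ y.1 y.2 := by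
  unfold expProfile
  fun_prop

lemma abs_expProfile_le {ψ : ℝ → ℝ} {K Y : ℝ} (hψ : ∀ a, |ψ a| ≤ K * |a|) {ξ y : ℝ}
    (hy : |y| ≤ Y) : |expProfile ψ ξ y| ≤ K * Real.exp (2 * Y) * |ξ| := by
  have hK : 0 ≤ K := by simpa using (abs_nonneg _).trans (hψ 1)
  have h1 : Real.exp (-y) ≤ Real.exp Y := Real.exp_le_exp.2 (by linarith [neg_abs_le y])
  unfold expProfile
  rw [abs_mul, abs_of_pos (Real.exp_pos _)]
  calc Real.exp (-y) * |ψ (ξ * Real.exp (-y))|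
      ≤ Real.exp (-y) * (K * |ξ * Real.exp (-y)|) := by gcongr; exact hψ _
    _ = K * (Real.exp (-y) * Real.exp (-y)) * |ξ| := by
        rw [abs_mul, abs_of_pos (Real.exp_pos _)]; ring
    _ ≤ K * (Real.exp Y * Real.exp Y) * |ξ| := by gcongr
    _ = _ := by rw [← Real.exp_add]; ring_nf

lemma abs_truncProfile_le (ψ : ℝ → ℝ) (ε a : ℝ) : |truncProfile ψ ε a| ≤ |ψ a| := by
  unfold truncProfile
  rw [abs_mul]
  exact mul_le_of_le_one_right (abs_nonneg _) (abs_evenCut_le_one _)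

lemma tendsto_one_div_mul (a : ℝ) :
    Tendsto (fun j : ℕ => 1 / ((j : ℝ) + 1) * a) atTop (𝓝 0) := by
  simpa using tendsto_one_div_add_atTop_nhds_zero_nat.mul_const a

lemma eventually_truncProfile_eq (ψ : ℝ → ℝ) (a : ℝ) :
    ∀ᶠ j : ℕ in atTop, ∀ᶠ b in 𝓝 a, truncProfile ψ (1 / ((j : ℝ) + 1)) b = ψ b := by
  have h := (tendsto_one_div_mul a).abs
  rw [abs_zero] at h
  filter_upwards [h.eventually (gt_mem_nhds zero_lt_one)] with j hj
  have hc : ContinuousAt (fun b : ℝ => |1 / ((j : ℝ) + 1) * b|) a := by fun_prop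
  filter_upwards [hc.eventually (gt_mem_nhds hj)] with b hb
  exact truncProfile_of_abs_le hb.le

/-- The final term of the tested kinetic equation converges as the cutoffs are removed. -/
lemma exists_tendsto_final_term (hUo : IsOpen U) (hf : ∀ k, IsCb2 U (f k)) {s t : ℝ} {Y : ℝ}
    (hY : ∀ x ∈ U, |logWeight f (z t - z s) x| ≤ Y) {w : Space d → ℝ}
    (hw : MemLp w 2 (volume.restrict U)) {ψ : ℝ → ℝ} {K : ℝ} (hψ : IsEnergyProfile ψ K)
    {φ : ℕ → Space d → ℝ} (hφ : ∀ j, IsTestFunction U (φ j)) (hφ0 : ∀ j x, 0 ≤ φ j x)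
    (hφ1 : ∀ j x, φ j x ≤ 1) (hone : ∀ x ∈ U, ∀ᶠ j in atTop, φ j x = 1) :
    ∃ T : ℝ, 0 ≤ T ∧
      ENNReal.ofReal T = ∫⁻ y, ENNReal.ofReal
        (kinetic (w y.2) y.1 * expProfile ψ y.1 (logWeight f (z t - z s) y.2))
          ∂(volume.prod (volume.restrict U)) ∧
      Tendsto (fun j : ℕ => ∫ ξ : ℝ, ∫ x in U, kinetic (w x) ξ * transported f z
        (fun y => φ j y.1 * truncProfile ψ (1 / ((j : ℝ) + 1)) y.2) s t x ξ) atTop (𝓝 T) := by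
  set a := z t - z s
  set μ := (volume : Measure ℝ).prod (volume.restrict U)
  have hψc : Continuous ψ := hψ.smooth.continuous
  have hlog : AEMeasurable (logWeight f a) (volume.restrict U) :=
    (contDiffOn_logWeight hf a).continuousOn.aemeasurable hUo.measurableSet
  have hψb : ∀ b, |ψ b| ≤ K * |b| := fun b => by simpa using hψ.bound_zero b
  have hE : ∀ g : ℝ → ℝ, Continuous g →
      AEStronglyMeasurable (fun y : ℝ × Space d => expProfile g y.1 (logWeight f a y.2)) μ :=
    fun g hg => ((continuous_expProfile hg).measurable.comp_aemeasurable
      (measurable_fst.aemeasurable.prodMk hlog.comp_snd)).aestronglyMeasurable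
  have hUae : ∀ᵐ y ∂μ, y.2 ∈ U :=
    Measure.quasiMeasurePreserving_snd.ae (ae_restrict_mem hUo.measurableSet)
  have hεc : ∀ ε, Continuous (truncProfile ψ ε) := fun ε => by
    unfold truncProfile
    exact hψc.mul (contDiff_evenCut.continuous.comp (continuous_const.mul continuous_id))
  set F : ℕ → ℝ × Space d → ℝ := fun j y => kinetic (w y.2) y.1 *
    (φ j y.2 * expProfile (truncProfile ψ (1 / ((j : ℝ) + 1))) y.1 (logWeight f a y.2))
  set F' : ℝ × Space d → ℝ := fun y =>
    kinetic (w y.2) y.1 * expProfile ψ y.1 (logWeight f a y.2)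
  have hbd : ∀ j, ∀ᵐ y ∂μ, |φ j y.2 * expProfile (truncProfile ψ (1 / ((j : ℝ) + 1))) y.1
      (logWeight f a y.2)| ≤ K * Real.exp (2 * Y) * |y.1| := fun j => by
    filter_upwards [hUae] with y hy
    rw [abs_mul, abs_of_nonneg (hφ0 j _)]
    refine (mul_le_of_le_one_left (abs_nonneg _) (hφ1 j _)).trans ?_
    exact abs_expProfile_le (fun b => (abs_truncProfile_le _ _ _).trans (hψb b)) (hY _ hy)
  have hFint : ∀ j, Integrable (F j) μ := fun j => integrable_kinetic_mul hw
    (((hφ j).smooth.continuous.measurable.comp measurable_snd).aestronglyMeasurable.mul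
      (hE _ (hεc _))) (hbd j)
  have hF'int : Integrable F' μ := integrable_kinetic_mul hw (C := K * Real.exp (2 * Y))
    (hE _ hψc) (by filter_upwards [hUae] with y hy using abs_expProfile_le hψb (hY _ hy))
  have hF'0 : ∀ y, 0 ≤ F' y := fun y => by
    refine kinetic_mul_nonneg ?_
    unfold expProfile
    have := hψ.sign (y.1 * Real.exp (-logWeight f a y.2))
    linarith
  refine ⟨∫ y, F' y ∂μ, integral_nonneg hF'0,
    ofReal_integral_eq_lintegral_ofReal hF'int (Eventually.of_forall hF'0), ?_⟩
  have hlim := tendsto_integral_of_dominated_convergence (μ := μ) (F := F) (f := F')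
    (fun y => |kinetic (w y.2) y.1| * (K * Real.exp (2 * Y) * |y.1|)) (fun j => (hFint j).1)
    (integrable_kinetic_mul_bound hw _) (fun j => by
      filter_upwards [hbd j] with y hy
      rw [norm_mul, Real.norm_eq_abs, Real.norm_eq_abs]
      gcongr) (by
      filter_upwards [hUae] with y hy
      refine tendsto_const_nhds.congr' ?_
      filter_upwards [hone _ hy, eventually_truncProfile_eq ψ
        (y.1 * Real.exp (-logWeight f a y.2))] with j h1 h2
      simp only [F, F', h1, one_mul, expProfile, h2.self_of_nhds])
  refine hlim.congr fun j => ?_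
  rw [integral_prod _ (hFint j)]
  simp only [F, transported_prod, a]

/-- The initial term of the tested kinetic equation. -/
lemma enorm_initial_term_le {w : Space d → ℝ} (hw : MemLp w 2 (volume.restrict U)) {ψ : ℝ → ℝ}
    {K e : ℝ} (hK : 0 ≤ K) (he : -1 < e) (hψ : ∀ a, |ψ a| ≤ K * |a| ^ e) {φ : Space d → ℝ}
    (hφ0 : ∀ x, 0 ≤ φ x) (hφ1 : ∀ x, φ x ≤ 1) (ε : ℝ) :
    ‖∫ ξ : ℝ, ∫ x in U, kinetic (w x) ξ * (φ x * truncProfile ψ ε ξ)‖ₑ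
      ≤ ∫⁻ x in U, ENNReal.ofReal (K / (e + 1) * |w x| ^ (e + 1)) := by
  calc _ ≤ ∫⁻ ξ : ℝ, ∫⁻ x in U, ‖kinetic (w x) ξ * (φ x * truncProfile ψ ε ξ)‖ₑ := by
        refine (enorm_integral_le_lintegral_enorm _).trans (lintegral_mono fun ξ => ?_)
        exact enorm_integral_le_lintegral_enorm _
    _ ≤ ∫⁻ ξ : ℝ, ∫⁻ x in U, ENNReal.ofReal K *
          (‖kinetic (w x) ξ‖ₑ * ENNReal.ofReal (|ξ| ^ e)) := by
        refine lintegral_mono fun ξ => lintegral_mono fun x => ?_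
        rw [Real.enorm_eq_ofReal_abs, Real.enorm_eq_ofReal_abs, ← ENNReal.ofReal_mul (abs_nonneg _),
          ← ENNReal.ofReal_mul hK]
        refine ENNReal.ofReal_le_ofReal ?_
        rw [abs_mul, abs_mul, abs_of_nonneg (hφ0 x)]
        calc |kinetic (w x) ξ| * (φ x * |truncProfile ψ ε ξ|)
            ≤ |kinetic (w x) ξ| * (1 * (K * |ξ| ^ e)) := by
              gcongr
              · exact hφ1 x
              · exact (abs_truncProfile_le _ _ _).trans (hψ ξ)
          _ = _ := by ring
    _ = _ := by
        rw [lintegral_lintegral_kinetic_rpow he hw.1.aemeasurable aemeasurable_const]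
        refine lintegral_congr fun x => ?_
        rw [← ENNReal.ofReal_mul hK]
        congr 1; ring

lemma continuousOn_weight (hf : ∀ k, IsCb2 U (f k)) (hz : ContinuousOn z (Ici 0)) {s t : ℝ}
    (hs : 0 ≤ s) :
    ContinuousOn (fun y : Space d × ℝ × ℝ => weight f z s y.2.2 y.1)
      (U ×ˢ (univ : Set ℝ) ×ˢ Ioc s t) := by
  unfold weight
  refine Real.continuous_exp.comp_continuousOn (continuousOn_finsetSum _ fun k _ => ?_).neg
  refine ContinuousOn.mul ((hf k).1.continuousOn.comp continuousOn_fst fun y hy => hy.1) ?_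
  refine ContinuousOn.sub ?_ continuousOn_const
  have hzk : ContinuousOn (fun r => z r k) (Ici 0) :=
    (continuous_apply k).comp_continuousOn hz
  exact hzk.comp (by fun_prop) fun y hy => hs.trans (mem_Ioc.1 hy.2.2).1.le

/-- The defect term of the tested kinetic equation converges as the cutoffs are removed, and the
limit dominates the contribution of the parabolic defect measure. -/
lemma exists_tendsto_defect_term (hUo : IsOpen U) (hf : ∀ k, IsCb2 U (f k))
    (hz : ContinuousOn z (Ici 0)) {s t : ℝ} (hs : 0 ≤ s) {Y : ℝ}
    (hY : ∀ r ∈ Ioc s t, ∀ x ∈ U, |logWeight f (z r - z s) x| ≤ Y) {m : ℝ}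
    {u : ℝ → Space d → ℝ} {G : ℝ → Space d → Space d}
    (hu : AEStronglyMeasurable (Function.uncurry u)
      ((volume.restrict (Ioi (0 : ℝ))).prod (volume.restrict U)))
    (hG : AEStronglyMeasurable (Function.uncurry G)
      ((volume.restrict (Ioi (0 : ℝ))).prod (volume.restrict U)))
    {p : Measure (Space d × ℝ × ℝ)}
    (hfin : (p + parabolicDefect m U u G) (U ×ˢ univ ×ˢ Ioc s t) < ⊤)
    {ψ : ℝ → ℝ} {K K' : ℝ} (hψ : IsEnergyProfile ψ K)
    (htr : ∀ ε : ℝ, 0 < ε → ContDiff ℝ ∞ (truncProfile ψ ε) ∧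
      ∀ a, |deriv (truncProfile ψ ε) a| ≤ K')
    {φ : ℕ → Space d → ℝ} (hφ : ∀ j, IsTestFunction U (φ j)) (hφ0 : ∀ j x, 0 ≤ φ j x)
    (hφ1 : ∀ j x, φ j x ≤ 1) (hone : ∀ x ∈ U, ∀ᶠ j in atTop, φ j x = 1) :
    ∃ P : ℝ, 0 ≤ P ∧
      (∫⁻ r in Ioc s t, ∫⁻ x in U, ENNReal.ofReal (4 * m / (m + 1) ^ 2 * ‖G r x‖ ^ 2) *
        ENNReal.ofReal (weight f z s r x ^ 2 * deriv ψ (u r x * weight f z s r x)))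
          ≤ ENNReal.ofReal P ∧
      Tendsto (fun j : ℕ => ∫ y in U ×ˢ univ ×ˢ Ioc s t, deriv (fun ξ => transported f z
        (fun y => φ j y.1 * truncProfile ψ (1 / ((j : ℝ) + 1)) y.2) s y.2.2 y.1 ξ) y.2.1
          ∂(p + parabolicDefect m U u G)) atTop (𝓝 P) := by
  set S : Set (Space d × ℝ × ℝ) := U ×ˢ univ ×ˢ Ioc s t
  have hS : MeasurableSet S := hUo.measurableSet.prod (MeasurableSet.univ.prod measurableSet_Ioc)
  set μ := (p + parabolicDefect m U u G).restrict S
  have : IsFiniteMeasure μ := ⟨by rwa [Measure.restrict_apply_univ]⟩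
  set v : Space d × ℝ × ℝ → ℝ := fun y => weight f z s y.2.2 y.1
  have hv : ContinuousOn v S := continuousOn_weight hf hz hs
  have hvY : ∀ y ∈ S, 0 < v y ∧ v y ≤ Real.exp Y := fun y hy => by
    refine ⟨Real.exp_pos _, ?_⟩
    have := hY y.2.2 hy.2.2 y.1 hy.1
    simp only [v, weight_eq_exp]
    exact Real.exp_le_exp.2 (by linarith [neg_abs_le (logWeight f (z y.2.2 - z s) y.1)])
  set F : ℕ → Space d × ℝ × ℝ → ℝ := fun j y =>
    φ j y.1 * (v y ^ 2 * deriv (truncProfile ψ (1 / ((j : ℝ) + 1))) (y.2.1 * v y))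
  set F' : Space d × ℝ × ℝ → ℝ := fun y => v y ^ 2 * deriv ψ (y.2.1 * v y)
  have hFeq : ∀ j y, deriv (fun ξ => transported f z
      (fun y => φ j y.1 * truncProfile ψ (1 / ((j : ℝ) + 1)) y.2) s y.2.2 y.1 ξ) y.2.1
      = F j y := fun j y => by
    simp only [transported_prod, expProfile_logWeight]
    have h1 := ((htr (1 / ((j : ℝ) + 1)) (by positivity)).1.differentiable (by simp)
      (y.2.1 * v y)).hasDerivAt
    have h2 : HasDerivAt (fun ξ : ℝ => ξ * v y) (v y) y.2.1 := by
      simpa using (hasDerivAt_id y.2.1).mul_const (v y)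
    have h3 := ((h1.comp y.2.1 h2).const_mul (v y)).const_mul (φ j y.1)
    refine h3.deriv.trans ?_
    simp only [F]; ring
  have hcont : ∀ g : ℝ → ℝ, Continuous g → ContinuousOn (fun y => v y ^ 2 * g (y.2.1 * v y)) S :=
    fun g hg => (hv.pow 2).mul (hg.comp_continuousOn ((by fun_prop : ContinuousOn
      (fun y : Space d × ℝ × ℝ => y.2.1) S).mul hv))
  have hdc : ∀ {g : ℝ → ℝ}, ContDiff ℝ ∞ g → Continuous (deriv g) := fun hg =>
    hg.continuous_deriv (by norm_cast)
  have hFm : ∀ j, AEStronglyMeasurable (F j) μ := fun j =>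
    (((hφ j).smooth.continuous.comp continuous_fst).continuousOn.mul
      (hcont _ (hdc (htr _ (by positivity)).1))).aestronglyMeasurable hS
  have hF'c : ContinuousOn F' S := hcont _ (hdc hψ.smooth)
  have hF'0 : ∀ y, 0 ≤ F' y := fun y => mul_nonneg (sq_nonneg _) (hψ.deriv_nonneg _)
  have hmem : ∀ᵐ y ∂μ, y ∈ S := ae_restrict_mem hS
  have hbound : ∀ (D : ℝ) (g : ℝ → ℝ), (∀ a, |g a| ≤ D) → ∀ y ∈ S,
      |v y ^ 2 * g (y.2.1 * v y)| ≤ Real.exp Y ^ 2 * D := fun D g hg y hy => by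
    rw [abs_mul, abs_of_nonneg (sq_nonneg _)]
    have := hvY y hy
    gcongr
    · exact this.1.le
    · exact this.2
    · exact hg _
  have hlim := tendsto_integral_of_dominated_convergence (μ := μ) (F := F) (f := F')
    (fun _ => Real.exp Y ^ 2 * K') hFm (integrable_const _) (fun j => by
      filter_upwards [hmem] with y hy
      rw [norm_mul, Real.norm_eq_abs, Real.norm_eq_abs, abs_of_nonneg (hφ0 j _)]
      exact (mul_le_of_le_one_left (abs_nonneg _) (hφ1 j _)).trans
        (hbound _ _ (htr _ (by positivity)).2 y hy)) (by
      filter_upwards [hmem] with y hy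
      refine tendsto_const_nhds.congr' ?_
      filter_upwards [hone _ hy.1, eventually_truncProfile_eq ψ (y.2.1 * v y)] with j h1 h2
      simp only [F, F', h1, one_mul]
      rw [EventuallyEq.deriv_eq h2])
  have hF'int : Integrable F' μ := by
    refine (integrable_const (Real.exp Y ^ 2 * K)).mono' (hF'c.aestronglyMeasurable hS) ?_
    filter_upwards [hmem] with y hy
    exact hbound _ _ hψ.deriv_le y hy
  refine ⟨∫ y, F' y ∂μ, integral_nonneg hF'0, ?_, ?_⟩
  · rw [ofReal_integral_eq_lintegral_ofReal hF'int (Eventually.of_forall hF'0)]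
    have h1 := setLIntegral_parabolicDefect (m := m) (t := t) hUo hs hu hG
      (F := fun y => ENNReal.ofReal (F' y)) (hF'c.aemeasurable hS).ennreal_ofReal
    refine (le_of_eq h1.symm).trans ?_
    refine lintegral_mono' (Measure.restrict_mono_measure ?_ _) le_rfl
    exact Measure.le_add_left le_rfl
  · simp only [hFeq]
    exact hlim

end Limits

/-! ### The energy inequality -/

section EnergyInequality

variable {d n : ℕ} {U : Set (Space d)} {f : Fin n → Space d → ℝ} {z : ℝ → Fin n → ℝ}

/-- The kinetic equation on the time interval `(s,t]`, starting from the function `w`. -/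
def KineticEquationOn (m : ℝ) (U : Set (Space d)) (f : Fin n → Space d → ℝ) (z : ℝ → Fin n → ℝ)
    (u : ℝ → Space d → ℝ) (G : ℝ → Space d → Space d) (p : Measure (Space d × ℝ × ℝ))
    (w : Space d → ℝ) (s t : ℝ) : Prop :=
  ∀ ρ₀ : Space d × ℝ → ℝ, IsTestFunction (U ×ˢ univ) ρ₀ →
    (∫ ξ : ℝ, ∫ x in U, kinetic (u t x) ξ * transported f z ρ₀ s t x ξ)
      - (∫ ξ : ℝ, ∫ x in U, kinetic (w x) ξ * ρ₀ (x, ξ))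
    = (∫ r in Ioc s t, ∫ ξ : ℝ, ∫ x in U, m * |ξ| ^ (m - 1) * kinetic (u r x) ξ *
          Laplacian.laplacian (fun y => transported f z ρ₀ s r y ξ) x)
      - ∫ y in U ×ˢ univ ×ˢ Ioc s t,
          deriv (fun ξ => transported f z ρ₀ s y.2.2 y.1 ξ) y.2.1 ∂(p + parabolicDefect m U u G)

/-- The standing properties of a solution: measurability, the Sobolev regularity of
`u^{[(m+1)/2]}` and the finiteness of the entropy defect measure `p`. -/
structure IsKineticDatum (m : ℝ) (U : Set (Space d)) (u : ℝ → Space d → ℝ)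
    (G : ℝ → Space d → Space d) (p : Measure (Space d × ℝ × ℝ)) : Prop where
  aesm : AEStronglyMeasurable (Function.uncurry u)
    ((volume.restrict (Ioi (0 : ℝ))).prod (volume.restrict U))
  mem : ∀ T : ℝ, 0 < T → MemLpW1pZero U T 2 (fun t x => spow ((m + 1) / 2) (u t x)) G
  finite : ∀ T : ℝ, 0 < T → p (U ×ˢ univ ×ˢ Ioo 0 T) < ⊤

variable {m : ℝ} {u : ℝ → Space d → ℝ} {G : ℝ → Space d → Space d}
  {p : Measure (Space d × ℝ × ℝ)}

lemma ofReal_add_le_of_sub_eq {a b c e : ℝ} {A B : ℝ≥0∞} (h : a - b = c - e) (hb : ‖b‖ₑ ≤ A)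
    (hc : ‖c‖ₑ ≤ B) : ENNReal.ofReal (a + e) ≤ A + B :=
  calc ENNReal.ofReal (a + e) = ENNReal.ofReal (b + c) := by congr 1; linarith
    _ ≤ ‖b + c‖ₑ := Real.ofReal_le_enorm _
    _ ≤ ‖b‖ₑ + ‖c‖ₑ := enorm_add_le _ _
    _ ≤ A + B := add_le_add hb hc

lemma Ioc_subset_Icc_zero {s t : ℝ} (hs : 0 ≤ s) : Ioc s t ⊆ Icc (0 : ℝ) t :=
  fun _ hr => ⟨hs.trans hr.1.le, hr.2⟩

lemma Ioc_subset_Ioi {s t : ℝ} (hs : 0 ≤ s) : Ioc s t ⊆ Ioi (0 : ℝ) :=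
  fun _ hr => lt_of_le_of_lt hs hr.1

lemma IsKineticDatum.aesm_grad (h : IsKineticDatum m U u G p) :
    AEStronglyMeasurable (Function.uncurry G)
      ((volume.restrict (Ioi (0 : ℝ))).prod (volume.restrict U)) :=
  aestronglyMeasurable_Ioi fun T hT => (h.mem T hT).aestronglyMeasurable_grad

lemma aesm_mono_Ioc {E : Type*} [NormedAddCommGroup E] {g : ℝ × Space d → E}
    (h : AEStronglyMeasurable g ((volume.restrict (Ioi (0 : ℝ))).prod (volume.restrict U)))
    {s t : ℝ} (hs : 0 ≤ s) :
    AEStronglyMeasurable g ((volume.restrict (Ioc s t)).prod (volume.restrict U)) := by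
  refine h.mono_measure ?_
  exact Measure.prod_mono (Measure.restrict_mono (Ioc_subset_Ioi hs) le_rfl) le_rfl

lemma MemLpW1pZero.lintegral_grad_lt_top {T : ℝ} {w : ℝ → Space d → ℝ}
    (h : MemLpW1pZero U T 2 w G) : ∫⁻ r in Icc 0 T, ∫⁻ x in U, ‖G r x‖ₑ ^ 2 < ⊤ :=
  lt_of_le_of_lt (lintegral_mono fun r => lintegral_mono fun x => by
    rw [← ENNReal.rpow_two]; exact le_add_self) h.norm_lt_top

lemma IsKineticDatum.defect_lt_top (hUo : IsOpen U) (h : IsKineticDatum m U u G p) (hm : 0 < m)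
    {s t : ℝ} (hs : 0 ≤ s) (hst : s < t) :
    (p + parabolicDefect m U u G) (U ×ˢ univ ×ˢ Ioc s t) < ⊤ := by
  rw [Measure.add_apply]
  refine ENNReal.add_lt_top.2 ⟨lt_of_le_of_lt (measure_mono ?_) (h.finite (t + 1) (by linarith)),
    ?_⟩
  · rintro y ⟨h1, h2, h3⟩
    exact ⟨h1, h2, lt_of_le_of_lt hs h3.1, by linarith [h3.2]⟩
  · have h1 := setLIntegral_parabolicDefect (m := m) (t := t) hUo hs h.aesm h.aesm_grad
      (F := fun _ => 1) aemeasurable_const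
    rw [setLIntegral_one] at h1
    rw [h1]
    simp only [mul_one]
    calc _ ≤ ∫⁻ r in Icc 0 t, ∫⁻ x in U, ENNReal.ofReal (4 * m / (m + 1) ^ 2) * ‖G r x‖ₑ ^ 2 := by
          refine (lintegral_mono_set (Ioc_subset_Icc_zero hs)).trans ?_
          refine lintegral_mono fun r => lintegral_mono fun x => ?_
          rw [ENNReal.ofReal_mul (by positivity), ← ofReal_norm,
            ENNReal.ofReal_pow (norm_nonneg _)]
      _ = ENNReal.ofReal (4 * m / (m + 1) ^ 2) * ∫⁻ r in Icc 0 t, ∫⁻ x in U, ‖G r x‖ₑ ^ 2 := by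
          rw [← lintegral_const_mul' _ _ ENNReal.ofReal_ne_top]
          exact lintegral_congr fun r => lintegral_const_mul' _ _ ENNReal.ofReal_ne_top
      _ < ⊤ := ENNReal.mul_lt_top ENNReal.ofReal_lt_top
          (h.mem t (by linarith)).lintegral_grad_lt_top

/-- **Energy inequality.** The kinetic equation may be tested with the transported profile
`v ψ(ξ v)`, without cutoff at the boundary or at large levels: the term created by the cutoffs is
controlled by `∫ κ² |u|^{m+1}`, which is finite by the Hardy inequality and `u = 0` on `∂U`. -/
theorem KineticEquationOn.energy_le (hU : IsSmoothBoundedDomain U) (hf : ∀ k, IsCb2 U (f k))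
    (hz : ContinuousOn z (Ici 0)) (hm : 0 < m) (hd : IsKineticDatum m U u G p) {s t : ℝ}
    (hs : 0 ≤ s) (hst : s < t) {w : Space d → ℝ} (hw : MemLp w 2 (volume.restrict U))
    (hut : MemLp (u t) 2 (volume.restrict U)) (heq : KineticEquationOn m U f z u G p w s t)
    {Y : ℝ} (hY : ∀ r ∈ Ioc s t, ∀ i ≤ 2, ∀ x ∈ U,
      ‖iteratedFDeriv ℝ i (logWeight f (z r - z s)) x‖ ≤ Y)
    {ψ : ℝ → ℝ} {K : ℝ} (hψ : IsEnergyProfile ψ K) {e KA Λ : ℝ} (he : -1 < e)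
    (hme : 0 < m + e) (hKA : 0 ≤ KA) (hψe : ∀ a, |ψ a| ≤ KA * |a| ^ e) (hΛ : 0 ≤ Λ)
    (hL : ∀ r ∈ Ioc s t, ∀ x ∈ U, ∀ ξ,
      |Laplacian.laplacian (fun y => expProfile ψ ξ (logWeight f (z r - z s) y)) x|
        ≤ Λ * |ξ| ^ e) :
    (∫⁻ y, ENNReal.ofReal
        (kinetic (u t y.2) y.1 * expProfile ψ y.1 (logWeight f (z t - z s) y.2))
          ∂(volume.prod (volume.restrict U)))
      + (∫⁻ r in Ioc s t, ∫⁻ x in U, ENNReal.ofReal (4 * m / (m + 1) ^ 2 * ‖G r x‖ ^ 2) *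
        ENNReal.ofReal (weight f z s r x ^ 2 * deriv ψ (u r x * weight f z s r x)))
    ≤ (∫⁻ x in U, ENNReal.ofReal (KA / (e + 1) * |w x| ^ (e + 1)))
      + ∫⁻ r in Ioc s t, ∫⁻ x in U, ENNReal.ofReal (Λ * m / (m + e) * |u r x| ^ (m + e)) := by
  obtain ⟨κ, φ, C, A, hκm, hκ1, hC, hA, hφ, hφ0, hφ1, hφb, hone, hardy⟩ := hU.exists_cutoffs
  obtain ⟨B, hB, htr⟩ := IsProfile.exists_trunc_bound
  have hε : ∀ j : ℕ, 0 < 1 / ((j : ℝ) + 1) := fun j => by positivity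
  have htrψ := fun ε hε => htr ψ K hψ.toIsProfile hψ.deriv_le ε hε
  have hK0 : 0 ≤ K := (abs_nonneg _).trans (hψ.deriv_le 0)
  have hY0 : ∀ r ∈ Ioc s t, ∀ x ∈ U, |logWeight f (z r - z s) x| ≤ Y := fun r hr x hx => by
    simpa using hY r hr 0 (by norm_num) x hx
  have hone' : ∀ x ∈ U, ∀ᶠ j in atTop, φ j x = 1 := fun x hx => by
    filter_upwards [tendsto_natCast_atTop_atTop.eventually (eventually_gt_atTop (κ x))] with j hj
    exact (hone j x hx hj).self_of_nhds
  obtain ⟨T, hT0, hTe, hT⟩ := exists_tendsto_final_term hU.isOpen hf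
    (hY0 t (right_mem_Ioc.2 hst)) hut hψ hφ hφ0 hφ1 hone'
  obtain ⟨P, hP0, hPe, hP⟩ := exists_tendsto_defect_term hU.isOpen hf hz hs hY0 hd.aesm
    hd.aesm_grad (hd.defect_lt_top hU.isOpen hm hs hst) hψ
    (fun ε hε => ⟨(htrψ ε hε).1.smooth, (htrψ ε hε).2.1⟩) hφ hφ0 hφ1 hone'
  have hfin : ∫⁻ r in Ioc s t, ∫⁻ x in U, ‖κ x‖ₑ ^ 2 * ENNReal.ofReal (|u r x| ^ (m + 1)) < ⊤ := by
    refine lt_of_le_of_lt ?_ ((hd.mem t (by linarith)).lintegral_weight_lt_top hκm hardy)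
    refine (lintegral_mono_set (Ioc_subset_Icc_zero hs)).trans (le_of_eq ?_)
    simp only [enorm_spow_sq hm]
  obtain ⟨R, hR, hflux⟩ := exists_flux_remainder hm (aesm_mono_Ioc hd.aesm hs) hκm hfin hΛ hme
    (C := d * (40 * (B * K) * Real.exp (Y * 2) * (1 + Y) ^ 2) * C) (by positivity) Y hU.isOpen
  have hle := le_of_tendsto_of_tendsto
    (ENNReal.continuous_ofReal.tendsto (T + P) |>.comp (hT.add hP))
    ((tendsto_const_nhds (x := (∫⁻ x in U, ENNReal.ofReal (KA / (e + 1) * |w x| ^ (e + 1)))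
      + ∫⁻ r in Ioc s t, ∫⁻ x in U, ENNReal.ofReal (Λ * m / (m + e) * |u r x| ^ (m + e)))).add hR)
    (Eventually.of_forall fun j => ?_)
  · rw [add_zero, ENNReal.ofReal_add hT0 hP0, hTe] at hle
    exact (add_le_add_right hPe _).trans hle
  · have hj := heq (fun y => φ j y.1 * truncProfile ψ (1 / ((j : ℝ) + 1)) y.2)
      ((hφ j).prod_mul (htrψ _ (hε j)).1.smooth (htrψ _ (hε j)).2.2)
    have hfj := hflux j (fun r x ξ => Laplacian.laplacian (fun y => transported f z
        (fun y => φ j y.1 * truncProfile ψ (1 / ((j : ℝ) + 1)) y.2) s r y ξ) x)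
      (fun r hr x hx ξ hk => by
        simp only [transported_prod]
        exact abs_laplacian_cutoff_trunc_le hU.isOpen hf (hε j) (htrψ _ (hε j)).1 (hY r hr) hx
          (mul_nonneg hΛ (Real.rpow_nonneg (abs_nonneg _) _)) (hL r hr x hx ξ) (hφ j).smooth
          (hφb j x hx) (hone j x hx) hk)
    have hij := enorm_initial_term_le hw hKA he hψe (hφ0 j) (hφ1 j) (1 / ((j : ℝ) + 1))
    simp only [Function.comp_apply]
    exact (ofReal_add_le_of_sub_eq hj hij hfj).trans_eq (add_assoc _ _ _).symm

end EnergyInequality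

/-! ### The energy bound on short time intervals -/

section GradientBound

variable {d n : ℕ} {U : Set (Space d)} {f : Fin n → Space d → ℝ} {z : ℝ → Fin n → ℝ} {m : ℝ}

lemma isEnergyProfile_id : IsEnergyProfile id 1 := by
  have hd : deriv (id : ℝ → ℝ) = fun _ => 1 := funext fun a => deriv_id a
  exact ⟨⟨contDiff_id, fun a => by simp, fun a => by simp [hd], fun a => by simp [hd]⟩,
    fun a => by simp [hd], fun a => by simp [hd], fun a => mul_self_nonneg a⟩

/-- While the driving signal moves little, the energy identity for the square closes: the
Laplacian of the squared weight is small and is absorbed by the dissipation through the Poincaré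
inequality. -/
lemma exists_short_time_bound (hd : 1 ≤ d) (hU : IsSmoothBoundedDomain U)
    (hf : ∀ k, IsCb2 U (f k)) (hz : ContinuousOn z (Ici 0)) (hm : 0 < m) :
    ∃ δ : ℝ, 0 < δ ∧ ∃ C : ℝ, 1 ≤ C ∧ ∀ (u : ℝ → Space d → ℝ) (G : ℝ → Space d → Space d)
      (p : Measure (Space d × ℝ × ℝ)) (w : Space d → ℝ) (s t : ℝ), IsKineticDatum m U u G p →
      0 ≤ s → s < t → MemLp w 2 (volume.restrict U) → MemLp (u t) 2 (volume.restrict U) →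
      KineticEquationOn m U f z u G p w s t → (∀ r ∈ Ioc s t, ‖z r - z s‖ ≤ δ) →
      ∫⁻ x in U, ‖u t x‖ₑ ^ 2 ≤ ENNReal.ofReal C * ∫⁻ x in U, ‖w x‖ₑ ^ 2 ∧
      ∫⁻ r in Ioc s t, ∫⁻ x in U, ‖G r x‖ₑ ^ 2 ≤ ENNReal.ofReal C * ∫⁻ x in U, ‖w x‖ₑ ^ 2 := by
  obtain ⟨M, hM, hlog⟩ := exists_bound_logWeight hU.isOpen hf
  obtain ⟨CP, hCP, hpoinc⟩ := exists_poincare hd hU.isBounded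
  set c : ℝ := 4 * m / (m + 1) ^ 2 * Real.exp (-2) with hc
  have hc0 : 0 < c := by positivity
  have hd0 : (0 : ℝ) < d := by exact_mod_cast hd
  -- `Y` is the size of the logarithm of the weight, chosen so that the flux term is at most half
  -- of the dissipation
  set Y : ℝ := min 1 (c / 2 / (d * (10 * Real.exp 2) * m / (m + 1) * CP)) with hYdef
  have hY0 : 0 < Y := lt_min one_pos (by positivity)
  have hY1 : Y ≤ 1 := min_le_left _ _
  have hYc : d * (10 * Real.exp 2 * Y) * m / (m + 1) * CP ≤ c / 2 := by
    have h := min_le_right 1 (c / 2 / (d * (10 * Real.exp 2) * m / (m + 1) * CP))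
    rw [← hYdef, le_div_iff₀ (by positivity)] at h
    calc _ = Y * (d * (10 * Real.exp 2) * m / (m + 1) * CP) := by ring
      _ ≤ _ := h
  refine ⟨Y / M, by positivity, Real.exp 2 + 1 / c, by
    have : 1 ≤ Real.exp 2 := Real.one_le_exp (by norm_num)
    have : 0 < 1 / c := by positivity
    linarith, fun u G p w s t hdat hs hst hw hut heq hzs => ?_⟩
  have hY : ∀ r ∈ Ioc s t, ∀ i ≤ 2, ∀ x ∈ U,
      ‖iteratedFDeriv ℝ i (logWeight f (z r - z s)) x‖ ≤ Y := fun r hr i hi x hx => by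
    refine (hlog _ i hi x hx).trans ?_
    have := hzs r hr
    rw [le_div_iff₀ hM] at this
    linarith
  have hYv : ∀ r ∈ Ioc s t, ∀ x ∈ U, Real.exp (-1) ≤ weight f z s r x := fun r hr x hx => by
    have h1 : |logWeight f (z r - z s) x| ≤ Y := by simpa using hY r hr 0 (by norm_num) x hx
    rw [weight_eq_exp]
    exact Real.exp_le_exp.2 (by linarith [le_abs_self (logWeight f (z r - z s) x)])
  have hEI := heq.energy_le hU hf hz hm hdat hs hst hw hut hY isEnergyProfile_id (e := 1) (KA := 1)
    (Λ := d * (10 * Real.exp 2 * Y)) (by norm_num) (by linarith) zero_le_one (fun a => by simp)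
    (by positivity) (fun r hr x hx ξ => abs_laplacian_linear_le hU.isOpen hf hY1 (hY r hr) hx ξ)
  have hsq : Real.exp (-2) = Real.exp (-1) * Real.exp (-1) := by rw [← Real.exp_add]; norm_num
  set I := ∫⁻ r in Ioc s t, ∫⁻ x in U, ‖G r x‖ₑ ^ 2 with hI
  have hsubT : Ioc s t ⊆ Icc 0 t := Ioc_subset_Icc_zero hs
  have hIfin : I < ⊤ := lt_of_le_of_lt (lintegral_mono_set hsubT)
    (hdat.mem t (by linarith)).lintegral_grad_lt_top
  have hfinal : ENNReal.ofReal (Real.exp (-2) / 2) * (∫⁻ x in U, ‖u t x‖ₑ ^ 2)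
      ≤ ∫⁻ y, ENNReal.ofReal
        (kinetic (u t y.2) y.1 * expProfile id y.1 (logWeight f (z t - z s) y.2))
          ∂(volume.prod (volume.restrict U)) := by
    have h1 := lintegral_prod_kinetic_rpow (μ := volume.restrict U) (a := 1) (by norm_num)
      hut.1.aemeasurable (g := fun _ => ENNReal.ofReal (Real.exp (-2))) aemeasurable_const
    calc _ = ∫⁻ x in U, ENNReal.ofReal (Real.exp (-2)) *
            ENNReal.ofReal (|u t x| ^ ((1 : ℝ) + 1) / (1 + 1)) := by
          rw [← lintegral_const_mul' _ _ ENNReal.ofReal_ne_top]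
          refine lintegral_congr fun x => ?_
          rw [enorm_sq_eq_ofReal, ← ENNReal.ofReal_mul (by positivity),
            ← ENNReal.ofReal_mul (by positivity)]
          congr 1
          norm_num
          ring
      _ ≤ _ := by
          rw [← h1]
          refine lintegral_mono_ae ?_
          filter_upwards [Measure.quasiMeasurePreserving_snd.ae
            (ae_restrict_mem hU.isOpen.measurableSet)] with y hy
          rw [Real.enorm_eq_ofReal_abs, ← ENNReal.ofReal_mul (abs_nonneg _),
            ← ENNReal.ofReal_mul (Real.exp_pos _).le]
          refine ENNReal.ofReal_le_ofReal ?_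
          have hv := hYv t (right_mem_Ioc.2 hst) y.2 hy
          rw [expProfile_logWeight, Real.rpow_one, ← abs_mul,
            abs_of_nonneg (kinetic_mul_nonneg (mul_self_nonneg y.1)), hsq]
          have hk : 0 ≤ kinetic (u t y.2) y.1 * y.1 := kinetic_mul_nonneg (mul_self_nonneg y.1)
          calc Real.exp (-1) * Real.exp (-1) * (kinetic (u t y.2) y.1 * y.1)
              ≤ weight f z s t y.2 * weight f z s t y.2 * (kinetic (u t y.2) y.1 * y.1) := by
                have hv0 : 0 ≤ weight f z s t y.2 := (Real.exp_pos _).le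
                gcongr
            _ = _ := by simp only [id]; ring
  have hdefect : ENNReal.ofReal c * I ≤ ∫⁻ r in Ioc s t, ∫⁻ x in U,
      ENNReal.ofReal (4 * m / (m + 1) ^ 2 * ‖G r x‖ ^ 2) *
        ENNReal.ofReal (weight f z s r x ^ 2 * deriv id (u r x * weight f z s r x)) := by
    rw [hI, ← lintegral_const_mul' _ _ ENNReal.ofReal_ne_top]
    refine lintegral_mono_ae ?_
    filter_upwards [ae_restrict_mem measurableSet_Ioc] with r hr
    rw [← lintegral_const_mul' _ _ ENNReal.ofReal_ne_top]
    refine lintegral_mono_ae ?_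
    filter_upwards [ae_restrict_mem hU.isOpen.measurableSet] with x hx
    rw [← ofReal_norm, ← ENNReal.ofReal_pow (norm_nonneg _), ← ENNReal.ofReal_mul hc0.le,
      ← ENNReal.ofReal_mul (by positivity)]
    refine ENNReal.ofReal_le_ofReal ?_
    rw [deriv_id, mul_one, hc, hsq]
    have hv := hYv r hr x hx
    calc _ = 4 * m / (m + 1) ^ 2 * ‖G r x‖ ^ 2 * (Real.exp (-1) ^ 2) := by ring
      _ ≤ _ := by gcongr
  have hflux : ∫⁻ r in Ioc s t, ∫⁻ x in U, ENNReal.ofReal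
      (d * (10 * Real.exp 2 * Y) * m / (m + 1) * |u r x| ^ (m + 1))
        ≤ ENNReal.ofReal (c / 2) * I := by
    rw [hI, ← lintegral_const_mul' _ _ ENNReal.ofReal_ne_top]
    have hae : ∀ᵐ r ∂(volume.restrict (Ioc s t)),
        MemW1pZero U 2 (fun x => spow ((m + 1) / 2) (u r x)) (G r) :=
      ae_restrict_of_ae_restrict_of_subset hsubT (hdat.mem t (by linarith)).mem
    refine lintegral_mono_ae ?_
    filter_upwards [hae] with r hr
    calc _ = ENNReal.ofReal (d * (10 * Real.exp 2 * Y) * m / (m + 1)) *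
            ∫⁻ x in U, ‖spow ((m + 1) / 2) (u r x)‖ₑ ^ 2 := by
          rw [← lintegral_const_mul' _ _ ENNReal.ofReal_ne_top]
          refine lintegral_congr fun x => ?_
          rw [enorm_spow_sq hm, ← ENNReal.ofReal_mul (by positivity)]
      _ ≤ ENNReal.ofReal (d * (10 * Real.exp 2 * Y) * m / (m + 1)) *
            (ENNReal.ofReal CP * ∫⁻ x in U, ‖G r x‖ₑ ^ 2) := by
          gcongr
          exact hpoinc _ _ hr
      _ ≤ _ := by
          rw [← mul_assoc, ← ENNReal.ofReal_mul (by positivity)]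
          gcongr
  have hinit : ∫⁻ x in U, ENNReal.ofReal (1 / (1 + 1) * |w x| ^ ((1 : ℝ) + 1))
      = ENNReal.ofReal (1 / 2) * ∫⁻ x in U, ‖w x‖ₑ ^ 2 := by
    rw [← lintegral_const_mul' _ _ ENNReal.ofReal_ne_top]
    refine lintegral_congr fun x => ?_
    rw [enorm_sq_eq_ofReal, ← ENNReal.ofReal_mul (by positivity)]
    congr 1
    norm_num
  rw [hinit] at hEI
  have hsum := (add_le_add hfinal hdefect).trans (hEI.trans (add_le_add_right hflux _))
  have hsplit : ENNReal.ofReal c * I = ENNReal.ofReal (c / 2) * I + ENNReal.ofReal (c / 2) * I := by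
    rw [← add_mul, ← ENNReal.ofReal_add (by positivity) (by positivity)]
    congr 2; ring
  rw [hsplit, ← add_assoc] at hsum
  have hfin' : ENNReal.ofReal (c / 2) * I ≠ ⊤ := (ENNReal.mul_lt_top ENNReal.ofReal_lt_top hIfin).ne
  have habs := ENNReal.le_of_add_le_add_right hfin' hsum
  have key : ∀ (a b : ℝ) (A W : ℝ≥0∞), 0 < a → 1 / 2 / a ≤ b →
      ENNReal.ofReal a * A ≤ ENNReal.ofReal (1 / 2) * W → A ≤ ENNReal.ofReal b * W := by
    intro a b A W ha hb h
    calc A = ENNReal.ofReal (1 / a) * (ENNReal.ofReal a * A) := by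
          rw [← mul_assoc, ← ENNReal.ofReal_mul (by positivity), one_div_mul_cancel ha.ne']
          simp
      _ ≤ ENNReal.ofReal (1 / a) * (ENNReal.ofReal (1 / 2) * W) := by gcongr
      _ = ENNReal.ofReal (1 / 2 / a) * W := by
          rw [← mul_assoc, ← ENNReal.ofReal_mul (by positivity)]
          congr 2; ring
      _ ≤ _ := by gcongr
  constructor
  · refine key (Real.exp (-2) / 2) _ _ _ (by positivity) ?_ (le_self_add.trans habs)
    rw [Real.exp_neg]
    have : 0 < 1 / c := by positivity
    field_simp
    linarith
  · refine key (c / 2) _ _ _ (by positivity) ?_ (le_add_self.trans habs)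
    have : 1 / 2 / (c / 2) = 1 / c := by field_simp
    rw [this]
    linarith [Real.exp_pos 2]

end GradientBound

/-! ### The energy bound on arbitrary time intervals -/

section Evolution

variable {d n : ℕ} {U : Set (Space d)} {f : Fin n → Space d → ℝ} {z : ℝ → Fin n → ℝ} {m : ℝ}

/-- A kinetic solution, with the gradient `G`, the entropy defect measure `p` and a null set `B` of
times singled out: outside `B` the slices are square integrable and the kinetic equation holds. -/
structure IsKineticEvolution (m : ℝ) (U : Set (Space d)) (f : Fin n → Space d → ℝ)
    (z : ℝ → Fin n → ℝ) (u₀ : Space d → ℝ) (u : ℝ → Space d → ℝ) (G : ℝ → Space d → Space d)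
    (p : Measure (Space d × ℝ × ℝ)) (B : Set ℝ) : Prop extends IsKineticDatum m U u G p where
  null : volume B = 0
  memLp_init : MemLp u₀ 2 (volume.restrict U)
  memLp : ∀ t, 0 < t → t ∉ B → MemLp (u t) 2 (volume.restrict U)
  eq_init : ∀ t, 0 < t → t ∉ B → KineticEquationOn m U f z u G p u₀ 0 t
  eq_on : ∀ s t, 0 < s → s < t → s ∉ B → t ∉ B → KineticEquationOn m U f z u G p (u s) s t

lemma transported_self (ρ : Space d × ℝ → ℝ) (s : ℝ) (x : Space d) (ξ : ℝ) :
    transported f z ρ s s x ξ = ρ (x, ξ) := by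
  unfold transported
  rw [backChar_eq, weight_self, mul_one, mul_one]

lemma IsPathwiseKineticSolution.exists_evolution {u₀ : Space d → ℝ} {u : ℝ → Space d → ℝ}
    (hu₀ : MemLp u₀ 2 (volume.restrict U)) (h : IsPathwiseKineticSolution m U f z u₀ u) :
    ∃ G p B, IsKineticEvolution m U f z u₀ u G p B := by
  obtain ⟨hu, hb, G, hG, p, N, hp, hN0, hN, heq, hinit⟩ := h
  have hslice : ∀ᵐ t ∂(volume.restrict (Ioi (0 : ℝ))), MemLp (u t) 2 (volume.restrict U) := by
    have hk : ∀ᵐ t ∂(volume.restrict (⋃ k : ℕ, Icc (0 : ℝ) (k + 1))),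
        eLpNorm (u t) 2 (volume.restrict U) < ⊤ := by
      rw [ae_restrict_iUnion_iff]
      intro k
      obtain ⟨M, hM⟩ := hb (k + 1) (by positivity)
      filter_upwards [hM] with t ht using lt_of_le_of_lt ht ENNReal.ofReal_lt_top
    have hsub : Ioi (0 : ℝ) ⊆ ⋃ k : ℕ, Icc (0 : ℝ) (k + 1) := fun t ht => by
      obtain ⟨k, hk⟩ := exists_nat_ge t
      exact mem_iUnion.2 ⟨k, le_of_lt ht, by linarith⟩
    filter_upwards [hu.prodMk_left, ae_restrict_of_ae_restrict_of_subset hsub hk] with t h1 h2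
      using ⟨h1, h2⟩
  rw [ae_restrict_iff' measurableSet_Ioi] at hslice
  refine ⟨G, p, N ∪ {t | ¬ (t ∈ Ioi (0 : ℝ) → MemLp (u t) 2 (volume.restrict U))},
    ⟨⟨hu, hG, hp⟩, measure_union_null hN hslice, hu₀, fun t ht hB => ?_, fun t ht hB ρ hρ => ?_,
      fun s t hs hst hsB htB ρ hρ => ?_⟩⟩
  · simp only [mem_union, mem_ofPred_eq, not_or, not_not] at hB
    exact hB.2 ht
  · rw [← heq 0 t le_rfl ht (fun h0 => lt_irrefl (0 : ℝ) (hN0 h0)) (fun h0 => hB (Or.inl h0)) ρ hρ,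
      hinit ρ hρ]
  · rw [← heq s t hs.le hst (fun h0 => hsB (Or.inl h0)) (fun h0 => htB (Or.inl h0)) ρ hρ]
    simp only [transported_self]

lemma exists_mem_Ioo_notMem {B : Set ℝ} (hB : volume B = 0) {a b : ℝ} (hab : a < b) :
    ∃ t ∈ Ioo a b, t ∉ B := by
  by_contra h
  push Not at h
  have h1 : volume (Ioo a b) ≤ volume B := measure_mono h
  rw [hB, Real.volume_Ioo] at h1
  simp only [nonpos_iff_eq_zero, ENNReal.ofReal_eq_zero] at h1
  linarith

/-- The gradient of `u^{[(m+1)/2]}` is bounded in `L²` by the initial datum: the short time bound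
is iterated along a partition of the time interval that avoids the exceptional times. -/
lemma exists_gradient_bound (hd : 1 ≤ d) (hU : IsSmoothBoundedDomain U)
    (hf : ∀ k, IsCb2 U (f k)) (hz : ContinuousOn z (Ici 0)) (hm : 0 < m) {T : ℝ} (hT : 0 < T) :
    ∃ C : ℝ, 0 < C ∧ ∀ (u₀ : Space d → ℝ) (u : ℝ → Space d → ℝ) (G : ℝ → Space d → Space d)
      (p : Measure (Space d × ℝ × ℝ)) (B : Set ℝ), IsKineticEvolution m U f z u₀ u G p B →
      ∫⁻ r in Icc 0 T, ∫⁻ x in U, ‖G r x‖ₑ ^ 2 ≤ ENNReal.ofReal C * ∫⁻ x in U, ‖u₀ x‖ₑ ^ 2 := by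
  obtain ⟨δ, hδ, C, hC, hstep⟩ := exists_short_time_bound hd hU hf hz hm
  have huc : UniformContinuousOn z (Icc 0 (T + 1)) :=
    isCompact_Icc.uniformContinuousOn_of_continuous (hz.mono Icc_subset_Ici_self)
  obtain ⟨η, hη, hzη⟩ := Metric.uniformContinuousOn_iff_le.1 huc δ hδ
  -- consecutive partition points lie in consecutive intervals `(k h, (k + 1) h)`, hence have
  -- distance below `2 h ≤ η`
  set h : ℝ := min (1 / 2) (η / 2) with hh
  have hh0 : 0 < h := lt_min (by norm_num) (by positivity)
  have hh2 : h ≤ 1 / 2 := min_le_left _ _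
  have hhη : h ≤ η / 2 := min_le_right _ _
  set k₀ : ℕ := ⌈T / h⌉₊ with hk₀
  have hk1 : T ≤ k₀ * h := by rw [← div_le_iff₀ hh0]; exact Nat.le_ceil _
  have hk2 : (k₀ : ℝ) * h < T + h := by
    have := Nat.ceil_lt_add_one (div_pos hT hh0).le
    calc (k₀ : ℝ) * h < (T / h + 1) * h := by gcongr
      _ = T + h := by field_simp
  refine ⟨k₀ * C ^ k₀ + 1, by positivity, fun u₀ u G p B hev => ?_⟩
  set W := ∫⁻ x in U, ‖u₀ x‖ₑ ^ 2 with hW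
  have key : ∀ k : ℕ, k ≤ k₀ → ∃ (t : ℝ) (w : Space d → ℝ), k * h ≤ t ∧ t < (k + 1) * h ∧
      MemLp w 2 (volume.restrict U) ∧
      (∀ t', t < t' → t' ∉ B → KineticEquationOn m U f z u G p w t t') ∧
      ∫⁻ x in U, ‖w x‖ₑ ^ 2 ≤ ENNReal.ofReal (C ^ k) * W ∧
      ∫⁻ r in Ioc 0 t, ∫⁻ x in U, ‖G r x‖ₑ ^ 2 ≤ ENNReal.ofReal (k * C ^ k) * W := by
    intro k
    induction k with
    | zero =>
      intro _
      exact ⟨0, u₀, by simp, by simpa using hh0, hev.memLp_init, hev.eq_init, by simp [hW], by simp⟩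
    | succ k ih =>
      intro hk
      obtain ⟨t, w, h1, h2, hw, heq, hwb, hGb⟩ := ih (by omega)
      obtain ⟨t', ⟨ht1, ht2⟩, htB⟩ := exists_mem_Ioo_notMem hev.null
        (show ((k : ℝ) + 1) * h < (k + 1 + 1) * h by nlinarith)
      have ht0 : 0 ≤ t := le_trans (by positivity) h1
      have htt : t < t' := h2.trans ht1
      have hut := hev.memLp t' (by linarith) htB
      have hkT : ((k : ℝ) + 1) * h ≤ k₀ * h := by
        have : (k : ℝ) + 1 ≤ k₀ := by exact_mod_cast hk
        gcongr
      have hT' : t' ≤ T + 1 := by nlinarith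
      obtain ⟨e1, e2⟩ := hstep u G p w t t' hev.toIsKineticDatum ht0 htt hw hut
        (heq t' htt htB) fun r hr => by
          rw [← dist_eq_norm]
          refine hzη r ⟨by linarith [hr.1], by linarith [hr.2]⟩ t ⟨ht0, by linarith⟩ ?_
          rw [Real.dist_eq, abs_of_nonneg (by linarith [hr.1])]
          nlinarith [hr.2]
      have hwC : ENNReal.ofReal C * ∫⁻ x in U, ‖w x‖ₑ ^ 2 ≤ ENNReal.ofReal (C ^ (k + 1)) * W := by
        calc _ ≤ ENNReal.ofReal C * (ENNReal.ofReal (C ^ k) * W) := by gcongr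
          _ = _ := by rw [← mul_assoc, ← ENNReal.ofReal_mul (by linarith), pow_succ']
      refine ⟨t', u t', by push_cast; exact ht1.le, by push_cast; exact ht2, hut,
        fun t'' h3 h4 => hev.eq_on t' t'' (by linarith) h3 htB h4, e1.trans hwC, ?_⟩
      rw [← Ioc_union_Ioc_eq_Ioc ht0 htt.le, lintegral_union measurableSet_Ioc
        (Ioc_disjoint_Ioc_of_le le_rfl)]
      calc _ ≤ ENNReal.ofReal (k * C ^ k) * W + ENNReal.ofReal (C ^ (k + 1)) * W :=
            add_le_add hGb (e2.trans hwC)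
        _ ≤ _ := by
          rw [← add_mul, ← ENNReal.ofReal_add (by positivity) (by positivity)]
          gcongr
          have : C ^ k ≤ C ^ (k + 1) := pow_le_pow_right₀ hC (by omega)
          push_cast
          nlinarith [Nat.cast_nonneg (α := ℝ) k]
  obtain ⟨t, w, h1, h2, -, -, -, hGb⟩ := key k₀ le_rfl
  rw [← setLIntegral_congr (Ioc_ae_eq_Icc (μ := volume) (a := (0 : ℝ)) (b := T))]
  calc _ ≤ ∫⁻ r in Ioc 0 t, ∫⁻ x in U, ‖G r x‖ₑ ^ 2 :=
        lintegral_mono_set (Ioc_subset_Ioc_right (hk1.trans h1))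
    _ ≤ _ := hGb.trans (by gcongr; linarith)

end Evolution

/-! ### Regularized powers for the fast diffusion range -/

section FastDiffusion

/-- A smooth regularization of `a ↦ |a|^{m-1} a`. Its growth is controlled by `|a|^m` uniformly in
`ε`, and by `ε^{m-1} |a|`. -/
noncomputable def regPower (m ε a : ℝ) : ℝ := a * (a ^ 2 + ε ^ 2) ^ ((m - 1) / 2)

variable {m ε : ℝ}

lemma contDiff_regPower (hε : 0 < ε) : ContDiff ℝ ∞ (regPower m ε) := by
  unfold regPower
  refine contDiff_id.mul (ContDiff.rpow_const_of_ne (by fun_prop) fun a => ?_)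
  positivity

lemma hasDerivAt_regBase (hε : 0 < ε) (α a : ℝ) :
    HasDerivAt (fun a : ℝ => (a ^ 2 + ε ^ 2) ^ α) (2 * α * a * (a ^ 2 + ε ^ 2) ^ (α - 1)) a := by
  have h : HasDerivAt (fun a : ℝ => a ^ 2 + ε ^ 2) (2 * a) a := by
    simpa using (hasDerivAt_pow 2 a).add_const (ε ^ 2)
  refine (h.rpow_const (p := α) (Or.inl (by positivity))).congr_deriv ?_
  ring

lemma deriv_regPower (hε : 0 < ε) (a : ℝ) : deriv (regPower m ε) a
    = (a ^ 2 + ε ^ 2) ^ ((m - 1) / 2)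
      + (m - 1) * a ^ 2 * (a ^ 2 + ε ^ 2) ^ ((m - 1) / 2 - 1) := by
  refine (((hasDerivAt_id a).mul (hasDerivAt_regBase hε ((m - 1) / 2) a)).deriv).trans ?_
  simp only [id]
  ring

lemma deriv_deriv_regPower (hε : 0 < ε) (a : ℝ) : deriv (deriv (regPower m ε)) a
    = 3 * (m - 1) * a * (a ^ 2 + ε ^ 2) ^ ((m - 1) / 2 - 1)
      + (m - 1) * (m - 3) * a ^ 3 * (a ^ 2 + ε ^ 2) ^ ((m - 1) / 2 - 1 - 1) := by
  rw [show deriv (regPower m ε) = fun a => (a ^ 2 + ε ^ 2) ^ ((m - 1) / 2)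
      + (m - 1) * a ^ 2 * (a ^ 2 + ε ^ 2) ^ ((m - 1) / 2 - 1) from funext (deriv_regPower hε)]
  have h2 : HasDerivAt (fun a : ℝ => (m - 1) * a ^ 2) ((m - 1) * (2 * a)) a := by
    simpa using (hasDerivAt_pow 2 a).const_mul (m - 1)
  refine ((hasDerivAt_regBase hε ((m - 1) / 2) a).add
    (h2.mul (hasDerivAt_regBase hε ((m - 1) / 2 - 1) a))).deriv.trans ?_
  ring

lemma rpow_sub_one_mul_self {b : ℝ} (hb : 0 < b) (α : ℝ) : b ^ (α - 1) * b = b ^ α := by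
  rw [← Real.rpow_add_one hb.ne']; congr 1; ring

lemma le_deriv_regPower (hm1 : m < 1) (hε : 0 < ε) (a : ℝ) :
    m * (a ^ 2 + ε ^ 2) ^ ((m - 1) / 2) ≤ deriv (regPower m ε) a := by
  have hb : 0 < a ^ 2 + ε ^ 2 := by positivity
  rw [deriv_regPower hε, ← rpow_sub_one_mul_self hb]
  have := Real.rpow_pos_of_pos hb ((m - 1) / 2 - 1)
  nlinarith [mul_nonneg this.le (mul_nonneg (by linarith : 0 ≤ 1 - m) (sq_nonneg ε))]

lemma deriv_regPower_le (hm1 : m < 1) (hε : 0 < ε) (a : ℝ) :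
    deriv (regPower m ε) a ≤ (a ^ 2 + ε ^ 2) ^ ((m - 1) / 2) := by
  have hb : 0 < a ^ 2 + ε ^ 2 := by positivity
  rw [deriv_regPower hε]
  have := Real.rpow_pos_of_pos hb ((m - 1) / 2 - 1)
  nlinarith [mul_nonneg this.le (mul_nonneg (by linarith : 0 ≤ 1 - m) (sq_nonneg a))]

lemma abs_deriv_regPower_le (hm : 0 < m) (hm1 : m < 1) (hε : 0 < ε) (a : ℝ) :
    |deriv (regPower m ε) a| ≤ (a ^ 2 + ε ^ 2) ^ ((m - 1) / 2) := by
  have hb : 0 < a ^ 2 + ε ^ 2 := by positivity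
  rw [abs_of_nonneg]
  · exact deriv_regPower_le hm1 hε a
  · exact le_trans (mul_nonneg hm.le (Real.rpow_nonneg hb.le _)) (le_deriv_regPower hm1 hε a)

lemma abs_sq_deriv_deriv_regPower_le (hm : 0 < m) (hm1 : m < 1) (hε : 0 < ε) (a : ℝ) :
    |a ^ 2 * deriv (deriv (regPower m ε)) a| ≤ 6 * (|a| * (a ^ 2 + ε ^ 2) ^ ((m - 1) / 2)) := by
  set b := a ^ 2 + ε ^ 2 with hbdef
  have hb : 0 < b := by positivity
  have hab : a ^ 2 ≤ b := by rw [hbdef]; nlinarith [sq_nonneg ε]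
  set β := b ^ ((m - 1) / 2 - 1 - 1) with hβ
  have hβ0 : 0 < β := Real.rpow_pos_of_pos hb _
  have e1 : b ^ ((m - 1) / 2 - 1) = β * b := (rpow_sub_one_mul_self hb _).symm
  have e2 : b ^ ((m - 1) / 2) = β * b * b := by rw [← e1, rpow_sub_one_mul_self hb]
  rw [deriv_deriv_regPower hε, ← hbdef, e1, e2, ← hβ]
  have : a ^ 2 * (3 * (m - 1) * a * (β * b) + (m - 1) * (m - 3) * a ^ 3 * β)
      = a * (β * (a ^ 2 * (3 * (m - 1) * b + (m - 1) * (m - 3) * a ^ 2))) := by ring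
  rw [this, abs_mul, abs_mul β, abs_of_pos hβ0]
  have h3 : |a ^ 2 * (3 * (m - 1) * b + (m - 1) * (m - 3) * a ^ 2)| ≤ 6 * (b * b) := by
    have ha0 := sq_nonneg a
    have h4 : |3 * (m - 1) * b + (m - 1) * (m - 3) * a ^ 2| ≤ 6 * b := by
      rw [abs_le]
      constructor
      · nlinarith [mul_nonneg (mul_nonneg (by linarith : 0 ≤ 1 - m) (by linarith : 0 ≤ 3 - m)) ha0]
      · have h5 : (m - 1) * (m - 3) ≤ 3 := by nlinarith
        nlinarith [mul_le_mul h5 hab ha0 (by norm_num : (0 : ℝ) ≤ 3),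
          mul_nonneg (by linarith : 0 ≤ 1 - m) hb.le]
    rw [abs_mul, abs_of_nonneg ha0]
    calc a ^ 2 * _ ≤ b * (6 * b) := by gcongr
      _ = _ := by ring
  calc |a| * (β * |a ^ 2 * (3 * (m - 1) * b + (m - 1) * (m - 3) * a ^ 2)|)
      ≤ |a| * (β * (6 * (b * b))) := by gcongr
    _ = _ := by ring

/-- Any bound of `|a| (a² + ε²)^{(m-1)/2}` by a power of `|a|` gives profile bounds for the
regularized power. -/
lemma isProfile_regPower (hm : 0 < m) (hm1 : m < 1) (hε : 0 < ε) {K e : ℝ}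
    (h : ∀ a : ℝ, |a| * (a ^ 2 + ε ^ 2) ^ ((m - 1) / 2) ≤ K * |a| ^ e) :
    IsProfile (regPower m ε) (6 * K) e := by
  have h0 : ∀ a : ℝ, 0 ≤ |a| * (a ^ 2 + ε ^ 2) ^ ((m - 1) / 2) := fun a => by positivity
  refine ⟨contDiff_regPower hε, fun a => ?_, fun a => ?_, fun a => ?_⟩
  · unfold regPower
    rw [abs_mul, abs_of_nonneg (Real.rpow_nonneg (by positivity) _)]
    linarith [h a, h0 a]
  · rw [abs_mul]
    have := mul_le_mul_of_nonneg_left (abs_deriv_regPower_le hm hm1 hε a) (abs_nonneg a)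
    linarith [h a, h0 a]
  · refine (abs_sq_deriv_deriv_regPower_le hm hm1 hε a).trans ?_
    linarith [h a]

lemma regBase_le_eps (hm1 : m < 1) (hε : 0 < ε) (a : ℝ) :
    (a ^ 2 + ε ^ 2) ^ ((m - 1) / 2) ≤ ε ^ (m - 1) := by
  calc _ ≤ (ε ^ 2) ^ ((m - 1) / 2) :=
        Real.rpow_le_rpow_of_nonpos (by positivity) (by nlinarith [sq_nonneg a]) (by linarith)
    _ = _ := by
      rw [← Real.rpow_natCast, ← Real.rpow_mul hε.le]; congr 1; push_cast; ring

lemma abs_mul_regBase_le (hm1 : m < 1) (ε a : ℝ) :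
    |a| * (a ^ 2 + ε ^ 2) ^ ((m - 1) / 2) ≤ 1 * |a| ^ m := by
  rcases eq_or_ne a 0 with rfl | ha
  · rw [abs_zero, zero_mul]; positivity
  have ha' : 0 < |a| := abs_pos.2 ha
  calc _ ≤ |a| * (|a| ^ 2) ^ ((m - 1) / 2) := by
        gcongr ?_ * ?_
        refine Real.rpow_le_rpow_of_nonpos (by positivity) ?_ (by linarith)
        rw [sq_abs]; nlinarith [sq_nonneg ε]
    _ = 1 * |a| ^ m := by
      rw [← Real.rpow_natCast, ← Real.rpow_mul ha'.le, one_mul, mul_comm,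
        ← Real.rpow_add_one ha'.ne']
      congr 1; push_cast; ring

lemma isProfile_regPower_rpow (hm : 0 < m) (hm1 : m < 1) (hε : 0 < ε) :
    IsProfile (regPower m ε) 6 m := by
  simpa using isProfile_regPower hm hm1 hε (abs_mul_regBase_le hm1 ε)

lemma isEnergyProfile_regPower (hm : 0 < m) (hm1 : m < 1) (hε : 0 < ε) :
    IsEnergyProfile (regPower m ε) (6 * ε ^ (m - 1)) := by
  have hpos : 0 < ε ^ (m - 1) := Real.rpow_pos_of_pos hε _
  refine ⟨isProfile_regPower hm hm1 hε fun a => ?_, fun a => ?_, fun a => ?_, fun a => ?_⟩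
  · rw [Real.rpow_one, mul_comm]
    gcongr
    exact regBase_le_eps hm1 hε a
  · exact le_trans (by positivity) (le_deriv_regPower hm1 hε a)
  · linarith [abs_deriv_regPower_le hm hm1 hε a, regBase_le_eps hm1 hε a]
  · unfold regPower
    rw [← mul_assoc]
    exact mul_nonneg (mul_self_nonneg a) (Real.rpow_nonneg (by positivity) _)

end FastDiffusion

/-! ### Bounds in the fast diffusion range -/

section FastDiffusionBound

variable {d n : ℕ} {U : Set (Space d)} {f : Fin n → Space d → ℝ} {z : ℝ → Fin n → ℝ} {m : ℝ}

lemma lintegral_rpow_le_of_le_one {X : Type*} [MeasurableSpace X] {μ : Measure X}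
    {g : X → ℝ≥0∞} (hg : AEMeasurable g μ) {θ : ℝ} (h0 : 0 ≤ θ) (h1 : θ ≤ 1) :
    ∫⁻ x, g x ^ θ ∂μ ≤ (∫⁻ x, g x ∂μ) ^ θ * μ univ ^ (1 - θ) := by
  have := ENNReal.lintegral_mul_norm_pow_le (μ := μ) hg (g := fun _ => 1) aemeasurable_const
    (p := θ) (q := 1 - θ) h0 (by linarith) (by ring)
  simpa using this

/-- Poincaré inequality in space-time for `u^{[(m+1)/2]}`. -/
lemma exists_spaceTime_poincare (hd : 1 ≤ d) (hU : IsSmoothBoundedDomain U) (hm : 0 < m) :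
    ∃ C : ℝ, 0 < C ∧ ∀ (u : ℝ → Space d → ℝ) (G : ℝ → Space d → Space d) (T : ℝ),
      MemLpW1pZero U T 2 (fun t x => spow ((m + 1) / 2) (u t x)) G →
      ∫⁻ r in Icc 0 T, ∫⁻ x in U, ENNReal.ofReal (|u r x| ^ (m + 1))
        ≤ ENNReal.ofReal C * ∫⁻ r in Icc 0 T, ∫⁻ x in U, ‖G r x‖ₑ ^ 2 := by
  obtain ⟨C, hC, h⟩ := exists_poincare hd hU.isBounded
  refine ⟨C, hC, fun u G T hT => ?_⟩
  rw [← lintegral_const_mul' _ _ ENNReal.ofReal_ne_top]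
  refine lintegral_mono_ae ?_
  filter_upwards [hT.mem] with r hr
  simpa only [enorm_spow_sq hm] using h _ _ hr

lemma IsKineticDatum.aemeasurable_Icc {u : ℝ → Space d → ℝ} {G : ℝ → Space d → Space d}
    {p : Measure (Space d × ℝ × ℝ)} (h : IsKineticDatum m U u G p) (T : ℝ) :
    AEMeasurable (fun y : ℝ × Space d => u y.1 y.2)
      ((volume.restrict (Icc 0 T)).prod (volume.restrict U)) := by
  rw [← Measure.restrict_congr_set (Ioc_ae_eq_Icc (μ := volume) (a := (0 : ℝ)) (b := T))]
  exact (aesm_mono_Ioc h.aesm le_rfl).aemeasurable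

/-- In the fast diffusion range, `|u|^{2m}` is a sublinear power of `|u|^{m+1}`, so that its
integral is controlled by a power of the energy of the initial datum. -/
lemma exists_sublinear_bound (hd : 1 ≤ d) (hU : IsSmoothBoundedDomain U)
    (hf : ∀ k, IsCb2 U (f k)) (hz : ContinuousOn z (Ici 0)) (hm : 0 < m) (hm1 : m < 1) {T : ℝ}
    (hT : 0 < T) :
    ∃ C : ℝ, 0 < C ∧ ∀ (u₀ : Space d → ℝ) (u : ℝ → Space d → ℝ) (G : ℝ → Space d → Space d)
      (p : Measure (Space d × ℝ × ℝ)) (B : Set ℝ), IsKineticEvolution m U f z u₀ u G p B →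
      ∫⁻ r in Icc 0 T, ∫⁻ x in U, ENNReal.ofReal (|u r x| ^ (2 * m))
        ≤ ENNReal.ofReal C * (∫⁻ x in U, ‖u₀ x‖ₑ ^ 2) ^ (2 * m / (m + 1)) := by
  obtain ⟨C1, hC1, h1⟩ := exists_gradient_bound hd hU hf hz hm hT
  obtain ⟨C2, hC2, h2⟩ := exists_spaceTime_poincare hd hU hm
  set θ : ℝ := 2 * m / (m + 1) with hθ
  have hθ0 : 0 ≤ θ := by positivity
  have hθ1 : θ ≤ 1 := by rw [hθ, div_le_one (by linarith)]; linarith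
  set ν := (volume.restrict (Icc (0 : ℝ) T)).prod ((volume : Measure (Space d)).restrict U)
  have hν : ν univ < ⊤ := by
    simp only [ν]
    rw [← univ_prod_univ, Measure.prod_prod, Measure.restrict_apply_univ,
      Measure.restrict_apply_univ]
    exact ENNReal.mul_lt_top (by simp) hU.isBounded.measure_lt_top
  set V := ν univ ^ (1 - θ) with hV
  have hVt : V ≠ ⊤ := ENNReal.rpow_ne_top_of_nonneg (by linarith) hν.ne
  refine ⟨(C2 * C1) ^ θ * V.toReal + 1, by positivity, fun u₀ u G p B hev => ?_⟩
  have hu := hev.aemeasurable_Icc T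
  have hg : AEMeasurable (fun y : ℝ × Space d => ENNReal.ofReal (|u y.1 y.2| ^ (m + 1))) ν :=
    ((hu.abs).pow_const _).ennreal_ofReal
  have hg2 : AEMeasurable (fun y : ℝ × Space d => ENNReal.ofReal (|u y.1 y.2| ^ (2 * m))) ν :=
    ((hu.abs).pow_const _).ennreal_ofReal
  calc ∫⁻ r in Icc 0 T, ∫⁻ x in U, ENNReal.ofReal (|u r x| ^ (2 * m))
      = ∫⁻ y, ENNReal.ofReal (|u y.1 y.2| ^ (m + 1)) ^ θ ∂ν := by
        rw [← lintegral_prod (fun y : ℝ × Space d => ENNReal.ofReal (|u y.1 y.2| ^ (2 * m))) hg2]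
        refine lintegral_congr fun y => ?_
        rw [ENNReal.ofReal_rpow_of_nonneg (by positivity) hθ0, ← Real.rpow_mul (abs_nonneg _)]
        congr 2
        rw [hθ]; field_simp
    _ ≤ (∫⁻ y, ENNReal.ofReal (|u y.1 y.2| ^ (m + 1)) ∂ν) ^ θ * V :=
        lintegral_rpow_le_of_le_one hg hθ0 hθ1
    _ ≤ (ENNReal.ofReal (C2 * C1) * ∫⁻ x in U, ‖u₀ x‖ₑ ^ 2) ^ θ * V := by
        gcongr
        rw [lintegral_prod _ hg, ENNReal.ofReal_mul hC2.le, mul_assoc]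
        exact (h2 u G T (hev.mem T hT)).trans (mul_le_mul_right (h1 u₀ u G p B hev) _)
    _ = ENNReal.ofReal ((C2 * C1) ^ θ * V.toReal) * (∫⁻ x in U, ‖u₀ x‖ₑ ^ 2) ^ θ := by
        rw [ENNReal.mul_rpow_of_nonneg _ _ hθ0,
          ENNReal.ofReal_mul (by positivity : 0 ≤ (C2 * C1) ^ θ),
          ENNReal.ofReal_toReal hVt, ENNReal.ofReal_rpow_of_nonneg (by positivity) hθ0]
        ring
    _ ≤ _ := by gcongr; linarith

/-- In the fast diffusion range, testing with the regularizations of `ξ^{[m]}` bounds the gradient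
of `u^{[m]}`. -/
lemma exists_weighted_gradient_bound (hd : 1 ≤ d) (hU : IsSmoothBoundedDomain U)
    (hf : ∀ k, IsCb2 U (f k)) (hz : ContinuousOn z (Ici 0)) (hm : 0 < m) (hm1 : m < 1) {T : ℝ}
    (hT : 0 < T) :
    ∃ C : ℝ, 0 < C ∧ ∀ (u₀ : Space d → ℝ) (u : ℝ → Space d → ℝ) (G : ℝ → Space d → Space d)
      (p : Measure (Space d × ℝ × ℝ)) (B : Set ℝ), IsKineticEvolution m U f z u₀ u G p B →
      ∫⁻ r in Icc 0 T, ∫⁻ x in U, ENNReal.ofReal (|u r x| ^ (m - 1)) * ‖G r x‖ₑ ^ 2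
        ≤ ENNReal.ofReal C * ((∫⁻ x in U, ENNReal.ofReal (|u₀ x| ^ (m + 1)))
          + (∫⁻ x in U, ‖u₀ x‖ₑ ^ 2) ^ (2 * m / (m + 1))) := by
  obtain ⟨M, hM, hlog⟩ := exists_bound_logWeight hU.isOpen hf
  obtain ⟨C1, hC1, h1⟩ := exists_sublinear_bound hd hU hf hz hm hm1 (T := T + 1) (by linarith)
  obtain ⟨Z, hZ⟩ := isCompact_Icc.exists_bound_of_continuousOn
    ((hz.sub (continuousOn_const (c := z 0))).mono (Icc_subset_Ici_self : Icc 0 (T + 1) ⊆ Ici 0))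
  have hZ0 : 0 ≤ Z := (norm_nonneg _).trans (hZ 0 ⟨le_rfl, by linarith⟩)
  set Y : ℝ := M * Z with hYdef
  have hY0 : 0 ≤ Y := by positivity
  set Λ : ℝ := d * (10 * 6 * Real.exp (Y * (1 + m)) * (1 + Y) ^ 2) with hΛdef
  have hΛ : 0 ≤ Λ := by positivity
  set α : ℝ := (m - 1) / 2 with hα
  have hα0 : α < 0 := by rw [hα]; linarith
  -- the constant in front of the dissipation, after bounding the weight from below
  set c : ℝ := 4 * m / (m + 1) ^ 2 * (Real.exp (-2 * Y) * (m * Real.exp (2 * Y) ^ α)) with hc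
  have hc0 : 0 < c := by positivity
  set D : ℝ := 6 / (m + 1) + Λ * m / (m + m) * C1 with hDdef
  have hD : 0 < D := by positivity
  refine ⟨1 / c * D, by positivity, fun u₀ u G p B hev => ?_⟩
  obtain ⟨t, ⟨htT, htT1⟩, htB⟩ := exists_mem_Ioo_notMem hev.null (lt_add_one T)
  have ht0 : 0 < t := hT.trans htT
  have hY : ∀ r ∈ Ioc 0 t, ∀ i ≤ 2, ∀ x ∈ U,
      ‖iteratedFDeriv ℝ i (logWeight f (z r - z 0)) x‖ ≤ Y := fun r hr i hi x hx => by
    refine (hlog _ i hi x hx).trans ?_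
    exact mul_le_mul_of_nonneg_left (hZ r ⟨hr.1.le, by linarith [hr.2]⟩) hM.le
  set W := (∫⁻ x in U, ENNReal.ofReal (|u₀ x| ^ (m + 1)))
    + (∫⁻ x in U, ‖u₀ x‖ₑ ^ 2) ^ (2 * m / (m + 1)) with hW
  have hEI : ∀ ε : ℝ, 0 < ε → ∫⁻ r in Ioc 0 t, ∫⁻ x in U,
      ENNReal.ofReal (4 * m / (m + 1) ^ 2 * ‖G r x‖ ^ 2) * ENNReal.ofReal
        (weight f z 0 r x ^ 2 * deriv (regPower m ε) (u r x * weight f z 0 r x))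
      ≤ ENNReal.ofReal D * W := fun ε hε => by
    have := (hev.eq_init t ht0 htB).energy_le hU hf hz hm hev.toIsKineticDatum le_rfl ht0
      hev.memLp_init (hev.memLp t ht0 htB) hY (isEnergyProfile_regPower hm hm1 hε) (e := m)
      (KA := 6) (Λ := Λ) (by linarith) (by linarith) (by norm_num)
      (isProfile_regPower_rpow hm hm1 hε).bound_zero hΛ (fun r hr x hx ξ =>
        abs_laplacian_transported_le hU.isOpen hf (isProfile_regPower_rpow hm hm1 hε) hm.le
          (hY r hr) hx ξ)
    refine (le_add_self.trans this).trans ?_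
    have e1 : ∫⁻ x in U, ENNReal.ofReal (6 / (m + 1) * |u₀ x| ^ (m + 1))
        = ENNReal.ofReal (6 / (m + 1)) * ∫⁻ x in U, ENNReal.ofReal (|u₀ x| ^ (m + 1)) := by
      rw [← lintegral_const_mul' _ _ ENNReal.ofReal_ne_top]
      exact lintegral_congr fun x => ENNReal.ofReal_mul (by positivity)
    have e2 : ∫⁻ r in Ioc 0 t, ∫⁻ x in U, ENNReal.ofReal (Λ * m / (m + m) * |u r x| ^ (m + m))
        ≤ ENNReal.ofReal (Λ * m / (m + m) * C1) *
          (∫⁻ x in U, ‖u₀ x‖ₑ ^ 2) ^ (2 * m / (m + 1)) := by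
      calc _ ≤ ∫⁻ r in Icc 0 (T + 1), ∫⁻ x in U,
              ENNReal.ofReal (Λ * m / (m + m) * |u r x| ^ (m + m)) :=
            lintegral_mono_set fun r hr => ⟨hr.1.le, by linarith [hr.2]⟩
        _ = ENNReal.ofReal (Λ * m / (m + m)) * ∫⁻ r in Icc 0 (T + 1), ∫⁻ x in U,
              ENNReal.ofReal (|u r x| ^ (2 * m)) := by
            rw [← lintegral_const_mul' _ _ ENNReal.ofReal_ne_top]
            refine lintegral_congr fun r => ?_
            rw [← lintegral_const_mul' _ _ ENNReal.ofReal_ne_top]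
            refine lintegral_congr fun x => ?_
            rw [ENNReal.ofReal_mul (by positivity), two_mul]
        _ ≤ ENNReal.ofReal (Λ * m / (m + m)) * (ENNReal.ofReal C1 *
              (∫⁻ x in U, ‖u₀ x‖ₑ ^ 2) ^ (2 * m / (m + 1))) := by
            gcongr
            exact h1 u₀ u G p B hev
        _ = _ := by rw [← mul_assoc, ← ENNReal.ofReal_mul (by positivity)]
    rw [e1]
    refine (add_le_add_right e2 _).trans ?_
    rw [hW, mul_add]
    have hl : 0 ≤ Λ * m / (m + m) * C1 := by positivity
    have hr : 0 ≤ 6 / (m + 1) := by positivity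
    gcongr <;> linarith
  -- a lower bound of the dissipation density; since the exponent `α` is negative, the weight is
  -- replaced by its upper bound inside the power
  set g : ℕ → ℝ × Space d → ℝ≥0∞ := fun j y => ENNReal.ofReal (4 * m / (m + 1) ^ 2 *
    ‖G y.1 y.2‖ ^ 2) * ENNReal.ofReal (Real.exp (-2 * Y) *
      (m * (Real.exp (2 * Y) * u y.1 y.2 ^ 2 + (1 / ((j : ℝ) + 1)) ^ 2) ^ α))
  set ν := (volume.restrict (Ioc 0 t)).prod ((volume : Measure (Space d)).restrict U)
  have hu : AEMeasurable (fun y : ℝ × Space d => u y.1 y.2) ν :=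
    (aesm_mono_Ioc hev.aesm le_rfl).aemeasurable
  have hG : AEMeasurable (fun y : ℝ × Space d => ‖G y.1 y.2‖) ν :=
    (aesm_mono_Ioc hev.aesm_grad le_rfl).norm.aemeasurable
  have hg : ∀ j, AEMeasurable (g j) ν := fun j =>
    (((hG.pow_const 2).const_mul _).ennreal_ofReal).mul
      ((((((hu.pow_const 2).const_mul _).add_const _).pow_const _).const_mul _).const_mul
        _).ennreal_ofReal
  have hgb : ∀ j, ∫⁻ y, g j y ∂ν ≤ ENNReal.ofReal D * W := fun j => by
    rw [lintegral_prod _ (hg j)]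
    refine le_trans ?_ (hEI (1 / ((j : ℝ) + 1)) (by positivity))
    refine lintegral_mono_ae ?_
    filter_upwards [ae_restrict_mem measurableSet_Ioc] with r hr
    refine lintegral_mono_ae ?_
    filter_upwards [ae_restrict_mem hU.isOpen.measurableSet] with x hx
    simp only [g]
    refine mul_le_mul' le_rfl (ENNReal.ofReal_le_ofReal ?_)
    set ε := 1 / ((j : ℝ) + 1)
    have hε : 0 < ε := by positivity
    set v := weight f z 0 r x with hv
    have hl : |logWeight f (z r - z 0) x| ≤ Y := by simpa using hY r hr 0 (by norm_num) x hx
    have hv1 : Real.exp (-Y) ≤ v := by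
      rw [hv, weight_eq_exp]
      exact Real.exp_le_exp.2 (by linarith [le_abs_self (logWeight f (z r - z 0) x)])
    have hv2 : v ≤ Real.exp Y := by
      rw [hv, weight_eq_exp]
      exact Real.exp_le_exp.2 (by linarith [neg_abs_le (logWeight f (z r - z 0) x)])
    have hv0 : 0 < v := (Real.exp_pos _).trans_le hv1
    have hv3 : Real.exp (-2 * Y) ≤ v ^ 2 := by
      calc Real.exp (-2 * Y) = Real.exp (-Y) ^ 2 := by
            rw [← Real.exp_nat_mul]; congr 1; push_cast; ring
        _ ≤ _ := by gcongr
    have hv4 : v ^ 2 ≤ Real.exp (2 * Y) := by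
      calc v ^ 2 ≤ Real.exp Y ^ 2 := by gcongr
        _ = _ := by rw [← Real.exp_nat_mul]; congr 1
    have hpow : (Real.exp (2 * Y) * u r x ^ 2 + ε ^ 2) ^ α ≤ ((u r x * v) ^ 2 + ε ^ 2) ^ α := by
      refine Real.rpow_le_rpow_of_nonpos (by positivity) ?_ hα0.le
      rw [mul_pow, mul_comm (u r x ^ 2)]
      gcongr
    calc _ ≤ v ^ 2 * (m * ((u r x * v) ^ 2 + ε ^ 2) ^ α) := by gcongr
      _ ≤ _ := by gcongr; exact le_deriv_regPower hm1 hε _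
  have hlim : ∀ y : ℝ × Space d, ENNReal.ofReal c *
      (ENNReal.ofReal (|u y.1 y.2| ^ (m - 1)) * ‖G y.1 y.2‖ₑ ^ 2)
        ≤ liminf (fun j => g j y) atTop := fun y => by
    rcases eq_or_ne (u y.1 y.2) 0 with h0 | h0
    -- here the left-hand side vanishes, by the convention `0 ^ (m - 1) = 0`
    · simp [h0, Real.zero_rpow (by linarith : m - 1 ≠ 0)]
    · have hb : Real.exp (2 * Y) * u y.1 y.2 ^ 2 + 0 ^ 2 ≠ 0 := by positivity
      have h3 : Tendsto (fun j : ℕ => 1 / ((j : ℝ) + 1)) atTop (𝓝 0) :=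
        tendsto_one_div_add_atTop_nhds_zero_nat
      have h4 := ((((h3.pow 2).const_add (Real.exp (2 * Y) * u y.1 y.2 ^ 2)).rpow_const
        (p := α) (Or.inl hb)).const_mul m).const_mul (Real.exp (-2 * Y))
      have h5 := ENNReal.Tendsto.const_mul (a := ENNReal.ofReal (4 * m / (m + 1) ^ 2 *
        ‖G y.1 y.2‖ ^ 2)) ((ENNReal.continuous_ofReal.tendsto _).comp h4)
        (Or.inr ENNReal.ofReal_ne_top)
      refine le_of_eq ?_
      rw [show (fun j => g j y) = _ from rfl]
      refine Eq.trans ?_ h5.liminf_eq.symm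
      have e3 : |u y.1 y.2| ^ (m - 1) = (u y.1 y.2 ^ 2) ^ α := by
        rw [← sq_abs, ← Real.rpow_natCast, ← Real.rpow_mul (abs_nonneg _), hα]
        congr 1; push_cast; ring
      rw [← ofReal_norm, ← ENNReal.ofReal_pow (norm_nonneg _),
        ← ENNReal.ofReal_mul (by positivity), ← ENNReal.ofReal_mul hc0.le,
        ← ENNReal.ofReal_mul (by positivity)]
      congr 1
      rw [zero_pow two_ne_zero, add_zero, Real.mul_rpow (Real.exp_pos _).le (sq_nonneg _), e3, hc]
      ring
  have hm0 : AEMeasurable (fun y : ℝ × Space d =>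
      ENNReal.ofReal (|u y.1 y.2| ^ (m - 1)) * ‖G y.1 y.2‖ₑ ^ 2) ν :=
    ((hu.abs).pow_const _).ennreal_ofReal.mul
      ((aesm_mono_Ioc hev.aesm_grad le_rfl).enorm.pow_const 2)
  have hfatou : ENNReal.ofReal c * ∫⁻ y, ENNReal.ofReal (|u y.1 y.2| ^ (m - 1)) *
      ‖G y.1 y.2‖ₑ ^ 2 ∂ν ≤ ENNReal.ofReal D * W := by
    rw [← lintegral_const_mul' _ _ ENNReal.ofReal_ne_top]
    refine (lintegral_mono hlim).trans ((lintegral_liminf_le' hg).trans ?_)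
    exact liminf_le_of_le (by isBoundedDefault) fun b hb => by
      obtain ⟨j, hj⟩ := hb.exists
      exact hj.trans (hgb j)
  rw [lintegral_prod _ hm0] at hfatou
  rw [← setLIntegral_congr (Ioc_ae_eq_Icc (μ := volume) (a := (0 : ℝ)) (b := T))]
  set J := ∫⁻ r in Ioc 0 t, ∫⁻ x in U, ENNReal.ofReal (|u r x| ^ (m - 1)) * ‖G r x‖ₑ ^ 2 with hJ
  calc _ ≤ J := lintegral_mono_set (Ioc_subset_Ioc_right htT.le)
    _ = ENNReal.ofReal (1 / c) * (ENNReal.ofReal c * J) := by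
        rw [← mul_assoc, ← ENNReal.ofReal_mul (by positivity), one_div_mul_cancel hc0.ne']
        simp
    _ ≤ ENNReal.ofReal (1 / c) * (ENNReal.ofReal D * W) := by gcongr
    _ = _ := by rw [← mul_assoc, ← ENNReal.ofReal_mul (by positivity)]

end FastDiffusionBound

/-! ### Integrability of `∇u^{[m]}` and traces -/

section Conclusion

variable {d n : ℕ} {U : Set (Space d)} {f : Fin n → Space d → ℝ} {z : ℝ → Fin n → ℝ} {m : ℝ}

lemma pExp_of_one_le (hm : 1 ≤ m) : pExp m = (m + 1) / m := by
  unfold pExp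
  rw [min_eq_left]
  rw [div_le_iff₀ (by linarith)]; linarith

lemma pExp_of_le_one (hm : 0 < m) (hm1 : m ≤ 1) : pExp m = 2 := by
  unfold pExp
  rw [min_eq_right]
  rw [le_div_iff₀ hm]; linarith

lemma one_le_pExp (hm : 0 < m) : 1 ≤ pExp m := by
  unfold pExp
  refine le_min ?_ one_le_two
  rw [le_div_iff₀ hm]; linarith

lemma pExp_le_two : pExp m ≤ 2 := min_le_right _ _

lemma abs_spow_rpow (hm : 0 < m) (a : ℝ) :
    |spow ((m + 1) / 2) a| ^ (2 * m / (m + 1) - 1) = |a| ^ ((m - 1) / 2) := by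
  rw [abs_spow (by linarith), ← Real.rpow_mul (abs_nonneg a)]
  congr 1
  field_simp
  ring

lemma spow_spow (hm : 0 < m) (a : ℝ) :
    spow (2 * m / (m + 1)) (spow ((m + 1) / 2) a) = spow m a := by
  rcases eq_or_ne a 0 with rfl | ha
  · simp [spow]
  rw [spow, abs_spow_rpow hm, spow, spow, ← mul_assoc, ← Real.rpow_add (abs_pos.2 ha)]
  congr 2
  ring

lemma lintegral_lintegral_add_left' {X Y : Type*} [MeasurableSpace X] [MeasurableSpace Y]
    {μ : Measure X} {ν : Measure Y} [SFinite μ] [SFinite ν] {g h : X → Y → ℝ≥0∞}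
    (hg : AEMeasurable (Function.uncurry g) (μ.prod ν))
    (hh : AEMeasurable (Function.uncurry h) (μ.prod ν)) :
    ∫⁻ x, ∫⁻ y, (g x y + h x y) ∂ν ∂μ
      = (∫⁻ x, ∫⁻ y, g x y ∂ν ∂μ) + ∫⁻ x, ∫⁻ y, h x y ∂ν ∂μ := by
  have h1 := lintegral_prod _ hg
  have h2 := lintegral_prod _ hh
  have h3 := lintegral_prod _ (hg.add hh)
  simp only [Function.uncurry, Pi.add_apply] at h1 h2 h3
  rw [← h1, ← h2, ← h3]
  exact lintegral_add_left' hg _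

/-- The chain rule for the power `u^{[m]}`, as a function of `u^{[(m+1)/2]}`, in space-time. -/
lemma MemLpW1pZero.spow_comp (hU : Bornology.IsBounded U) (hm : 0 < m) {p : ℝ} (hp : 1 ≤ p)
    (hp2 : p ≤ 2) (hp1 : m = 1 → p = 2) {T : ℝ} {u : ℝ → Space d → ℝ} {G : ℝ → Space d → Space d}
    (hu : AEMeasurable (fun y : ℝ × Space d => u y.1 y.2)
      ((volume.restrict (Icc 0 T)).prod (volume.restrict U)))
    (h : MemLpW1pZero U T 2 (fun t x => spow ((m + 1) / 2) (u t x)) G)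
    (hfin : normPowLpW1p U T p (fun t x => spow m (u t x))
      (fun t x => (2 * m / (m + 1) * |u t x| ^ ((m - 1) / 2)) • G t x) < ⊤) :
    MemLpW1pZero U T p (fun t x => spow m (u t x))
      (fun t x => (2 * m / (m + 1) * |u t x| ^ ((m - 1) / 2)) • G t x) := by
  have h1 : AEStronglyMeasurable (fun y : ℝ × Space d => spow m (u y.1 y.2))
      ((volume.restrict (Icc 0 T)).prod (volume.restrict U)) :=
    ((measurable_spow m).comp_aemeasurable hu).aestronglyMeasurable
  have h2 : AEStronglyMeasurable (fun y : ℝ × Space d =>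
      (2 * m / (m + 1) * |u y.1 y.2| ^ ((m - 1) / 2)) • G y.1 y.2)
      ((volume.restrict (Icc 0 T)).prod (volume.restrict U)) :=
    (((hu.abs).pow_const _).const_mul _).aestronglyMeasurable.smul h.aestronglyMeasurable_grad
  refine ⟨h1, h2, ?_, hfin⟩
  have hmeas : AEMeasurable (fun y : ℝ × Space d => ‖spow m (u y.1 y.2)‖ₑ ^ p
      + ‖(2 * m / (m + 1) * |u y.1 y.2| ^ ((m - 1) / 2)) • G y.1 y.2‖ₑ ^ p)
      ((volume.restrict (Icc 0 T)).prod (volume.restrict U)) :=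
    (h1.enorm.pow_const p).add (h2.enorm.pow_const p)
  have hslice := ae_lt_top' hmeas.lintegral_prod_right' hfin.ne
  have hpt : ENNReal.ofReal p ≠ ⊤ := ENNReal.ofReal_ne_top
  have hp0 : 0 < p := by linarith
  filter_upwards [hslice, h.mem, h1.prodMk_left, h2.prodMk_left] with t ht hmem hm1 hm2
  have hf : MemLp (fun x => spow m (u t x)) (ENNReal.ofReal p)
      (volume.restrict U) := by
    refine ⟨hm1, ?_⟩
    have h3 := lt_of_le_of_lt (lintegral_mono fun x => le_self_add) ht
    rw [lintegral_enorm_rpow_eq_eLpNorm_rpow _ hp0] at h3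
    exact (ENNReal.rpow_lt_top_iff_of_pos hp0).1 h3
  have hg : MemLp (fun x => (2 * m / (m + 1) * |u t x| ^ ((m - 1) / 2)) • G t x)
      (ENNReal.ofReal p) (volume.restrict U) := by
    refine ⟨hm2, ?_⟩
    have h3 := lt_of_le_of_lt (lintegral_mono fun x => le_add_self) ht
    rw [lintegral_enorm_rpow_eq_eLpNorm_rpow _ hp0] at h3
    exact (ENNReal.rpow_lt_top_iff_of_pos hp0).1 h3
  rcases eq_or_ne m 1 with rfl | hne
  · rw [hp1 rfl]
    have e1 : ((1 : ℝ) + 1) / 2 = 1 := by norm_num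
    have e2 : (2 : ℝ) / (1 + 1) = 1 := by norm_num
    simpa [e1, e2] using hmem
  · have hθ1 : 2 * m / (m + 1) ≠ 1 := by
      rw [Ne, div_eq_one_iff_eq (by linarith)]
      intro h0
      exact hne (by linarith)
    have hθ2 : 2 * m / (m + 1) ≤ 2 := by rw [div_le_iff₀ (by linarith)]; linarith
    have := hmem.spow_comp hU hp hp2 (θ := 2 * m / (m + 1)) (by positivity) hθ2 hθ1
    simp only [spow_spow hm, abs_spow_rpow hm] at this
    exact this hf hg

/-- Two gradients of the same function in `L²([0,T]; H¹₀(U))` agree, so that bounds pass from one to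
the other. -/
lemma MemLpW1pZero.ae_gradient_eq (hU : IsSmoothBoundedDomain U) {T : ℝ}
    {w : ℝ → Space d → ℝ} {G₁ G₂ : ℝ → Space d → Space d}
    (h₁ : MemLpW1pZero U T 2 w G₁) (h₂ : MemLpW1pZero U T 2 w G₂) :
    ∀ᵐ t ∂(volume.restrict (Icc 0 T)), G₁ t =ᵐ[volume.restrict U] G₂ t := by
  filter_upwards [h₁.mem, h₂.mem] with t ht₁ ht₂
  exact ht₁.gradient_unique hU.isOpen hU.isBounded ht₂

/-- Approximating test functions vanish on the boundary, so the trace is zero. -/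
lemma MemW1pZero.hasTrace_zero (hUo : IsOpen U) {p : ℝ} {w : Space d → ℝ} {G : Space d → Space d}
    (h : MemW1pZero U p w G) : HasTrace U p w fun _ => 0 := by
  obtain ⟨h1, φ, hφ, hlim⟩ := h
  refine ⟨G, h1, φ, fun j => (hφ j).smooth, hlim, ?_⟩
  refine tendsto_const_nhds.congr fun j => ?_
  have h0 : (fun x => φ j x - 0) =ᵐ[(Measure.hausdorffMeasure ((d : ℝ) - 1)).restrict (frontier U)]
      fun _ => (0 : ℝ) := by
    filter_upwards [ae_restrict_mem isClosed_frontier.measurableSet] with x hx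
    rw [sub_zero]
    refine image_eq_zero_of_notMem_tsupport fun hxs => ?_
    rw [hUo.frontier_eq] at hx
    exact hx.2 ((hφ j).support_subset hxs)
  rw [eLpNorm_congr_ae h0]
  simp

lemma rpow_mul_rpow_le_add {x y l : ℝ} (hx : 0 ≤ x) (hy : 0 ≤ y) (h0 : 0 ≤ l) (h1 : l ≤ 1) :
    x ^ (1 - l) * y ^ l ≤ x + y := by
  have := Real.geom_mean_le_arith_mean2_weighted (by linarith : 0 ≤ 1 - l) h0 hx hy (by ring)
  nlinarith [mul_nonneg hx h0, mul_nonneg hy (by linarith : 0 ≤ 1 - l)]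

/-- In the slow diffusion range, Young's inequality bounds the integrand of the norm of `u^{[m]}`
by the energy density. -/
lemma norm_integrand_le (hm : 1 ≤ m) (a : ℝ) (g : Space d) :
    ‖spow m a‖ₑ ^ ((m + 1) / m) + ‖(2 * m / (m + 1) * |a| ^ ((m - 1) / 2)) • g‖ₑ ^ ((m + 1) / m)
      ≤ ENNReal.ofReal 5 * (ENNReal.ofReal (|a| ^ (m + 1)) + ‖g‖ₑ ^ 2) := by
  have hm0 : 0 < m := by linarith
  set p := (m + 1) / m with hp
  have hp0 : 0 ≤ p := by positivity
  have hp2 : p ≤ 2 := by rw [hp, div_le_iff₀ hm0]; linarith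
  have hθ : 2 * m / (m + 1) ≤ 2 := by rw [div_le_iff₀ (by linarith)]; linarith
  rw [← ofReal_norm, ← ofReal_norm, ← ofReal_norm,
    ENNReal.ofReal_rpow_of_nonneg (norm_nonneg _) hp0,
    ENNReal.ofReal_rpow_of_nonneg (norm_nonneg _) hp0, ← ENNReal.ofReal_pow (norm_nonneg _),
    ← ENNReal.ofReal_add (by positivity) (by positivity),
    ← ENNReal.ofReal_add (by positivity) (by positivity), ← ENNReal.ofReal_mul (by norm_num)]
  refine ENNReal.ofReal_le_ofReal ?_
  have e1 : ‖spow m a‖ ^ p = |a| ^ (m + 1) := by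
    rw [Real.norm_eq_abs, abs_spow hm0, ← Real.rpow_mul (abs_nonneg a)]
    congr 1
    rw [hp]; field_simp
  have e2 : ‖(2 * m / (m + 1) * |a| ^ ((m - 1) / 2)) • g‖ ^ p
      = (2 * m / (m + 1)) ^ p * ((|a| ^ (m + 1)) ^ (1 - p / 2) * (‖g‖ ^ 2) ^ (p / 2)) := by
    rw [norm_smul, Real.norm_eq_abs, abs_of_nonneg (by positivity),
      Real.mul_rpow (by positivity) (norm_nonneg _), Real.mul_rpow (by positivity) (by positivity),
      ← Real.rpow_mul (abs_nonneg a), ← Real.rpow_mul (abs_nonneg a), ← Real.rpow_natCast ‖g‖ 2,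
      ← Real.rpow_mul (norm_nonneg g), mul_assoc]
    congr 3
    · rw [hp]; field_simp; ring
    · push_cast; ring
  have e3 : (2 * m / (m + 1)) ^ p ≤ 4 := by
    calc (2 * m / (m + 1)) ^ p ≤ 2 ^ p := by gcongr
      _ ≤ 2 ^ (2 : ℝ) := Real.rpow_le_rpow_of_exponent_le one_le_two hp2
      _ = 4 := by norm_num
  have e4 := rpow_mul_rpow_le_add (x := |a| ^ (m + 1)) (y := ‖g‖ ^ 2) (l := p / 2) (by positivity)
    (by positivity) (by positivity) (by linarith)
  rw [e1, e2]
  have e5 : 0 ≤ (|a| ^ (m + 1)) ^ (1 - p / 2) * (‖g‖ ^ 2) ^ (p / 2) := by positivity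
  have e6 : (0 : ℝ) ≤ ‖g‖ ^ 2 := by positivity
  have := mul_le_mul e3 e4 e5 (by norm_num)
  linarith

lemma norm_integrand_eq (hm : 0 < m) (a : ℝ) (g : Space d) :
    ‖spow m a‖ₑ ^ (2 : ℝ) + ‖(2 * m / (m + 1) * |a| ^ ((m - 1) / 2)) • g‖ₑ ^ (2 : ℝ)
      = ENNReal.ofReal (|a| ^ (2 * m)) + ENNReal.ofReal ((2 * m / (m + 1)) ^ 2) *
        (ENNReal.ofReal (|a| ^ (m - 1)) * ‖g‖ₑ ^ 2) := by
  rw [ENNReal.rpow_two, ENNReal.rpow_two, enorm_smul, mul_pow, enorm_sq_eq_ofReal,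
    enorm_sq_eq_ofReal, ← mul_assoc, ← ENNReal.ofReal_mul (by positivity), mul_pow,
    ← sq_abs (spow m a), abs_spow hm, ← Real.rpow_natCast (|a| ^ m), ← Real.rpow_mul (abs_nonneg a),
    ← Real.rpow_natCast (|a| ^ _), ← Real.rpow_mul (abs_nonneg a),
    show m * ((2 : ℕ) : ℝ) = 2 * m by push_cast; ring,
    show (m - 1) / 2 * ((2 : ℕ) : ℝ) = m - 1 by push_cast; ring,
    ENNReal.ofReal_mul (sq_nonneg _), mul_assoc]

lemma exists_norm_bound_of_one_le (hd : 1 ≤ d) (hU : IsSmoothBoundedDomain U)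
    (hf : ∀ k, IsCb2 U (f k)) (hz : ContinuousOn z (Ici 0)) (hm : 1 ≤ m) {T : ℝ} (hT : 0 < T) :
    ∃ C : ℝ, 0 < C ∧ ∀ (u₀ : Space d → ℝ) (u : ℝ → Space d → ℝ) (G₀ : ℝ → Space d → Space d)
      (p : Measure (Space d × ℝ × ℝ)) (B : Set ℝ), IsKineticEvolution m U f z u₀ u G₀ p B →
      ∀ G : ℝ → Space d → Space d,
        MemLpW1pZero U T 2 (fun t x => spow ((m + 1) / 2) (u t x)) G →
        normPowLpW1p U T (pExp m) (fun t x => spow m (u t x))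
            (fun t x => (2 * m / (m + 1) * |u t x| ^ ((m - 1) / 2)) • G t x)
          ≤ ENNReal.ofReal C * eLpNorm u₀ 2 (volume.restrict U) ^ (2 : ℝ) := by
  have hm0 : 0 < m := by linarith
  obtain ⟨C1, hC1, h1⟩ := exists_gradient_bound hd hU hf hz hm0 hT
  obtain ⟨C2, hC2, h2⟩ := exists_spaceTime_poincare hd hU hm0
  refine ⟨5 * ((C2 + 1) * C1), by positivity, fun u₀ u G₀ p B hev G hG => ?_⟩
  have hgrad : ∫⁻ r in Icc 0 T, ∫⁻ x in U, ‖G r x‖ₑ ^ 2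
      = ∫⁻ r in Icc 0 T, ∫⁻ x in U, ‖G₀ r x‖ₑ ^ 2 := by
    refine lintegral_congr_ae ?_
    filter_upwards [hG.ae_gradient_eq hU (hev.mem T hT)] with t ht
    exact lintegral_congr_ae (by filter_upwards [ht] with x hx; rw [hx])
  have hu := hev.aemeasurable_Icc T
  rw [pExp_of_one_le hm, normPowLpW1p, ENNReal.rpow_two, ← lintegral_enorm_sq_eq_eLpNorm_sq]
  calc _ ≤ ∫⁻ r in Icc 0 T, ∫⁻ x in U, ENNReal.ofReal 5 *
          (ENNReal.ofReal (|u r x| ^ (m + 1)) + ‖G r x‖ₑ ^ 2) :=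
        lintegral_mono fun r => lintegral_mono fun x => norm_integrand_le hm _ _
    _ = ENNReal.ofReal 5 * ∫⁻ r in Icc 0 T, ∫⁻ x in U,
          (ENNReal.ofReal (|u r x| ^ (m + 1)) + ‖G r x‖ₑ ^ 2) := by
        rw [← lintegral_const_mul' _ _ ENNReal.ofReal_ne_top]
        exact lintegral_congr fun r => lintegral_const_mul' _ _ ENNReal.ofReal_ne_top
    _ = ENNReal.ofReal 5 * ((∫⁻ r in Icc 0 T, ∫⁻ x in U, ENNReal.ofReal (|u r x| ^ (m + 1)))
          + ∫⁻ r in Icc 0 T, ∫⁻ x in U, ‖G r x‖ₑ ^ 2) := by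
        rw [lintegral_lintegral_add_left' (((hu.abs).pow_const _).ennreal_ofReal)
          (hG.aestronglyMeasurable_grad.enorm.pow_const 2)]
    _ ≤ ENNReal.ofReal 5 * (ENNReal.ofReal C2 * (ENNReal.ofReal C1 * ∫⁻ x in U, ‖u₀ x‖ₑ ^ 2)
          + ENNReal.ofReal C1 * ∫⁻ x in U, ‖u₀ x‖ₑ ^ 2) := by
        have h3 : ∫⁻ r in Icc 0 T, ∫⁻ x in U, ‖G r x‖ₑ ^ 2
            ≤ ENNReal.ofReal C1 * ∫⁻ x in U, ‖u₀ x‖ₑ ^ 2 := hgrad.trans_le (h1 u₀ u G₀ p B hev)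
        gcongr
        exact (h2 u G T hG).trans (mul_le_mul_right h3 _)
    _ = _ := by
        rw [ENNReal.ofReal_mul (by norm_num), ENNReal.ofReal_mul (by positivity),
          ENNReal.ofReal_add hC2.le zero_le_one, ENNReal.ofReal_one]
        ring

lemma exists_norm_bound_of_lt_one (hd : 1 ≤ d) (hU : IsSmoothBoundedDomain U)
    (hf : ∀ k, IsCb2 U (f k)) (hz : ContinuousOn z (Ici 0)) (hm : 0 < m) (hm1 : m < 1) {T : ℝ}
    (hT : 0 < T) :
    ∃ C : ℝ, 0 < C ∧ ∀ (u₀ : Space d → ℝ) (u : ℝ → Space d → ℝ) (G₀ : ℝ → Space d → Space d)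
      (p : Measure (Space d × ℝ × ℝ)) (B : Set ℝ), IsKineticEvolution m U f z u₀ u G₀ p B →
      ∀ G : ℝ → Space d → Space d,
        MemLpW1pZero U T 2 (fun t x => spow ((m + 1) / 2) (u t x)) G →
        normPowLpW1p U T 2 (fun t x => spow m (u t x))
            (fun t x => (2 * m / (m + 1) * |u t x| ^ ((m - 1) / 2)) • G t x)
          ≤ ENNReal.ofReal C *
            (eLpNorm u₀ (ENNReal.ofReal (1 + m)) (volume.restrict U) ^ (1 + m)
              + eLpNorm u₀ 2 (volume.restrict U) ^ (4 * m / (m + 1))) := by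
  obtain ⟨C1, hC1, h1⟩ := exists_sublinear_bound hd hU hf hz hm hm1 hT
  obtain ⟨C2, hC2, h2⟩ := exists_weighted_gradient_bound hd hU hf hz hm hm1 hT
  set θ : ℝ := 2 * m / (m + 1) with hθ
  refine ⟨C1 + θ ^ 2 * C2, by positivity, fun u₀ u G₀ p B hev G hG => ?_⟩
  have hgrad : ∫⁻ r in Icc 0 T, ∫⁻ x in U, ENNReal.ofReal (|u r x| ^ (m - 1)) * ‖G r x‖ₑ ^ 2
      = ∫⁻ r in Icc 0 T, ∫⁻ x in U, ENNReal.ofReal (|u r x| ^ (m - 1)) * ‖G₀ r x‖ₑ ^ 2 := by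
    refine lintegral_congr_ae ?_
    filter_upwards [hG.ae_gradient_eq hU (hev.mem T hT)] with t ht
    exact lintegral_congr_ae (by filter_upwards [ht] with x hx; rw [hx])
  have hu := hev.aemeasurable_Icc T
  have e1 : eLpNorm u₀ (ENNReal.ofReal (1 + m)) (volume.restrict U) ^ (1 + m)
      = ∫⁻ x in U, ENNReal.ofReal (|u₀ x| ^ (m + 1)) := by
    rw [← lintegral_enorm_rpow_eq_eLpNorm_rpow _ (by linarith)]
    refine lintegral_congr fun x => ?_
    rw [Real.enorm_eq_ofReal_abs, ENNReal.ofReal_rpow_of_nonneg (abs_nonneg _) (by linarith),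
      add_comm]
  have e2 : eLpNorm u₀ 2 (volume.restrict U) ^ (4 * m / (m + 1))
      = (∫⁻ x in U, ‖u₀ x‖ₑ ^ 2) ^ θ := by
    rw [lintegral_enorm_sq_eq_eLpNorm_sq, ← ENNReal.rpow_natCast, ← ENNReal.rpow_mul]
    congr 1
    rw [hθ]; push_cast; ring
  rw [e1, e2]
  set A := ∫⁻ x in U, ENNReal.ofReal (|u₀ x| ^ (m + 1))
  set W := (∫⁻ x in U, ‖u₀ x‖ₑ ^ 2) ^ θ
  calc _ = ∫⁻ r in Icc 0 T, ∫⁻ x in U, (ENNReal.ofReal (|u r x| ^ (2 * m)) +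
          ENNReal.ofReal (θ ^ 2) * (ENNReal.ofReal (|u r x| ^ (m - 1)) * ‖G r x‖ₑ ^ 2)) :=
        lintegral_congr fun r => lintegral_congr fun x => norm_integrand_eq hm _ _
    _ = (∫⁻ r in Icc 0 T, ∫⁻ x in U, ENNReal.ofReal (|u r x| ^ (2 * m))) +
          ∫⁻ r in Icc 0 T, ∫⁻ x in U,
            ENNReal.ofReal (θ ^ 2) * (ENNReal.ofReal (|u r x| ^ (m - 1)) * ‖G r x‖ₑ ^ 2) :=
        lintegral_lintegral_add_left' ((hu.abs).pow_const _).ennreal_ofReal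
          (((((hu.abs).pow_const _).ennreal_ofReal).mul
            (hG.aestronglyMeasurable_grad.enorm.pow_const 2)).const_mul _)
    _ = (∫⁻ r in Icc 0 T, ∫⁻ x in U, ENNReal.ofReal (|u r x| ^ (2 * m))) +
          ENNReal.ofReal (θ ^ 2) * ∫⁻ r in Icc 0 T, ∫⁻ x in U,
            ENNReal.ofReal (|u r x| ^ (m - 1)) * ‖G r x‖ₑ ^ 2 := by
        congr 1
        rw [← lintegral_const_mul' _ _ ENNReal.ofReal_ne_top]
        exact lintegral_congr fun r => lintegral_const_mul' _ _ ENNReal.ofReal_ne_top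
    _ ≤ ENNReal.ofReal C1 * (A + W) + ENNReal.ofReal (θ ^ 2) * (ENNReal.ofReal C2 * (A + W)) := by
        rw [hgrad]
        gcongr
        · exact (h1 u₀ u G₀ p B hev).trans (mul_le_mul_right le_add_self _)
        · exact h2 u₀ u G₀ p B hev
    _ = _ := by
        rw [ENNReal.ofReal_add hC1.le (by positivity), ENNReal.ofReal_mul (sq_nonneg θ)]
        ring

/-- The power `u^{[m]}` of a kinetic solution lies in the Sobolev space of exponent `p_m`. -/
lemma IsKineticEvolution.memLpW1pZero_spow (hd : 1 ≤ d) (hU : IsSmoothBoundedDomain U)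
    (hf : ∀ k, IsCb2 U (f k)) (hz : ContinuousOn z (Ici 0)) (hm : 0 < m) {u₀ : Space d → ℝ}
    {u : ℝ → Space d → ℝ} {G₀ : ℝ → Space d → Space d} {p : Measure (Space d × ℝ × ℝ)} {B : Set ℝ}
    (hev : IsKineticEvolution m U f z u₀ u G₀ p B) {T : ℝ} (hT : 0 < T)
    {G : ℝ → Space d → Space d}
    (hG : MemLpW1pZero U T 2 (fun t x => spow ((m + 1) / 2) (u t x)) G) :
    MemLpW1pZero U T (pExp m) (fun t x => spow m (u t x))
      (fun t x => (2 * m / (m + 1) * |u t x| ^ ((m - 1) / 2)) • G t x) := by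
  refine hG.spow_comp hU.isBounded hm (one_le_pExp hm) pExp_le_two
    (fun h => pExp_of_le_one hm h.le) (hev.aemeasurable_Icc T) ?_
  rcases le_or_gt 1 m with hm1 | hm1
  · obtain ⟨C, -, hC⟩ := exists_norm_bound_of_one_le hd hU hf hz hm1 hT
    refine lt_of_le_of_lt (hC u₀ u G₀ p B hev G hG) (ENNReal.mul_lt_top ENNReal.ofReal_lt_top ?_)
    exact ENNReal.rpow_lt_top_of_nonneg zero_le_two hev.memLp_init.2.ne
  · obtain ⟨C, -, hC⟩ := exists_norm_bound_of_lt_one hd hU hf hz hm hm1 hT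
    rw [pExp_of_le_one hm hm1.le]
    have : IsFiniteMeasure ((volume : Measure (Space d)).restrict U) :=
      ⟨by rw [Measure.restrict_apply_univ]; exact hU.isBounded.measure_lt_top⟩
    have hL : MemLp u₀ (ENNReal.ofReal (1 + m)) (volume.restrict U) := by
      refine hev.memLp_init.mono_exponent ?_
      rw [← ENNReal.ofReal_ofNat 2]
      exact ENNReal.ofReal_le_ofReal (by linarith)
    refine lt_of_le_of_lt (hC u₀ u G₀ p B hev G hG) (ENNReal.mul_lt_top ENNReal.ofReal_lt_top
      (ENNReal.add_lt_top.2 ⟨?_, ?_⟩))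
    · exact ENNReal.rpow_lt_top_of_nonneg (by linarith) hL.2.ne
    · exact ENNReal.rpow_lt_top_of_nonneg (by positivity) hev.memLp_init.2.ne

end Conclusion

end PathwiseKinetic

open PathwiseKinetic

theorem lemmaA1 (d n : ℕ) (hd : 1 ≤ d) (m : ℝ) (hm : 0 < m)
    (U : Set (Space d)) (hU : IsSmoothBoundedDomain U)
    (f : Fin n → Space d → ℝ) (hf : ∀ k, IsCb2 U (f k))
    (z : ℝ → Fin n → ℝ) (hz : ContinuousOn z (Ici 0)) :
    (∀ T : ℝ, 0 < T → ∃ C : ℝ, 0 < C ∧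
      ∀ (u₀ : Space d → ℝ) (u : ℝ → Space d → ℝ), MemLp u₀ 2 (volume.restrict U) →
        IsPathwiseKineticSolution m U f z u₀ u →
        ∀ G : ℝ → Space d → Space d,
          MemLpW1pZero U T 2 (fun t x => spow ((m + 1) / 2) (u t x)) G →
          MemLpW1pZero U T (pExp m) (fun t x => spow m (u t x))
            (fun t x => (2 * m / (m + 1) * |u t x| ^ ((m - 1) / 2)) • G t x) ∧
          (1 ≤ m →
            normPowLpW1p U T (pExp m) (fun t x => spow m (u t x))
                (fun t x => (2 * m / (m + 1) * |u t x| ^ ((m - 1) / 2)) • G t x)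
              ≤ ENNReal.ofReal C * eLpNorm u₀ 2 (volume.restrict U) ^ (2 : ℝ)) ∧
          (m < 1 →
            normPowLpW1p U T 2 (fun t x => spow m (u t x))
                (fun t x => (2 * m / (m + 1) * |u t x| ^ ((m - 1) / 2)) • G t x)
              ≤ ENNReal.ofReal C *
                (eLpNorm u₀ (ENNReal.ofReal (1 + m)) (volume.restrict U) ^ (1 + m)
                  + eLpNorm u₀ 2 (volume.restrict U) ^ (4 * m / (m + 1))))) ∧
    (∀ (u₀ : Space d → ℝ) (u : ℝ → Space d → ℝ), MemLp u₀ 2 (volume.restrict U) →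
      IsPathwiseKineticSolution m U f z u₀ u →
      ∀ᵐ t ∂(volume.restrict (Ioi (0 : ℝ))),
        HasTrace U (pExp m) (fun x => spow m (u t x)) (fun _ => 0)) := by
  refine ⟨fun T hT => ?_, fun u₀ u hu₀ hu => ?_⟩
  · rcases le_or_gt 1 m with hm1 | hm1
    · obtain ⟨C, hC, hb⟩ := exists_norm_bound_of_one_le hd hU hf hz hm1 hT
      refine ⟨C, hC, fun u₀ u hu₀ hu G hG => ?_⟩
      obtain ⟨G₀, p, B, hev⟩ := hu.exists_evolution hu₀
      exact ⟨hev.memLpW1pZero_spow hd hU hf hz hm hT hG, fun _ => hb u₀ u G₀ p B hev G hG,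
        fun h => absurd h hm1.not_gt⟩
    · obtain ⟨C, hC, hb⟩ := exists_norm_bound_of_lt_one hd hU hf hz hm hm1 hT
      refine ⟨C, hC, fun u₀ u hu₀ hu G hG => ?_⟩
      obtain ⟨G₀, p, B, hev⟩ := hu.exists_evolution hu₀
      exact ⟨hev.memLpW1pZero_spow hd hU hf hz hm hT hG, fun h => absurd h hm1.not_ge,
        fun _ => hb u₀ u G₀ p B hev G hG⟩
  · obtain ⟨G₀, p, B, hev⟩ := hu.exists_evolution hu₀
    have hk : ∀ᵐ t ∂(volume.restrict (⋃ k : ℕ, Icc (0 : ℝ) (k + 1))),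
        HasTrace U (pExp m) (fun x => spow m (u t x)) fun _ => 0 := by
      rw [ae_restrict_iUnion_iff]
      intro k
      have hk0 : (0 : ℝ) < k + 1 := by positivity
      filter_upwards [(hev.memLpW1pZero_spow hd hU hf hz hm hk0 (hev.mem _ hk0)).mem] with t ht
      exact ht.hasTrace_zero hU.isOpen
    refine ae_restrict_of_ae_restrict_of_subset (fun t ht => ?_) hk
    obtain ⟨k, hk⟩ := exists_nat_ge t
    exact mem_iUnion.2 ⟨k, le_of_lt ht, by linarith⟩
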